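/- Let $\mathcal V$ be a complete symmetric monoidal closed category. A $\mathcal V$-category is *small* if its objects form a small set; $A$, $K$ below denote small $\mathcal V$-categories. For $F:K\to\mathcal V$ and $G:K\to B$, the limit $\{F,G\}$ is an object $b$ of $B$ with a $\mathcal V$-natural $F\to B(b,G-)$ inducing isomorphisms $B(x,b)\cong[K,\mathcal V](F,B(x,G-))$ for all $x$; for $F:K^{op}\to\mathcal V$ and $G:K\to B$, the colimit $F*G$ is an object $b$ with a $\mathcal V$-natural $F\to B(G-,b)$ inducing isomorphisms $B(b,x)\cong[K^{op},\mathcal V](F,B(G-,x))$ for all $x$. If $\Phi$ is a class of such indexes $F$, a $\mathcal V$-functor is $\Phi$-(co)continuous if it preserves all existing (co)limits with index in $\Phi$, and $B$ is $\Phi$-cocomplete if it has all colimits with index in $\Phi$. A left Kan extension of $G:A\to B$ along $J:A\to C$ is a $\mathcal V$-functor $L:C\to B$ with a $\mathcal V$-natural $G\to LJ$ that exhibits $Lc$ as $C(J-,c)*G$ for every object $c$ of $C$. Let $\mathcal P$ be any class of indexes $K\to\mathcal V$ ($K$ small). A presheaf $F:A^{op}\to\mathcal V$ is *$\mathcal P$-flat*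 if it has a left Kan extension $-*F:[A,\mathcal V]\to\mathcal V$ along the Yoneda embedding $A^{op}\to[A,\mathcal V]$ and this functor preserves all $\mathcal P$-limits. Let $\mathrm{Flat}_{\mathcal P}$ be the class of all $\mathcal P$-flat presheaves on small $\mathcal V$-categories, and $\mathrm{Flat}_{\mathcal P}(A)$ the full subcategory of $[A^{op},\mathcal V]$ on the $\mathcal P$-flat presheaves on $A$. **Theorem.** For every class $\mathcal P$ of indexes and every small $\mathcal V$-category $A$, $\mathrm{Flat}_{\mathcal P}(A)$ is the free $\mathrm{Flat}_{\mathcal P}$-cocompletion of $A$. That is: 1. $\mathrm{Flat}_{\mathcal P}(A)$ is the closure of $A$ under $\mathrm{Flat}_{\mathcal P}$-colimits in $[A^{op},\mathcal V]$, i.e. the smallest full replete subcategory of $[A^{op},\mathcal V]$ that contains the representables and is closed under the formation of $\mathrm{Flat}_{\mathcal P}$-colimits in $[A^{op},\mathcal V]$. In particular there is a functor $J:A\to\mathrm{Flat}_{\mathcal P}(A)$, $a\mapsto A(-,a)$; it is fully faithful. 2. $\mathrm{Flat}_{\mathcal P}(A)$ is $\mathrm{Flat}_{\mathcal P}$-cocomplete.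 3. Let $B$ be any, possibly large, $\mathcal V$-category. Let $[A,B]'$ be the full subcategory of $[A,B]$ on the functors that admit a left Kan extension along $J$, and let $\mathrm{Flat}_{\mathcal P}\text{-}\mathrm{Cocts}[\mathrm{Flat}_{\mathcal P}(A),B]$ be the full subcategory of $[\mathrm{Flat}_{\mathcal P}(A),B]$ on the $\mathrm{Flat}_{\mathcal P}$-cocontinuous functors; the hom-objects (ends in $\mathcal V$) of the latter exist, so that it is a $\mathcal V$-category. Restriction along $J$ gives a $\mathcal V$-functor $\mathrm{Flat}_{\mathcal P}\text{-}\mathrm{Cocts}[\mathrm{Flat}_{\mathcal P}(A),B]\to[A,B]'$, and there is a left Kan extension $\mathcal V$-functor $\mathrm{Lan}_J:[A,B]'\to\mathrm{Flat}_{\mathcal P}\text{-}\mathrm{Cocts}[\mathrm{Flat}_{\mathcal P}(A),B]$; both composites are $\mathcal V$-naturally isomorphic to the identity, the isomorphism $1\cong(\mathrm{Lan}_J-)J$ having as its components the units of the Kan extensions. So these two $\mathcal V$-categories are equivalent. 4. If $B$ is $\mathrm{Flat}_{\mathcal P}$-cocomplete, then $[A,B]'=[A,B]$. -/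

import Mathlib

open CategoryTheory MonoidalCategory Opposite

universe v u w w₁ w₂

set_option linter.unusedSectionVars false

/- A symmetric monoidal closed category `V` is regarded as a `V`-category through its internal
hom. -/
attribute [local instance] MonoidalClosed.enrichedCategorySelf

namespace EnrichedFlat

noncomputable section

section Basic

variable {V : Type u} [Category.{v} V] [MonoidalCategory V]
variable {D : Type w} [EnrichedCategory V D]

theorem tensor_eComp_assoc {X Y Z W : D} {P Q R : V} (f : P ⟶ (X ⟶[V] Y)) (g : Q ⟶ (Y ⟶[V] Z))
    (h : R ⟶ (Z ⟶[V] W)) :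
    (((f ⊗ₘ g) ≫ eComp V X Y Z) ⊗ₘ h) ≫ eComp V X Z W =
      (α_ P Q R).hom ≫ (f ⊗ₘ ((g ⊗ₘ h) ≫ eComp V Y Z W)) ≫ eComp V X Y W := by
  have h1 := e_assoc' V X Y Z W
  calc _ = ((f ⊗ₘ g) ⊗ₘ h) ≫ (eComp V X Y Z ▷ _) ≫ eComp V X Z W := by
        rw [← MonoidalCategory.tensorHom_id, MonoidalCategory.tensorHom_comp_tensorHom_assoc,
          Category.comp_id]
    _ = _ := by
        rw [← h1, MonoidalCategory.associator_naturality_assoc, ← MonoidalCategory.id_tensorHom,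
          MonoidalCategory.tensorHom_comp_tensorHom_assoc, Category.comp_id]

end Basic

section NatHom

variable {V : Type u} [Category.{v} V] [MonoidalCategory V] [BraidedCategory V]
variable {C : Type w} [EnrichedCategory V C] {D : Type w₁} [EnrichedCategory V D]

/-- The `V`-object `∫_c D(F c, G c)` of `V`-natural transformations exists: the functor sending `Z`
to the set of `Z`-indexed `V`-natural families `Z ⟶ D(F c, G c)` is representable. -/
class HasNatHom (F G : EnrichedFunctor V C D) : Prop where
  isRepresentable : (enrichedNatTransYoneda F G).IsRepresentable

attribute [instance] HasNatHom.isRepresentable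

/-- The `V`-object `[C, D](F, G) = ∫_c D(F c, G c)`. -/
def natHom (F G : EnrichedFunctor V C D) [HasNatHom F G] : V :=
  (enrichedNatTransYoneda F G).reprX

namespace natHom

/-- `V`-naturality of a family `Z ⟶ D(F c, G c)`. -/
def IsNatural (F G : EnrichedFunctor V C D) {Z : V} (app : ∀ c, Z ⟶ (F.obj c ⟶[V] G.obj c)) :
    Prop :=
  ∀ c d : C, (β_ Z (c ⟶[V] d)).hom ≫ (F.map c d ⊗ₘ app d) ≫ eComp V _ _ _ =
    (app c ⊗ₘ G.map c d) ≫ eComp V _ _ _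

theorem IsNatural.precomp {F G : EnrichedFunctor V C D} {Z W : V} (f : W ⟶ Z)
    {app : ∀ c, Z ⟶ (F.obj c ⟶[V] G.obj c)} (h : IsNatural F G app) :
    IsNatural F G (fun c => f ≫ app c) :=
  ((enrichedNatTransYoneda F G).map f.op ⟨app, h⟩).naturality

theorem hasNatHom_of_universal {F G : EnrichedFunctor V C D} (E : V)
    (p : ∀ c, E ⟶ (F.obj c ⟶[V] G.obj c)) (hp : IsNatural F G p)
    (h : ∀ (Z : V) (app : ∀ c, Z ⟶ (F.obj c ⟶[V] G.obj c)), IsNatural F G app →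
      ∃! f : Z ⟶ E, ∀ c, f ≫ p c = app c) : HasNatHom F G where
  isRepresentable :=
    { has_representation := ⟨E, ⟨
        { homEquiv := fun {Z} => Equiv.ofBijective
            (fun f => (⟨fun c => f ≫ p c, hp.precomp f⟩ :
              GradedNatTrans ((Center.ofBraided V).obj Z) F G))
            ⟨fun f g hfg => (h Z (fun c => g ≫ p c) (hp.precomp g)).unique
              (fun c => congrArg (fun t => GradedNatTrans.app t c) hfg) (fun _ => rfl),
            fun σ => by
              obtain ⟨f, hf, -⟩ := h Z σ.app σ.naturality
              exact ⟨f, GradedNatTrans.ext (funext hf)⟩⟩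
          homEquiv_comp := fun f g => GradedNatTrans.ext (funext fun c => Category.assoc f g (p c))
          }⟩⟩ }

variable (F G : EnrichedFunctor V C D) [HasNatHom F G]

/-- The projections `[C, D](F, G) ⟶ D(F c, G c)`. -/
def π (c : C) : natHom F G ⟶ (F.obj c ⟶[V] G.obj c) :=
  ((enrichedNatTransYoneda F G).representableBy.homEquiv (𝟙 _)).app c

theorem π_natural : IsNatural F G (π F G) :=
  ((enrichedNatTransYoneda F G).representableBy.homEquiv (𝟙 _)).naturality

variable {F G}

/-- The morphism into `[C, D](F, G)` induced by a `V`-natural family. -/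
def lift {Z : V} (app : ∀ c, Z ⟶ (F.obj c ⟶[V] G.obj c)) (h : IsNatural F G app) :
    Z ⟶ natHom F G :=
  (enrichedNatTransYoneda F G).representableBy.homEquiv.symm ⟨app, h⟩

@[simp]
theorem lift_π {Z : V} (app : ∀ c, Z ⟶ (F.obj c ⟶[V] G.obj c)) (h : IsNatural F G app) (c : C) :
    lift app h ≫ π F G c = app c := by
  have h1 := (enrichedNatTransYoneda F G).representableBy.homEquiv_eq (lift app h)
  have h2 : (enrichedNatTransYoneda F G).representableBy.homEquiv (lift app h) = ⟨app, h⟩ :=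
    Equiv.apply_symm_apply _ _
  have := congrArg (fun t => GradedNatTrans.app t c) (h1.symm.trans h2)
  exact this

theorem hom_ext {Z : V} {f g : Z ⟶ natHom F G} (h : ∀ c, f ≫ π F G c = g ≫ π F G c) : f = g := by
  apply (enrichedNatTransYoneda F G).representableBy.homEquiv.injective
  rw [(enrichedNatTransYoneda F G).representableBy.homEquiv_eq f,
    (enrichedNatTransYoneda F G).representableBy.homEquiv_eq g]
  exact GradedNatTrans.ext (funext h)

theorem isNatural_id (F : EnrichedFunctor V C D) : IsNatural F F (fun c => eId V (F.obj c)) := by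
  intro c d
  have h1 := e_comp_id V (F.obj c) (F.obj d)
  have h2 := e_id_comp V (F.obj c) (F.obj d)
  rw [Iso.inv_comp_eq, Category.comp_id] at h1 h2
  rw [MonoidalCategory.tensorHom_def (F.map c d), MonoidalCategory.tensorHom_def' _ (F.map c d),
    Category.assoc, Category.assoc, h1, h2]
  simp

theorem isNatural_comp {F G H : EnrichedFunctor V C D} {Z W : V}
    {σ : ∀ c, Z ⟶ (F.obj c ⟶[V] G.obj c)} {τ : ∀ c, W ⟶ (G.obj c ⟶[V] H.obj c)}
    (hσ : IsNatural F G σ) (hτ : IsNatural G H τ) :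
    IsNatural F H (fun c => (σ c ⊗ₘ τ c) ≫ eComp V _ _ _) := by
  intro c d
  have e1 := hσ c d
  have e2 := hτ c d
  rw [BraidedCategory.braiding_tensor_left_hom]
  simp only [Category.assoc]
  have k1 := tensor_eComp_assoc (F.map c d) (σ d) (τ d)
  have k2 := tensor_eComp_assoc (σ c) (G.map c d) (τ d)
  have k3 := tensor_eComp_assoc (σ c) (τ c) (H.map c d)
  rw [k3, ← e2, ← k1, ← MonoidalCategory.tensorHom_id,
    MonoidalCategory.tensorHom_comp_tensorHom_assoc, Category.id_comp, e1, k2,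
    Iso.inv_hom_id_assoc, ← MonoidalCategory.id_tensorHom,
    MonoidalCategory.tensorHom_comp_tensorHom_assoc, Category.id_comp]

end natHom
end NatHom

section FunctorCategory

variable {V : Type u} [Category.{v} V] [MonoidalCategory V] [BraidedCategory V]
variable {C : Type w} [EnrichedCategory V C] {D : Type w₁} [EnrichedCategory V D]

/-- A class of `V`-functors `C → D` such that all `V`-objects of `V`-natural transformations
between its members exist. -/
class HasNatHoms (W : EnrichedFunctor V C D → Prop) : Prop where
  hasNatHom : ∀ F G : EnrichedFunctor V C D, W F → W G → HasNatHom F G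

/-- The composition `[C, D](F, G) ⊗ [C, D](G, H) ⟶ [C, D](F, H)`. -/
def natHom.comp (F G H : EnrichedFunctor V C D) [HasNatHom F G] [HasNatHom G H] [HasNatHom F H] :
    natHom F G ⊗ natHom G H ⟶ natHom F H :=
  natHom.lift (fun c => (natHom.π F G c ⊗ₘ natHom.π G H c) ≫ eComp V _ _ _)
    (natHom.isNatural_comp (natHom.π_natural F G) (natHom.π_natural G H))

/-- The full `V`-category of `V`-functors `C → D` spanned by a family of functors, as soon as the
`V`-objects of `V`-natural transformations exist. -/
@[reducible]
def functorCategory {T : Type w₂} (Φ : T → EnrichedFunctor V C D)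
    (h : ∀ s t, HasNatHom (Φ s) (Φ t)) : EnrichedCategory V T where
  Hom s t := natHom (Φ s) (Φ t)
  id s := natHom.lift (fun c => eId V ((Φ s).obj c)) (natHom.isNatural_id (Φ s))
  comp r s t := natHom.comp (Φ r) (Φ s) (Φ t)
  id_comp s t := by
    apply natHom.hom_ext
    intro c
    simp only [natHom.comp, Category.assoc, natHom.lift_π, Category.id_comp]
    rw [← MonoidalCategory.tensorHom_id, MonoidalCategory.tensorHom_comp_tensorHom_assoc,
      natHom.lift_π, Category.id_comp, MonoidalCategory.tensorHom_def'_assoc,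
      ← MonoidalCategory.leftUnitor_inv_naturality_assoc, e_id_comp, Category.comp_id]
  comp_id s t := by
    apply natHom.hom_ext
    intro c
    simp only [natHom.comp, Category.assoc, natHom.lift_π, Category.id_comp]
    rw [← MonoidalCategory.id_tensorHom, MonoidalCategory.tensorHom_comp_tensorHom_assoc,
      natHom.lift_π, Category.id_comp, MonoidalCategory.tensorHom_def_assoc,
      ← MonoidalCategory.rightUnitor_inv_naturality_assoc, e_comp_id, Category.comp_id]
  assoc q r s t := by
    apply natHom.hom_ext
    intro c
    simp only [natHom.comp, Category.assoc, natHom.lift_π]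
    rw [← MonoidalCategory.id_tensorHom, MonoidalCategory.tensorHom_comp_tensorHom_assoc,
      ← MonoidalCategory.tensorHom_id, MonoidalCategory.tensorHom_comp_tensorHom_assoc,
      natHom.lift_π, natHom.lift_π, Category.id_comp, Category.id_comp, tensor_eComp_assoc,
      Iso.inv_hom_id_assoc]

/-- The `V`-category `[C, D]` of all `V`-functors. -/
instance [h : ∀ F G : EnrichedFunctor V C D, HasNatHom F G] :
    EnrichedCategory V (EnrichedFunctor V C D) where
  Hom F G := natHom F G
  id F := (functorCategory (fun F => F) h).id F
  comp F G H := natHom.comp F G H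
  id_comp := (functorCategory (fun F => F) h).id_comp
  comp_id := (functorCategory (fun F => F) h).comp_id
  assoc := (functorCategory (fun F => F) h).assoc

/-- The type of `V`-functors `C → D` satisfying `W`. -/
structure FunctorSub (W : EnrichedFunctor V C D → Prop) where
  /-- the underlying functor -/
  obj : EnrichedFunctor V C D
  property : W obj

/-- The full subcategory of `[C, D]` on the functors satisfying `W`. -/
instance (W : EnrichedFunctor V C D → Prop) [h : HasNatHoms W] :
    EnrichedCategory V (FunctorSub W) :=
  functorCategory FunctorSub.obj (fun F G => h.hasNatHom _ _ F.property G.property)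

instance (W : EnrichedFunctor V C D → Prop) [h : HasNatHoms W] (F G : FunctorSub W) :
    HasNatHom F.obj G.obj :=
  h.hasNatHom _ _ F.property G.property

/-- The projections `[C, D](F, G) ⟶ D(F c, G c)` for a full subcategory of `[C, D]`. -/
def FunctorSub.π {W : EnrichedFunctor V C D → Prop} [HasNatHoms W] (F G : FunctorSub W) (c : C) :
    (F ⟶[V] G) ⟶ (F.obj.obj c ⟶[V] G.obj.obj c) :=
  natHom.π F.obj G.obj c

theorem FunctorSub.eId_π {W : EnrichedFunctor V C D → Prop} [HasNatHoms W] (F : FunctorSub W)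
    (c : C) : eId V F ≫ FunctorSub.π F F c = eId V (F.obj.obj c) :=
  natHom.lift_π _ _ _

theorem FunctorSub.eComp_π {W : EnrichedFunctor V C D → Prop} [HasNatHoms W]
    (F G H : FunctorSub W) (c : C) : eComp V F G H ≫ FunctorSub.π F H c =
      (FunctorSub.π F G c ⊗ₘ FunctorSub.π G H c) ≫ eComp V _ _ _ :=
  natHom.lift_π _ _ _

theorem eId_π [∀ F G : EnrichedFunctor V C D, HasNatHom F G] (F : EnrichedFunctor V C D) (c : C) :
    eId V F ≫ natHom.π F F c = eId V (F.obj c) :=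
  natHom.lift_π _ _ _

theorem eComp_π [∀ F G : EnrichedFunctor V C D, HasNatHom F G] (F G H : EnrichedFunctor V C D)
    (c : C) : eComp V F G H ≫ natHom.π F H c =
      (natHom.π F G c ⊗ₘ natHom.π G H c) ≫ eComp V _ _ _ :=
  natHom.lift_π _ _ _

end FunctorCategory

section Small

variable {V : Type u} [Category.{v} V] [MonoidalCategory V] [SymmetricCategory V]
  [MonoidalClosed V] [Limits.HasLimits V]
variable {C : Type v} [EnrichedCategory V C] {D : Type w₁} [EnrichedCategory V D]

section

variable (F G : EnrichedFunctor V C D)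

/-- The first of the two maps whose equalizer is `[C, D](F, G)`. -/
def endMap₁ : (∏ᶜ fun c => (F.obj c ⟶[V] G.obj c)) ⟶
    ∏ᶜ fun p : C × C => (ihom (p.1 ⟶[V] p.2)).obj (F.obj p.1 ⟶[V] G.obj p.2) :=
  Limits.Pi.lift fun p => MonoidalClosed.curry
    ((F.map p.1 p.2 ⊗ₘ Limits.Pi.π _ p.2) ≫ eComp V _ _ _)

/-- The second of the two maps whose equalizer is `[C, D](F, G)`. -/
def endMap₂ : (∏ᶜ fun c => (F.obj c ⟶[V] G.obj c)) ⟶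
    ∏ᶜ fun p : C × C => (ihom (p.1 ⟶[V] p.2)).obj (F.obj p.1 ⟶[V] G.obj p.2) :=
  Limits.Pi.lift fun p => MonoidalClosed.curry
    ((β_ _ _).hom ≫ (Limits.Pi.π _ p.1 ⊗ₘ G.map p.1 p.2) ≫ eComp V _ _ _)

theorem endMap_condition {Z : V} (f : Z ⟶ ∏ᶜ fun c => (F.obj c ⟶[V] G.obj c)) :
    f ≫ endMap₁ F G = f ≫ endMap₂ F G ↔
      natHom.IsNatural F G (fun c => f ≫ Limits.Pi.π _ c) := by
  have key : ∀ p : C × C, (f ≫ endMap₁ F G ≫ Limits.Pi.π _ p = f ≫ endMap₂ F G ≫ Limits.Pi.π _ p) ↔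
      (β_ Z (p.1 ⟶[V] p.2)).hom ≫ (F.map p.1 p.2 ⊗ₘ (f ≫ Limits.Pi.π _ p.2)) ≫ eComp V _ _ _ =
        ((f ≫ Limits.Pi.π _ p.1) ⊗ₘ G.map p.1 p.2) ≫ eComp V _ _ _ := by
    intro p
    simp only [endMap₁, endMap₂, Limits.limit.lift_π, Limits.Fan.mk_π_app]
    rw [← MonoidalClosed.curry_natural_left, ← MonoidalClosed.curry_natural_left,
      MonoidalClosed.curry_injective.eq_iff, ← cancel_epi (β_ Z (p.1 ⟶[V] p.2)).hom,
      BraidedCategory.braiding_naturality_right_assoc,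
      SymmetricCategory.symmetry_assoc,
      ← MonoidalCategory.id_tensorHom, ← MonoidalCategory.tensorHom_id,
      MonoidalCategory.tensorHom_comp_tensorHom_assoc,
      MonoidalCategory.tensorHom_comp_tensorHom_assoc, Category.id_comp, Category.id_comp]
  constructor
  · intro h c d
    refine (key (c, d)).1 ?_
    rw [← Category.assoc, h, Category.assoc]
  · intro h
    apply Limits.Pi.hom_ext
    intro p
    rw [Category.assoc, Category.assoc]
    exact (key p).2 (h p.1 p.2)

/-- For small `C` and complete symmetric monoidal closed `V`, the end exists. -/
instance : HasNatHom F G := by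
  have hι : Limits.equalizer.ι (endMap₁ F G) (endMap₂ F G) ≫ endMap₁ F G =
    Limits.equalizer.ι (endMap₁ F G) (endMap₂ F G) ≫ endMap₂ F G := Limits.equalizer.condition _ _
  refine natHom.hasNatHom_of_universal (Limits.equalizer (endMap₁ F G) (endMap₂ F G))
    (fun c => Limits.equalizer.ι _ _ ≫ Limits.Pi.π _ c) ((endMap_condition F G _).1 hι) ?_
  intro Z app h
  have h' : (fun c => Limits.Pi.lift app ≫ Limits.Pi.π _ c) = app := by
    funext c
    simp
  refine ⟨Limits.equalizer.lift (Limits.Pi.lift app)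
    ((endMap_condition F G _).2 (by rw [h']; exact h)), fun c => ?_, fun f hf => ?_⟩
  · rw [Limits.equalizer.lift_ι_assoc]
    exact congrFun h' c
  · apply Limits.equalizer.hom_ext
    apply Limits.Pi.hom_ext
    intro c
    rw [Limits.equalizer.lift_ι, Category.assoc, hf c]
    exact (congrFun h' c).symm

instance (W : EnrichedFunctor V C D → Prop) : HasNatHoms W := ⟨fun _ _ _ _ => inferInstance⟩

end

end Small

section Hom

variable {V : Type u} [Category.{v} V] [MonoidalCategory V] [SymmetricCategory V]
  [MonoidalClosed V]

theorem curry_tensor_eComp {x y z a b : V} (f : x ⊗ a ⟶ y) (g : y ⊗ b ⟶ z) :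
    (MonoidalClosed.curry f ⊗ₘ MonoidalClosed.curry g) ≫ eComp V x y z =
      MonoidalClosed.curry ((α_ x a b).inv ≫ f ▷ b ≫ g) := by
  change _ ≫ MonoidalClosed.comp x y z = _
  rw [MonoidalClosed.comp_eq, ← MonoidalClosed.curry_natural_left,
    MonoidalClosed.compTranspose_eq, ← MonoidalCategory.id_tensorHom,
    MonoidalCategory.associator_inv_naturality_assoc]
  congr 2
  rw [MonoidalCategory.id_tensorHom, MonoidalCategory.tensorHom_def_assoc,
    MonoidalCategory.whisker_exchange_assoc, ← MonoidalCategory.comp_whiskerRight_assoc,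
    MonoidalClosed.whiskerLeft_curry_ihom_ev_app]
  change f ▷ b ≫ y ◁ MonoidalClosed.curry g ≫ (ihom.ev y).app z = _
  rw [MonoidalClosed.whiskerLeft_curry_ihom_ev_app]

variable {B : Type w} [EnrichedCategory V B]

/-- Precomposition `P ⟶ [B(Y, b), B(X, b)]` with a generalised element `P ⟶ B(X, Y)`. -/
def pre {P : V} {X Y : B} (f : P ⟶ (X ⟶[V] Y)) (b : B) :
    P ⟶ (EnrichedCategory.Hom (Y ⟶[V] b) (X ⟶[V] b) : V) :=
  MonoidalClosed.curry ((β_ (Y ⟶[V] b) P).hom ≫ (f ⊗ₘ 𝟙 _) ≫ eComp V X Y b)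

/-- Postcomposition `P ⟶ [B(b, X), B(b, Y)]` with a generalised element `P ⟶ B(X, Y)`. -/
def post {P : V} {X Y : B} (f : P ⟶ (X ⟶[V] Y)) (b : B) :
    P ⟶ (EnrichedCategory.Hom (b ⟶[V] X) (b ⟶[V] Y) : V) :=
  MonoidalClosed.curry ((𝟙 _ ⊗ₘ f) ≫ eComp V b X Y)

theorem comp_pre {P Q : V} (g : Q ⟶ P) {X Y : B} (f : P ⟶ (X ⟶[V] Y)) (b : B) :
    g ≫ pre f b = pre (g ≫ f) b := by
  rw [pre, pre, ← MonoidalClosed.curry_natural_left,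
    BraidedCategory.braiding_naturality_right_assoc, ← MonoidalCategory.tensorHom_id,
    MonoidalCategory.tensorHom_comp_tensorHom_assoc, Category.id_comp]

theorem comp_post {P Q : V} (g : Q ⟶ P) {X Y : B} (f : P ⟶ (X ⟶[V] Y)) (b : B) :
    g ≫ post f b = post (g ≫ f) b := by
  rw [post, post, ← MonoidalClosed.curry_natural_left, ← MonoidalCategory.id_tensorHom,
    MonoidalCategory.tensorHom_comp_tensorHom_assoc, Category.id_comp]

theorem pre_eId (X b : B) : pre (eId V X) b = eId V (X ⟶[V] b) := by
  change _ = MonoidalClosed.curry (ρ_ (X ⟶[V] b)).hom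
  have := e_id_comp V X b
  rw [Iso.inv_comp_eq, Category.comp_id] at this
  rw [pre, MonoidalCategory.tensorHom_id, this]
  simp

theorem post_eId (X b : B) : post (eId V X) b = eId V (b ⟶[V] X) := by
  change _ = MonoidalClosed.curry (ρ_ (b ⟶[V] X)).hom
  have := e_comp_id V b X
  rw [Iso.inv_comp_eq, Category.comp_id] at this
  rw [post, MonoidalCategory.id_tensorHom, this]

theorem whiskerRight_tensor {x y a b c : V} (f : x ⟶ y) (g : a ⟶ b) (h : y ⊗ b ⟶ c) :
    f ▷ a ≫ (𝟙 y ⊗ₘ g) ≫ h = (f ⊗ₘ g) ≫ h := by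
  rw [← MonoidalCategory.tensorHom_id, MonoidalCategory.tensorHom_comp_tensorHom_assoc,
    Category.comp_id, Category.id_comp]

theorem whiskerRight_braiding_tensor {x y a b c : V} (f : x ⟶ y) (g : a ⟶ b) (h : b ⊗ y ⟶ c) :
    f ▷ a ≫ (β_ y a).hom ≫ (g ⊗ₘ 𝟙 y) ≫ h = (β_ x a).hom ≫ (g ⊗ₘ f) ≫ h := by
  rw [BraidedCategory.braiding_naturality_left_assoc, ← MonoidalCategory.id_tensorHom,
    MonoidalCategory.tensorHom_comp_tensorHom_assoc, Category.comp_id, Category.id_comp]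

theorem post_comp {P Q : V} {X Y Z : B} (f : P ⟶ (X ⟶[V] Y)) (g : Q ⟶ (Y ⟶[V] Z)) (b : B) :
    (post f b ⊗ₘ post g b) ≫ eComp V (b ⟶[V] X) (b ⟶[V] Y) (b ⟶[V] Z) =
      post ((f ⊗ₘ g) ≫ eComp V X Y Z) b := by
  rw [post, post, post, curry_tensor_eComp, whiskerRight_tensor, tensor_eComp_assoc,
    Iso.inv_hom_id_assoc]

theorem pre_comp {P Q : V} {X Y Z : B} (f : P ⟶ (Y ⟶[V] Z)) (g : Q ⟶ (X ⟶[V] Y)) (b : B) :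
    (pre f b ⊗ₘ pre g b) ≫ eComp V (Z ⟶[V] b) (Y ⟶[V] b) (X ⟶[V] b) =
      (β_ P Q).hom ≫ pre ((g ⊗ₘ f) ≫ eComp V X Y Z) b := by
  rw [pre, pre, pre, curry_tensor_eComp, ← MonoidalClosed.curry_natural_left]
  congr 1
  rw [whiskerRight_braiding_tensor, tensor_eComp_assoc,
    ← Category.id_comp g, ← MonoidalCategory.tensorHom_comp_tensorHom_assoc,
    MonoidalCategory.id_tensorHom, Category.id_comp]
  simp

theorem pre_post {P Q : V} {W X Y Z : B} (f : P ⟶ (W ⟶[V] X)) (g : Q ⟶ (Y ⟶[V] Z)) :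
    (pre f Y ⊗ₘ post g W) ≫ eComp V (X ⟶[V] Y) (W ⟶[V] Y) (W ⟶[V] Z) =
      (β_ P Q).hom ≫ (post g X ⊗ₘ pre f Z) ≫
        eComp V (X ⟶[V] Y) (X ⟶[V] Z) (W ⟶[V] Z) := by
  rw [pre, pre, post, post, curry_tensor_eComp, curry_tensor_eComp,
    ← MonoidalClosed.curry_natural_left, whiskerRight_tensor, whiskerRight_braiding_tensor]
  congr 1
  have k := tensor_eComp_assoc f (𝟙 (X ⟶[V] Y)) g
  rw [← Category.id_comp g, ← MonoidalCategory.tensorHom_comp_tensorHom_assoc, Category.id_comp,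
    k, MonoidalCategory.tensorHom_id]
  simp only [BraidedCategory.braiding_tensor_left_hom, Category.assoc,
    Iso.inv_hom_id_assoc]
  rw [← MonoidalCategory.whiskerLeft_comp_assoc, SymmetricCategory.symmetry,
    MonoidalCategory.whiskerLeft_id, Category.id_comp]

variable {K : Type w₁} [EnrichedCategory V K]

/-- The presheaf `B(G -, b) : Kᵒᵖ → V`. -/
def homTo (G : EnrichedFunctor V K B) (b : B) : EnrichedFunctor V Kᵒᵖ V where
  obj k := G.obj k.unop ⟶[V] b
  map k l := pre (G.map l.unop k.unop) b
  map_id k := by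
    change eId V k.unop ≫ _ = _
    rw [comp_pre, G.map_id, pre_eId]
  map_comp k l m := by
    rw [pre_comp, eComp_op_eq, Category.assoc, ← G.map_comp, ← comp_pre]
    rfl

/-- The functor `B(b, G -) : K → V`. -/
def homFrom (G : EnrichedFunctor V K B) (b : B) : EnrichedFunctor V K V where
  obj k := b ⟶[V] G.obj k
  map k l := post (G.map k l) b
  map_id k := by rw [comp_post, G.map_id, post_eId]
  map_comp k l m := by rw [post_comp, ← G.map_comp, comp_post]

/-- The components of `B(b, b') ⟶ [Kᵒᵖ, V](B(G -, b), B(G -, b'))`. -/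
def homToMap (G : EnrichedFunctor V K B) (b b' : B) (k : Kᵒᵖ) :
    (b ⟶[V] b') ⟶ (EnrichedCategory.Hom ((homTo G b).obj k) ((homTo G b').obj k) : V) :=
  post (𝟙 (b ⟶[V] b')) (G.obj k.unop)

/-- The components of `B(b', b) ⟶ [K, V](B(b, G -), B(b', G -))`. -/
def homFromMap (G : EnrichedFunctor V K B) (b b' : B) (k : K) :
    (b' ⟶[V] b) ⟶ (EnrichedCategory.Hom ((homFrom G b).obj k) ((homFrom G b').obj k) : V) :=
  pre (𝟙 (b' ⟶[V] b)) (G.obj k)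

theorem isNatural_homTo (G : EnrichedFunctor V K B) (b b' : B) :
    natHom.IsNatural (homTo G b) (homTo G b') (homToMap G b b') := by
  intro k l
  have h := pre_post (G.map l.unop k.unop) (𝟙 (b ⟶[V] b'))
  refine (congrArg (fun t => (β_ _ _).hom ≫ t) h).trans ?_
  exact SymmetricCategory.symmetry_assoc _ _ _

theorem isNatural_homFrom (G : EnrichedFunctor V K B) (b b' : B) :
    natHom.IsNatural (homFrom G b) (homFrom G b') (homFromMap G b b') := by
  intro k l
  exact (pre_post (𝟙 (b' ⟶[V] b)) (G.map k l)).symm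

theorem eId_homToMap (G : EnrichedFunctor V K B) (b : B) (k : Kᵒᵖ) :
    eId V b ≫ homToMap G b b k = eId V ((homTo G b).obj k) := by
  refine (comp_post _ _ _).trans ?_
  rw [Category.comp_id, post_eId]
  rfl

theorem eComp_homToMap (G : EnrichedFunctor V K B) (b b' b'' : B) (k : Kᵒᵖ) :
    eComp V b b' b'' ≫ homToMap G b b'' k =
      (homToMap G b b' k ⊗ₘ homToMap G b' b'' k) ≫ eComp V _ _ _ := by
  refine (comp_post _ _ _).trans (Eq.trans ?_ (post_comp _ _ _).symm)
  rw [MonoidalCategory.id_tensorHom_id, Category.id_comp, Category.comp_id]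

theorem eId_homFromMap (G : EnrichedFunctor V K B) (b : B) (k : K) :
    eId V b ≫ homFromMap G b b k = eId V ((homFrom G b).obj k) := by
  refine (comp_pre _ _ _).trans ?_
  rw [Category.comp_id, pre_eId]
  rfl

theorem eComp_homFromMap (G : EnrichedFunctor V K B) (b b' b'' : B) (k : K) :
    ((β_ _ _).hom ≫ eComp V b'' b' b) ≫ homFromMap G b b'' k =
      (homFromMap G b b' k ⊗ₘ homFromMap G b' b'' k) ≫ eComp V _ _ _ := by
  refine (comp_pre _ _ _).trans (Eq.trans ?_ (pre_comp _ _ _).symm)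
  rw [MonoidalCategory.id_tensorHom_id, Category.id_comp, Category.comp_id, comp_pre]

theorem curry_square {x y x' y' P : V} (m : x ⊗ P ⟶ y) (m' : x' ⊗ P ⟶ y') (f : x ⟶ x')
    (g : y ⟶ y') (h : m ≫ g = f ▷ P ≫ m') :
    (β_ (𝟙_ V) P).hom ≫ (MonoidalClosed.curry m ⊗ₘ MonoidalClosed.curry' g) ≫ eComp V x y y' =
      (MonoidalClosed.curry' f ⊗ₘ MonoidalClosed.curry m') ≫ eComp V x x' y' := by
  rw [MonoidalClosed.curry', MonoidalClosed.curry', curry_tensor_eComp, curry_tensor_eComp,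
    ← MonoidalClosed.curry_natural_left, MonoidalCategory.rightUnitor_naturality_assoc, h]
  congr 1
  simp

/-- The natural family `B(G k, b) ⟶ C(S G k, S b)` given by the action of `S` on morphisms. -/
theorem isNatural_mapTo {C : Type w₂} [EnrichedCategory V C] (G : EnrichedFunctor V K B)
    (S : EnrichedFunctor V B C) (b : B) :
    natHom.IsNatural (homTo G b) (homTo (G.comp V S) (S.obj b))
      (fun k => MonoidalClosed.curry' (S.map (G.obj k.unop) b)) := by
  intro k l
  refine curry_square _ _ (S.map (G.obj k.unop) b) (S.map (G.obj l.unop) b) ?_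
  refine Eq.trans ?_ (whiskerRight_braiding_tensor _ _ _).symm
  rw [Category.assoc, Category.assoc, S.map_comp,
    MonoidalCategory.tensorHom_comp_tensorHom_assoc, Category.id_comp]
  rfl

/-- The natural family `B(b, G k) ⟶ C(S b, S G k)` given by the action of `S` on morphisms. -/
theorem isNatural_mapFrom {C : Type w₂} [EnrichedCategory V C] (G : EnrichedFunctor V K B)
    (S : EnrichedFunctor V B C) (b : B) :
    natHom.IsNatural (homFrom G b) (homFrom (G.comp V S) (S.obj b))
      (fun k => MonoidalClosed.curry' (S.map b (G.obj k))) := by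
  intro k l
  refine curry_square _ _ (S.map b (G.obj k)) (S.map b (G.obj l)) ?_
  refine Eq.trans ?_ (whiskerRight_tensor _ _ _).symm
  rw [Category.assoc, S.map_comp, MonoidalCategory.tensorHom_comp_tensorHom_assoc,
    Category.id_comp]
  rfl

/-- Composition `B(X, Y) ⊗ B(Y, Z) ⟶ B(X, Z)` with a morphism `X ⟶ Y` of the underlying category. -/
def precomp {X Y : B} (f : 𝟙_ V ⟶ (X ⟶[V] Y)) (Z : B) : (Y ⟶[V] Z) ⟶ (X ⟶[V] Z) :=
  (λ_ _).inv ≫ (f ⊗ₘ 𝟙 _) ≫ eComp V X Y Z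

/-- Composition in the underlying category. -/
def ucomp {X Y Z : B} (f : 𝟙_ V ⟶ (X ⟶[V] Y)) (g : 𝟙_ V ⟶ (Y ⟶[V] Z)) : 𝟙_ V ⟶ (X ⟶[V] Z) :=
  (λ_ _).inv ≫ (f ⊗ₘ g) ≫ eComp V X Y Z

theorem isNatural_preNat {G H : EnrichedFunctor V K B} {η : ∀ k, 𝟙_ V ⟶ (G.obj k ⟶[V] H.obj k)}
    (hη : natHom.IsNatural G H η) (b : B) :
    natHom.IsNatural (homTo H b) (homTo G b)
      (fun k => MonoidalClosed.curry' (precomp (η k.unop) b)) := by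
  intro k l
  refine curry_square _ _ (precomp (η k.unop) b) (precomp (η l.unop) b) ?_
  refine Eq.trans ?_ (whiskerRight_braiding_tensor _ _ _).symm
  rw [Category.assoc, Category.assoc]
  congr 1
  have h := hη l.unop k.unop
  have k1 := tensor_eComp_assoc (η l.unop) (H.map l.unop k.unop) (𝟙 (H.obj k.unop ⟶[V] b))
  have k2 := tensor_eComp_assoc (G.map l.unop k.unop) (η k.unop) (𝟙 (H.obj k.unop ⟶[V] b))
  rw [← h, ← Iso.inv_comp_eq, ← Category.comp_id (𝟙 (H.obj k.unop ⟶[V] b)),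
    ← MonoidalCategory.tensorHom_comp_tensorHom, Category.comp_id] at k1
  rw [← Iso.inv_comp_eq] at k2
  have e1 : ((H.map l.unop k.unop ⊗ₘ 𝟙 (H.obj k.unop ⟶[V] b)) ≫ eComp V _ _ _) ≫
      precomp (η l.unop) b = (λ_ _).inv ≫ (η l.unop ⊗ₘ
        ((H.map l.unop k.unop ⊗ₘ 𝟙 (H.obj k.unop ⟶[V] b)) ≫ eComp V _ _ _)) ≫ eComp V _ _ _ := by
    rw [precomp, MonoidalCategory.leftUnitor_inv_naturality_assoc,
      ← MonoidalCategory.id_tensorHom, MonoidalCategory.tensorHom_comp_tensorHom_assoc,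
      Category.id_comp, Category.comp_id]
  have e2 : (G.map l.unop k.unop ⊗ₘ precomp (η k.unop) b) ≫ eComp V _ _ _ =
      _ ◁ (λ_ _).inv ≫ (G.map l.unop k.unop ⊗ₘ
        ((η k.unop ⊗ₘ 𝟙 (H.obj k.unop ⟶[V] b)) ≫ eComp V _ _ _)) ≫ eComp V _ _ _ := by
    rw [precomp, ← MonoidalCategory.id_tensorHom,
      MonoidalCategory.tensorHom_comp_tensorHom_assoc, Category.id_comp]
  refine Eq.trans ?_ e2.symm
  refine Eq.trans (Category.assoc _ _ _).symm ?_
  refine Eq.trans e1 ?_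
  rw [← k1, ← k2, Category.assoc, MonoidalCategory.tensorHom_id]
  simp

end Hom

section Tilde

variable {V : Type u} [Category.{v} V] [MonoidalCategory V] [SymmetricCategory V]
  [MonoidalClosed V] [Limits.HasLimits V]
variable {B : Type w} [EnrichedCategory V B]
variable {K : Type v} [EnrichedCategory V K]

/-- The `V`-functor `B → [Kᵒᵖ, V]`, `b ↦ B(G -, b)`. For `G = id` it is the Yoneda embedding. -/
def homToFunctor (G : EnrichedFunctor V K B) :
    EnrichedFunctor V B (EnrichedFunctor V Kᵒᵖ V) where
  obj b := homTo G b
  map b b' := natHom.lift (homToMap G b b') (isNatural_homTo G b b')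
  map_id b := natHom.hom_ext fun k => by
    rw [eId_π, Category.assoc, natHom.lift_π, eId_homToMap]
  map_comp b b' b'' := natHom.hom_ext fun k => by
    rw [Category.assoc, natHom.lift_π, Category.assoc, eComp_π,
      MonoidalCategory.tensorHom_comp_tensorHom_assoc, natHom.lift_π, natHom.lift_π,
      eComp_homToMap]

/-- The `V`-functor `Bᵒᵖ → [K, V]`, `b ↦ B(b, G -)`. For `G = id` it is the Yoneda embedding of the
opposite `V`-category. -/
def homFromFunctor (G : EnrichedFunctor V K B) :
    EnrichedFunctor V Bᵒᵖ (EnrichedFunctor V K V) where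
  obj b := homFrom G b.unop
  map b b' := natHom.lift (homFromMap G b.unop b'.unop) (isNatural_homFrom G b.unop b'.unop)
  map_id b := natHom.hom_ext fun k => by
    rw [eId_π, Category.assoc, natHom.lift_π]
    exact eId_homFromMap G b.unop k
  map_comp b b' b'' := natHom.hom_ext fun k => by
    rw [Category.assoc, natHom.lift_π, Category.assoc, eComp_π,
      MonoidalCategory.tensorHom_comp_tensorHom_assoc, natHom.lift_π, natHom.lift_π]
    exact eComp_homFromMap G b.unop b'.unop b''.unop k

end Tilde

section Colimits

/-- A class of indexes for limits: functors `K → V` with `K` a small `V`-category. -/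
abbrev LimitIndexes (V : Type u) [Category.{v} V] [MonoidalCategory V] [MonoidalClosed V] :=
  ∀ (K : Type v) [EnrichedCategory V K], EnrichedFunctor V K V → Prop

/-- A class of indexes for colimits: presheaves `Kᵒᵖ → V` with `K` a small `V`-category. -/
abbrev ColimitIndexes (V : Type u) [Category.{v} V] [MonoidalCategory V] [SymmetricCategory V]
    [MonoidalClosed V] :=
  ∀ (K : Type v) [EnrichedCategory V K], EnrichedFunctor V Kᵒᵖ V → Prop

variable {V : Type u} [Category.{v} V] [MonoidalCategory V] [SymmetricCategory V]
  [MonoidalClosed V] [Limits.HasLimits V]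
variable {B : Type w} [EnrichedCategory V B] {C : Type w₁} [EnrichedCategory V C]
variable {K : Type v} [EnrichedCategory V K]

/-- `ι : F ⟶ B(G -, b)` exhibits `b` as the colimit `F * G` of `G : K → B` indexed by
`F : Kᵒᵖ → V`: the induced maps `B(b, x) ⟶ [Kᵒᵖ, V](F, B(G -, x))` are isomorphisms. -/
structure IsIndexedColimit (F : EnrichedFunctor V Kᵒᵖ V) (G : EnrichedFunctor V K B) (b : B)
    (ι : 𝟙_ V ⟶ (F ⟶[V] homTo G b)) : Prop where
  isIso : ∀ x : B, IsIso ((homToFunctor G).map b x ≫ precomp ι (homTo G x))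

/-- `ρ : F ⟶ B(b, G -)` exhibits `b` as the limit `{F, G}` of `G : K → B` indexed by
`F : K → V`: the induced maps `B(x, b) ⟶ [K, V](F, B(x, G -))` are isomorphisms. -/
structure IsIndexedLimit (F : EnrichedFunctor V K V) (G : EnrichedFunctor V K B) (b : B)
    (ρ : 𝟙_ V ⟶ (F ⟶[V] homFrom G b)) : Prop where
  isIso : ∀ x : B, IsIso ((homFromFunctor G).map (op b) (op x) ≫ precomp ρ (homFrom G x))

/-- The `V`-natural transformation `B(G -, b) ⟶ C(S G -, S b)` given by `S : B → C`. -/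
def mapTo (G : EnrichedFunctor V K B) (S : EnrichedFunctor V B C) (b : B) :
    𝟙_ V ⟶ (homTo G b ⟶[V] homTo (G.comp V S) (S.obj b)) :=
  natHom.lift _ (isNatural_mapTo G S b)

/-- The `V`-natural transformation `B(b, G -) ⟶ C(S b, S G -)` given by `S : B → C`. -/
def mapFrom (G : EnrichedFunctor V K B) (S : EnrichedFunctor V B C) (b : B) :
    𝟙_ V ⟶ (homFrom G b ⟶[V] homFrom (G.comp V S) (S.obj b)) :=
  natHom.lift _ (isNatural_mapFrom G S b)

/-- The `V`-natural transformation `B(H -, b) ⟶ B(G -, b)` given by `η : G ⟶ H`. -/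
def preNat {G H : EnrichedFunctor V K B} (η : 𝟙_ V ⟶ (G ⟶[V] H)) (b : B) :
    𝟙_ V ⟶ (homTo H b ⟶[V] homTo G b) :=
  natHom.lift _ (isNatural_preNat ((natHom.π_natural G H).precomp η) b)

/-- `S : B → C` is `φ`-cocontinuous: it preserves all `φ`-colimits that exist in `B`. -/
def IsCocontinuous (φ : ColimitIndexes V) (S : EnrichedFunctor V B C) : Prop :=
  ∀ (K : Type v) [EnrichedCategory V K] (F : EnrichedFunctor V Kᵒᵖ V), φ K F →
    ∀ (G : EnrichedFunctor V K B) (b : B) (ι : 𝟙_ V ⟶ (F ⟶[V] homTo G b)),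
      IsIndexedColimit F G b ι → IsIndexedColimit F (G.comp V S) (S.obj b) (ucomp ι (mapTo G S b))

/-- `S : B → C` is `P`-continuous: it preserves all `P`-limits that exist in `B`. -/
def IsContinuous (P : LimitIndexes V) (S : EnrichedFunctor V B C) : Prop :=
  ∀ (K : Type v) [EnrichedCategory V K] (F : EnrichedFunctor V K V), P K F →
    ∀ (G : EnrichedFunctor V K B) (b : B) (ρ : 𝟙_ V ⟶ (F ⟶[V] homFrom G b)),
      IsIndexedLimit F G b ρ → IsIndexedLimit F (G.comp V S) (S.obj b) (ucomp ρ (mapFrom G S b))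

/-- `B` is `φ`-cocomplete: it has all `φ`-colimits. -/
def IsCocomplete (φ : ColimitIndexes V) (B : Type w) [EnrichedCategory V B] : Prop :=
  ∀ (K : Type v) [EnrichedCategory V K] (F : EnrichedFunctor V Kᵒᵖ V), φ K F →
    ∀ G : EnrichedFunctor V K B, ∃ (b : B) (ι : 𝟙_ V ⟶ (F ⟶[V] homTo G b)), IsIndexedColimit F G b ι

/-- `η : G ⟶ L J` exhibits `L : C → B` as the left Kan extension of `G : A → B` along `J : A → C`:
for every `c`, the composite `C(J -, c) ⟶ B(L J -, L c) ⟶ B(G -, L c)` exhibits `L c` as the colimit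
`C(J -, c) * G`. -/
def IsLeftKanExtension {A : Type v} [EnrichedCategory V A] (J : EnrichedFunctor V A C)
    (G : EnrichedFunctor V A B) (L : EnrichedFunctor V C B)
    (η : 𝟙_ V ⟶ (G ⟶[V] J.comp V L)) : Prop :=
  ∀ c : C, IsIndexedColimit (homTo J c) G (L.obj c) (ucomp (mapTo J L c) (preNat η (L.obj c)))

/-- `G : A → B` admits a left Kan extension along `J : A → C`. -/
def HasLeftKanExtension {A : Type v} [EnrichedCategory V A] (J : EnrichedFunctor V A C)
    (G : EnrichedFunctor V A B) : Prop :=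
  ∃ (L : EnrichedFunctor V C B) (η : 𝟙_ V ⟶ (G ⟶[V] J.comp V L)), IsLeftKanExtension J G L η

end Colimits

section Flat

variable {V : Type u} [Category.{v} V] [MonoidalCategory V] [SymmetricCategory V]
  [MonoidalClosed V] [Limits.HasLimits V]

/-- The Yoneda embedding `A → [Aᵒᵖ, V]`, `a ↦ A(-, a)`. -/
def yoneda (A : Type v) [EnrichedCategory V A] :
    EnrichedFunctor V A (EnrichedFunctor V Aᵒᵖ V) :=
  homToFunctor (EnrichedFunctor.id V A)

/-- The Yoneda embedding `Aᵒᵖ → [A, V]`, `a ↦ A(a, -)`. -/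
def coyoneda (A : Type v) [EnrichedCategory V A] :
    EnrichedFunctor V Aᵒᵖ (EnrichedFunctor V A V) :=
  homFromFunctor (EnrichedFunctor.id V A)

/-- A presheaf `F : Aᵒᵖ → V` is `P`-flat when it has a left Kan extension
`- * F : [A, V] → V` along the Yoneda embedding `Aᵒᵖ → [A, V]` which preserves all `P`-limits. -/
def IsFlat (P : LimitIndexes V) (A : Type v) [EnrichedCategory V A]
    (F : EnrichedFunctor V Aᵒᵖ V) : Prop :=
  ∃ (L : EnrichedFunctor V (EnrichedFunctor V A V) V)
    (η : 𝟙_ V ⟶ (F ⟶[V] (coyoneda A).comp V L)),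
    IsLeftKanExtension (coyoneda A) F L η ∧ IsContinuous P L

/-- The class `Flat_P` of all `P`-flat presheaves. -/
def flatIndexes (P : LimitIndexes V) : ColimitIndexes V := fun A _ F => IsFlat P A F

/-- The full subcategory `Flat_P(A)` of `[Aᵒᵖ, V]` on the `P`-flat presheaves. -/
abbrev FlatCat (P : LimitIndexes V) (A : Type v) [EnrichedCategory V A] :=
  FunctorSub (IsFlat P A)

end Flat

section Cocompletion

variable {V : Type u} [Category.{v} V] [MonoidalCategory V] [SymmetricCategory V]
  [MonoidalClosed V]

/-- A `V`-natural isomorphism between `V`-functors. -/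
structure VNatIso {C : Type w₁} [EnrichedCategory V C] {D : Type w₂} [EnrichedCategory V D]
    (F G : EnrichedFunctor V C D) where
  /-- the components -/
  hom : ∀ c, 𝟙_ V ⟶ (F.obj c ⟶[V] G.obj c)
  /-- the inverses of the components -/
  inv : ∀ c, 𝟙_ V ⟶ (G.obj c ⟶[V] F.obj c)
  hom_inv : ∀ c, ucomp (hom c) (inv c) = eId V (F.obj c)
  inv_hom : ∀ c, ucomp (inv c) (hom c) = eId V (G.obj c)
  natural : natHom.IsNatural F G hom

/-- The corestriction of `S : B → [C, D]` to a full subcategory containing its values. -/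
def FunctorSub.lift {B : Type w} [EnrichedCategory V B] {C : Type w₁} [EnrichedCategory V C]
    {D : Type w₂} [EnrichedCategory V D] {W : EnrichedFunctor V C D → Prop} [HasNatHoms W]
    [∀ F G : EnrichedFunctor V C D, HasNatHom F G]
    (S : EnrichedFunctor V B (EnrichedFunctor V C D)) (h : ∀ b, W (S.obj b)) :
    EnrichedFunctor V B (FunctorSub W) where
  obj b := ⟨S.obj b, h b⟩
  map b b' := S.map b b'
  map_id b := S.map_id b
  map_comp b b' b'' := S.map_comp b b' b''

theorem isNatural_restriction {A : Type w} [EnrichedCategory V A] {C : Type w₁}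
    [EnrichedCategory V C] {B : Type w₂} [EnrichedCategory V B] (J : EnrichedFunctor V A C)
    {S T : EnrichedFunctor V C B} {Z : V} {σ : ∀ c, Z ⟶ (S.obj c ⟶[V] T.obj c)}
    (hσ : natHom.IsNatural S T σ) :
    natHom.IsNatural (J.comp V S) (J.comp V T) (fun a => σ (J.obj a)) := by
  intro a a'
  have h := congrArg (fun t => Z ◁ J.map a a' ≫ t) (hσ (J.obj a) (J.obj a'))
  rw [BraidedCategory.braiding_naturality_right_assoc, ← MonoidalCategory.id_tensorHom,
    ← MonoidalCategory.tensorHom_id, MonoidalCategory.tensorHom_comp_tensorHom_assoc,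
    MonoidalCategory.tensorHom_comp_tensorHom_assoc, Category.id_comp, Category.id_comp] at h
  exact h

/-- The map `[C, B](S, T) ⟶ [A, B](S J, T J)` given by restriction along `J`. -/
def restrictionMap {A : Type w} [EnrichedCategory V A] {C : Type w₁}
    [EnrichedCategory V C] {B : Type w₂} [EnrichedCategory V B] (J : EnrichedFunctor V A C)
    (S T : EnrichedFunctor V C B) [HasNatHom S T] [HasNatHom (J.comp V S) (J.comp V T)] :
    natHom S T ⟶ natHom (J.comp V S) (J.comp V T) :=
  natHom.lift _ (isNatural_restriction J (natHom.π_natural S T))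

theorem restrictionMap_π {A : Type w} [EnrichedCategory V A] {C : Type w₁}
    [EnrichedCategory V C] {B : Type w₂} [EnrichedCategory V B] (J : EnrichedFunctor V A C)
    (S T : EnrichedFunctor V C B) [HasNatHom S T] [HasNatHom (J.comp V S) (J.comp V T)] (a : A) :
    restrictionMap J S T ≫ natHom.π (J.comp V S) (J.comp V T) a = natHom.π S T (J.obj a) :=
  natHom.lift_π _ _ _

/-- Restriction `[J, 1]` along `J : A → C`, from a full subcategory of `[C, B]` to a full
subcategory of `[A, B]`. -/
def restriction {A : Type w} [EnrichedCategory V A] {C : Type w₁} [EnrichedCategory V C]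
    {B : Type w₂} [EnrichedCategory V B] (J : EnrichedFunctor V A C)
    (W : EnrichedFunctor V C B → Prop) [HasNatHoms W]
    (W' : EnrichedFunctor V A B → Prop) [HasNatHoms W'] (h : ∀ S, W S → W' (J.comp V S)) :
    EnrichedFunctor V (FunctorSub W) (FunctorSub W') where
  obj S := ⟨J.comp V S.obj, h S.obj S.property⟩
  map S T :=
    have := HasNatHoms.hasNatHom _ _ (h S.obj S.property) (h T.obj T.property)
    restrictionMap J S.obj T.obj
  map_id S := by
    have := HasNatHoms.hasNatHom _ _ (h S.obj S.property) (h S.obj S.property)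
    refine natHom.hom_ext fun a => ?_
    refine (Category.assoc _ _ _).trans ?_
    refine (congrArg (fun t => eId V S ≫ t) (natHom.lift_π _ _ a)).trans ?_
    exact (FunctorSub.eId_π S (J.obj a)).trans
      (FunctorSub.eId_π (W := W') ⟨J.comp V S.obj, h S.obj S.property⟩ a).symm
  map_comp S T U := by
    have := HasNatHoms.hasNatHom _ _ (h S.obj S.property) (h T.obj T.property)
    have := HasNatHoms.hasNatHom _ _ (h T.obj T.property) (h U.obj U.property)
    have := HasNatHoms.hasNatHom _ _ (h S.obj S.property) (h U.obj U.property)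
    refine natHom.hom_ext fun a => ?_
    refine (Category.assoc _ _ _).trans ?_
    refine (congrArg (fun t => eComp V S T U ≫ t) (natHom.lift_π _ _ a)).trans ?_
    refine (FunctorSub.eComp_π S T U (J.obj a)).trans (Eq.trans ?_ (Category.assoc _ _ _).symm)
    refine Eq.trans ?_ (congrArg
      (fun t => (restrictionMap J S.obj T.obj ⊗ₘ restrictionMap J T.obj U.obj) ≫ t)
      (FunctorSub.eComp_π (W := W') ⟨J.comp V S.obj, h S.obj S.property⟩
        ⟨J.comp V T.obj, h T.obj T.property⟩ ⟨J.comp V U.obj, h U.obj U.property⟩ a)).symm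
    refine Eq.trans ?_ (MonoidalCategory.tensorHom_comp_tensorHom_assoc _ _ _ _ _).symm
    exact congrArg₂ (fun s t => (s ⊗ₘ t) ≫ eComp V _ _ _)
      (restrictionMap_π J S.obj T.obj a).symm (restrictionMap_π J T.obj U.obj a).symm

variable [Limits.HasLimits V]

/-- `J : A → Ā` is the free `φ`-cocompletion of the small `V`-category `A`: it is fully faithful,
`Ā` is `φ`-cocomplete, and for every, possibly large, `V`-category `B`, left Kan extension along `J`
and restriction along `J` are mutually inverse equivalences between the `V`-category `[A, B]'` of
functors admitting a left Kan extension along `J` and the `V`-category `φ-Cocts[Ā, B]` of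
`φ`-cocontinuous functors (whose hom-objects `[Ā, B](S, T)` are part of the assertion, as `Ā` may be
large), with `[A, B]' = [A, B]` if `B` is `φ`-cocomplete. -/
structure IsFreeCocompletion (φ : ColimitIndexes V) {A : Type v} [EnrichedCategory V A]
    {Abar : Type w} [EnrichedCategory V Abar] (J : EnrichedFunctor V A Abar) : Prop where
  fullyFaithful : ∀ a b : A, IsIso (J.map a b)
  cocomplete : IsCocomplete φ Abar
  universal : ∀ (B : Type w₁) [EnrichedCategory V B],
    ∃ (_ : HasNatHoms (IsCocontinuous φ (B := Abar) (C := B)))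
      (h : ∀ S : EnrichedFunctor V Abar B, IsCocontinuous φ S →
        HasLeftKanExtension J (J.comp V S))
      (Lan : EnrichedFunctor V (FunctorSub (HasLeftKanExtension J (B := B)))
        (FunctorSub (IsCocontinuous φ (B := Abar) (C := B))))
      (η : VNatIso (EnrichedFunctor.id V _)
        (Lan.comp V (restriction J (IsCocontinuous φ) (HasLeftKanExtension J) h))),
      Nonempty (VNatIso ((restriction J (IsCocontinuous φ) (HasLeftKanExtension J) h).comp V Lan)
        (EnrichedFunctor.id V _)) ∧
      ∀ G : FunctorSub (HasLeftKanExtension J (B := B)),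
        IsLeftKanExtension J G.obj (Lan.obj G).obj (η.hom G)
  hasLeftKanExtension : ∀ (B : Type w₁) [EnrichedCategory V B], IsCocomplete φ B →
    ∀ G : EnrichedFunctor V A B, HasLeftKanExtension J G

/-- A class of presheaves on `A` is replete, contains the representables and is closed under the
formation of `φ`-colimits in `[Aᵒᵖ, V]`. -/
structure IsClosedUnderColimits (φ : ColimitIndexes V) {A : Type v} [EnrichedCategory V A]
    (W : EnrichedFunctor V Aᵒᵖ V → Prop) : Prop where
  replete : ∀ F G : EnrichedFunctor V Aᵒᵖ V, Nonempty (VNatIso F G) → W F → W G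
  representable : ∀ a, W ((yoneda A).obj a)
  colimit : ∀ (K : Type v) [EnrichedCategory V K] (F : EnrichedFunctor V Kᵒᵖ V), φ K F →
    ∀ (G : EnrichedFunctor V K (EnrichedFunctor V Aᵒᵖ V)), (∀ k, W (G.obj k)) →
      ∀ (E : EnrichedFunctor V Aᵒᵖ V) (ι : 𝟙_ V ⟶ (F ⟶[V] homTo G E)), IsIndexedColimit F G E ι → W E

/-- `W` is the closure of `A` under `φ`-colimits in `[Aᵒᵖ, V]`. -/
structure IsClosure (φ : ColimitIndexes V) {A : Type v} [EnrichedCategory V A]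
    (W : EnrichedFunctor V Aᵒᵖ V → Prop) : Prop extends IsClosedUnderColimits φ W where
  minimal : ∀ W' : EnrichedFunctor V Aᵒᵖ V → Prop, IsClosedUnderColimits φ W' →
    ∀ F, W F → W' F

end Cocompletion



end
end EnrichedFlat

/-!
The base `V` is only complete, so no colimit in `V` may be formed freely. Weighted limits and
colimits are therefore tested on generalised elements `Z ⟶ B(x, y)`: a colimit of `G` weighted by
`F` is a family `F k ⟶ B(G k, b)` through which every natural family `F k ⊗ Z ⟶ B(G k, x)` factors
uniquely (`isIndexedColimit_iff`). With values in `V` itself this says that `b` is the tensor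
product `∫^k G k ⊗ F k` (`isColimitCocone_iff_isTensor`), and a presheaf `F` is flat if and only if
these tensor products `H * F` exist for all `H : A → V` and depend continuously on `H`
(`isFlat_iff`).

*Closure.* Representables are flat because `- * A(-, a)` is evaluation at `a` (`isFlat_yoneda`). Let
`F` be a flat presheaf on `K` and `G` a functor from `K` to flat presheaves on `A`. Flatness of `F`
provides the tensor products that compute the colimit `E = G * F` pointwise
(`exists_pointwise_colimit`), and by associativity `H * E = (H * G -) * F` (`isTensor_outerTensor`).
So `- * E` is the composite `[A, V] ⟶ [K, V] ⟶ V` of two continuous functors, and `E` is flat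
(`isFlat_of_colimit`). Since every presheaf is the colimit of representables weighted by itself
(`isColimitCocone_yoneda`), the flat presheaves form the smallest closed class.

*Freeness.* Let `J` be the embedding of `A` into `Flat(A)`. Every flat presheaf `c` is the colimit
of `J` indexed by `Flat(A)(J -, c) ≅ c`, which is flat. Hence a cocontinuous `S` is the left Kan
extension of its restriction `S J`, and `V`-natural families out of `S` amount to `V`-natural
families out of `S J`: this gives the hom-objects `[Flat(A), B](S, T) ≅ [A, B](S J, T J)`, so that
restriction along `J` is fully faithful (`existsUnique_extension`, `isIso_restrictionMap`).
Conversely, a left Kan extension `L` of `G` satisfies `B(L c, x) ≅ [Aᵒᵖ, V](c, B(G -, x))`, and the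
inclusion of `Flat(A)` in `[Aᵒᵖ, V]` preserves flat colimits, so `L` does
(`IsLeftKanExtension.isCocontinuous`). The unit `G ⟶ L J` is invertible as `J` is fully faithful
(`IsLeftKanExtension.exists_unit_inverse`). So left Kan extension is a quasi-inverse of restriction
(`inverseOfFullyFaithful`).
-/

namespace EnrichedFlat

noncomputable section

/-! ### Generalised morphisms and actions -/

section GradedComposition

variable {V : Type u} [Category.{v} V] [MonoidalCategory V]
variable {D : Type w} [EnrichedCategory V D] {E : Type w₁} [EnrichedCategory V E]

/-- The composite of two generalised morphisms `P ⟶ D(X, Y)` and `Q ⟶ D(Y, Z)`. -/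
def gcomp {X Y Z : D} {P Q : V} (f : P ⟶ (X ⟶[V] Y)) (g : Q ⟶ (Y ⟶[V] Z)) :
    P ⊗ Q ⟶ (X ⟶[V] Z) :=
  (f ⊗ₘ g) ≫ eComp V X Y Z

theorem gcomp_assoc {X Y Z W : D} {P Q R : V} (f : P ⟶ (X ⟶[V] Y)) (g : Q ⟶ (Y ⟶[V] Z))
    (h : R ⟶ (Z ⟶[V] W)) :
    gcomp (gcomp f g) h = (α_ P Q R).hom ≫ gcomp f (gcomp g h) :=
  tensor_eComp_assoc f g h

theorem tensor_gcomp {X Y Z : D} {P Q P' Q' : V} (a : P' ⟶ P) (b : Q' ⟶ Q) (f : P ⟶ (X ⟶[V] Y))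
    (g : Q ⟶ (Y ⟶[V] Z)) : (a ⊗ₘ b) ≫ gcomp f g = gcomp (a ≫ f) (b ≫ g) := by
  rw [gcomp, gcomp, MonoidalCategory.tensorHom_comp_tensorHom_assoc]

theorem tensor_gcomp_assoc {X Y Z : D} {P Q P' Q' R : V} (a : P' ⟶ P) (b : Q' ⟶ Q)
    (f : P ⟶ (X ⟶[V] Y)) (g : Q ⟶ (Y ⟶[V] Z)) (h : (X ⟶[V] Z) ⟶ R) :
    (a ⊗ₘ b) ≫ gcomp f g ≫ h = gcomp (a ≫ f) (b ≫ g) ≫ h := by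
  rw [← Category.assoc, tensor_gcomp]

theorem whiskerRight_gcomp {X Y Z : D} {P Q P' : V} (a : P' ⟶ P) (f : P ⟶ (X ⟶[V] Y))
    (g : Q ⟶ (Y ⟶[V] Z)) : a ▷ Q ≫ gcomp f g = gcomp (a ≫ f) g := by
  rw [← tensorHom_id, tensor_gcomp, Category.id_comp]

theorem whiskerRight_gcomp_assoc {X Y Z : D} {P Q P' R : V} (a : P' ⟶ P) (f : P ⟶ (X ⟶[V] Y))
    (g : Q ⟶ (Y ⟶[V] Z)) (h : (X ⟶[V] Z) ⟶ R) :
    a ▷ Q ≫ gcomp f g ≫ h = gcomp (a ≫ f) g ≫ h := by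
  rw [← Category.assoc, whiskerRight_gcomp]

theorem whiskerLeft_gcomp {X Y Z : D} {P Q Q' : V} (b : Q' ⟶ Q) (f : P ⟶ (X ⟶[V] Y))
    (g : Q ⟶ (Y ⟶[V] Z)) : P ◁ b ≫ gcomp f g = gcomp f (b ≫ g) := by
  rw [← id_tensorHom, tensor_gcomp, Category.id_comp]

theorem whiskerLeft_gcomp_assoc {X Y Z : D} {P Q Q' R : V} (b : Q' ⟶ Q) (f : P ⟶ (X ⟶[V] Y))
    (g : Q ⟶ (Y ⟶[V] Z)) (h : (X ⟶[V] Z) ⟶ R) :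
    P ◁ b ≫ gcomp f g ≫ h = gcomp f (b ≫ g) ≫ h := by
  rw [← Category.assoc, whiskerLeft_gcomp]

theorem gcomp_map (S : EnrichedFunctor V D E) {X Y Z : D} {P Q : V} (f : P ⟶ (X ⟶[V] Y))
    (g : Q ⟶ (Y ⟶[V] Z)) :
    gcomp f g ≫ S.map X Z = gcomp (f ≫ S.map X Y) (g ≫ S.map Y Z) := by
  rw [gcomp, gcomp, Category.assoc, S.map_comp, MonoidalCategory.tensorHom_comp_tensorHom_assoc]

theorem eComp_eq_gcomp (X Y Z : D) : eComp V X Y Z = gcomp (𝟙 (X ⟶[V] Y)) (𝟙 (Y ⟶[V] Z)) := by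
  rw [gcomp, id_tensorHom_id, Category.id_comp]

theorem eId_gcomp {X Y : D} {P : V} (f : P ⟶ (X ⟶[V] Y)) :
    gcomp (eId V X) f = (λ_ P).hom ≫ f := by
  have h := e_id_comp V X Y
  rw [Iso.inv_comp_eq, Category.comp_id] at h
  rw [gcomp, tensorHom_def'_assoc, h, leftUnitor_naturality]

theorem gcomp_eId {X Y : D} {P : V} (f : P ⟶ (X ⟶[V] Y)) :
    gcomp f (eId V Y) = (ρ_ P).hom ≫ f := by
  have h := e_comp_id V X Y
  rw [Iso.inv_comp_eq, Category.comp_id] at h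
  rw [gcomp, tensorHom_def_assoc, h, rightUnitor_naturality]

end GradedComposition

section SelfEnrichment

variable {V : Type u} [Category.{v} V] [MonoidalCategory V] [SymmetricCategory V]
  [MonoidalClosed V]

/-- Currying, with values in the hom-object of the self-enrichment. -/
def cur {X P Y : V} (f : X ⊗ P ⟶ Y) : P ⟶ (EnrichedCategory.Hom X Y : V) :=
  MonoidalClosed.curry f

/-- Uncurrying, for the hom-object of the self-enrichment. -/
def unc {X P Y : V} (f : P ⟶ (EnrichedCategory.Hom X Y : V)) : X ⊗ P ⟶ Y :=
  MonoidalClosed.uncurry f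

@[simp]
theorem unc_cur {X P Y : V} (f : X ⊗ P ⟶ Y) : unc (cur f) = f :=
  MonoidalClosed.uncurry_curry f

@[simp]
theorem cur_unc {X P Y : V} (f : P ⟶ (EnrichedCategory.Hom X Y : V)) : cur (unc f) = f :=
  MonoidalClosed.curry_uncurry f

theorem unc_injective {X P Y : V} :
    Function.Injective (unc : (P ⟶ (EnrichedCategory.Hom X Y : V)) → (X ⊗ P ⟶ Y)) :=
  MonoidalClosed.uncurry_injective

theorem cur_injective {X P Y : V} :
    Function.Injective (cur : (X ⊗ P ⟶ Y) → (P ⟶ (EnrichedCategory.Hom X Y : V))) :=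
  MonoidalClosed.curry_injective

theorem comp_cur {X P Q Y : V} (a : Q ⟶ P) (f : X ⊗ P ⟶ Y) : a ≫ cur f = cur (X ◁ a ≫ f) :=
  (MonoidalClosed.curry_natural_left a f).symm

theorem unc_comp {X P Q Y : V} (a : Q ⟶ P) (f : P ⟶ (EnrichedCategory.Hom X Y : V)) :
    unc (a ≫ f) = X ◁ a ≫ unc f :=
  MonoidalClosed.uncurry_natural_left a f

theorem unc_gcomp {X Y Z P Q : V} (f : P ⟶ (EnrichedCategory.Hom X Y : V))
    (g : Q ⟶ (EnrichedCategory.Hom Y Z : V)) :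
    unc (gcomp f g) = (α_ X P Q).inv ≫ unc f ▷ Q ≫ unc g := by
  apply cur_injective
  rw [cur_unc]
  refine Eq.trans ?_ (curry_tensor_eComp (unc f) (unc g))
  rw [gcomp]
  exact congrArg₂ (fun s t => (s ⊗ₘ t) ≫ eComp V X Y Z) (cur_unc f).symm (cur_unc g).symm

theorem unc_eId (X : V) : unc (eId V X) = (ρ_ X).hom :=
  MonoidalClosed.uncurry_curry _

/-- The action `P ⊗ X ⟶ Y` of a generalised morphism `P ⟶ [X, Y]`, with the morphism on the
left. -/
def lunc {X P Y : V} (f : P ⟶ (EnrichedCategory.Hom X Y : V)) : P ⊗ X ⟶ Y :=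
  (β_ P X).hom ≫ unc f

theorem lunc_injective {X P Y : V} :
    Function.Injective (lunc : (P ⟶ (EnrichedCategory.Hom X Y : V)) → (P ⊗ X ⟶ Y)) := by
  intro f g h
  exact unc_injective ((cancel_epi _).1 h)

theorem lunc_comp {X P Q Y : V} (a : Q ⟶ P) (f : P ⟶ (EnrichedCategory.Hom X Y : V)) :
    lunc (a ≫ f) = a ▷ X ≫ lunc f := by
  rw [lunc, lunc, unc_comp, BraidedCategory.braiding_naturality_left_assoc]

theorem braiding_lunc {X P Y : V} (f : P ⟶ (EnrichedCategory.Hom X Y : V)) :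
    (β_ X P).hom ≫ lunc f = unc f := by
  rw [lunc, SymmetricCategory.symmetry_assoc]

/-- Currying of the left variable. -/
def lcur {X P Y : V} (f : P ⊗ X ⟶ Y) : P ⟶ (EnrichedCategory.Hom X Y : V) :=
  cur ((β_ X P).hom ≫ f)

@[simp]
theorem lunc_lcur {X P Y : V} (f : P ⊗ X ⟶ Y) : lunc (lcur f) = f := by
  rw [lunc, lcur, unc_cur, SymmetricCategory.symmetry_assoc]

/-- In terms of left actions, composition in the self-enrichment reverses the order. -/
theorem lunc_gcomp {X Y Z P Q : V} (f : P ⟶ (EnrichedCategory.Hom X Y : V))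
    (g : Q ⟶ (EnrichedCategory.Hom Y Z : V)) :
    lunc (gcomp f g) = (β_ P Q).hom ▷ X ≫ (α_ Q P X).hom ≫ Q ◁ lunc f ≫ lunc g := by
  have h : (β_ (P ⊗ Q) X).hom ≫ (α_ X P Q).inv = (β_ P Q).hom ▷ X ≫ (α_ Q P X).hom ≫
      Q ◁ (β_ P X).hom ≫ (β_ Q (X ⊗ P)).hom := by
    have h1 := BraidedCategory.braiding_naturality_left_assoc (β_ P Q).hom X
      (X ◁ (β_ Q P).hom ≫ (α_ X P Q).inv)
    rw [← MonoidalCategory.whiskerLeft_comp_assoc, SymmetricCategory.symmetry,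
      MonoidalCategory.whiskerLeft_id, Category.id_comp] at h1
    rw [← h1, BraidedCategory.braiding_tensor_right_hom, BraidedCategory.braiding_tensor_left_hom]
    simp only [Category.assoc]
  rw [lunc, unc_gcomp, reassoc_of% h, lunc, lunc, MonoidalCategory.whiskerLeft_comp_assoc,
    BraidedCategory.braiding_naturality_right_assoc Q (unc f)]

theorem lunc_eId (X : V) : lunc (eId V X) = (λ_ X).hom := by
  rw [lunc, unc_eId]
  simp

end SelfEnrichment

section Actions

variable {V : Type u} [Category.{v} V] [MonoidalCategory V] [SymmetricCategory V]
  [MonoidalClosed V]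
variable {K : Type w} [EnrichedCategory V K]

/-- The action `K(k, l) ⊗ F l ⟶ F k` of a presheaf `F : Kᵒᵖ → V`. -/
def lact (F : EnrichedFunctor V Kᵒᵖ V) (k l : K) :
    (k ⟶[V] l) ⊗ F.obj (op l) ⟶ F.obj (op k) :=
  lunc (P := (k ⟶[V] l)) (F.map (op l) (op k))

/-- The action `H k ⊗ K(k, l) ⟶ H l` of a functor `H : K → V`. -/
def ract (H : EnrichedFunctor V K V) (k l : K) : H.obj k ⊗ (k ⟶[V] l) ⟶ H.obj l :=
  unc (H.map k l)

theorem lact_comp (F : EnrichedFunctor V Kᵒᵖ V) (j k l : K) :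
    eComp V j k l ▷ F.obj (op l) ≫ lact F j l =
      (α_ _ _ _).hom ≫ (j ⟶[V] k) ◁ lact F k l ≫ lact F j k := by
  have h := F.map_comp (op l) (op k) (op j)
  have h2 := lunc_gcomp (F.map (op l) (op k)) (F.map (op k) (op j))
  rw [gcomp, ← h, lunc_comp, eComp_op_eq, comp_whiskerRight_assoc] at h2
  exact (cancel_epi _).1 h2

theorem lact_id (F : EnrichedFunctor V Kᵒᵖ V) (k : K) :
    eId V k ▷ F.obj (op k) ≫ lact F k k = (λ_ _).hom := by
  refine (lunc_comp _ _).symm.trans ?_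
  refine Eq.trans ?_ (lunc_eId _)
  exact congrArg lunc (F.map_id (op k))

theorem ract_comp (H : EnrichedFunctor V K V) (j k l : K) :
    H.obj j ◁ eComp V j k l ≫ ract H j l =
      (α_ _ _ _).inv ≫ ract H j k ▷ _ ≫ ract H k l := by
  rw [ract, ← unc_comp, H.map_comp, ← gcomp, unc_gcomp, ract, ract]

theorem ract_id (H : EnrichedFunctor V K V) (k : K) :
    H.obj k ◁ eId V k ≫ ract H k k = (ρ_ _).hom := by
  rw [ract, ← unc_comp, H.map_id, unc_eId]

end Actions

/-! ### Weighted limits and colimits on generalised elements -/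

section Components

variable {V : Type u} [Category.{v} V] [MonoidalCategory V] [SymmetricCategory V]
  [MonoidalClosed V]
variable {K : Type w} [EnrichedCategory V K]

/-- A `Z`-indexed family between presheaves is `V`-natural if and only if its components
`F k ⊗ Z ⟶ G k` commute with the left actions of `K`. -/
theorem isNatural_iff_lact {F G : EnrichedFunctor V Kᵒᵖ V} {Z : V}
    (app : ∀ k, Z ⟶ (EnrichedCategory.Hom (F.obj k) (G.obj k) : V)) :
    natHom.IsNatural F G app ↔ ∀ k l : K, lact F k l ▷ Z ≫ unc (app (op k)) =
      (α_ _ _ _).hom ≫ (k ⟶[V] l) ◁ unc (app (op l)) ≫ lact G k l := by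
  have key : ∀ k l : K, (((β_ Z (k ⟶[V] l)).hom ≫ gcomp (F.map (op l) (op k)) (app (op k)) =
      gcomp (app (op l)) (G.map (op l) (op k))) ↔ (lact F k l ▷ Z ≫ unc (app (op k)) =
      (α_ _ _ _).hom ≫ (k ⟶[V] l) ◁ unc (app (op l)) ≫ lact G k l)) := by
    intro k l
    have hexagon : (β_ (k ⟶[V] l) (F.obj (op l))).hom ▷ Z ≫ (α_ _ _ _).hom ≫
        F.obj (op l) ◁ (β_ (k ⟶[V] l) Z).hom ≫ (α_ _ _ _).inv =
        (α_ _ _ _).hom ≫ (β_ (k ⟶[V] l) (F.obj (op l) ⊗ Z)).hom := by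
      rw [BraidedCategory.braiding_tensor_right_hom, Iso.hom_inv_id_assoc]
    rw [← unc_injective.eq_iff, unc_comp, unc_gcomp, unc_gcomp,
      ← cancel_epi ((β_ (k ⟶[V] l) (F.obj (op l))).hom ▷ Z ≫ (α_ _ _ _).hom ≫
        F.obj (op l) ◁ (β_ (k ⟶[V] l) Z).hom)]
    have e1 : ((β_ (k ⟶[V] l) (F.obj (op l))).hom ▷ Z ≫ (α_ _ _ _).hom ≫
        F.obj (op l) ◁ (β_ (k ⟶[V] l) Z).hom) ≫ F.obj (op l) ◁ (β_ Z (k ⟶[V] l)).hom ≫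
        (α_ _ _ _).inv ≫ unc (F.map (op l) (op k)) ▷ Z ≫ unc (app (op k)) =
        lact F k l ▷ Z ≫ unc (app (op k)) := by
      simp only [Category.assoc]
      rw [← MonoidalCategory.whiskerLeft_comp_assoc, SymmetricCategory.symmetry,
        MonoidalCategory.whiskerLeft_id, Category.id_comp]
      erw [Iso.hom_inv_id_assoc]
      rw [← comp_whiskerRight_assoc]
      rfl
    have e2 : ((β_ (k ⟶[V] l) (F.obj (op l))).hom ▷ Z ≫ (α_ _ _ _).hom ≫
        F.obj (op l) ◁ (β_ (k ⟶[V] l) Z).hom) ≫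
        (α_ _ _ _).inv ≫ unc (app (op l)) ▷ _ ≫ unc (G.map (op l) (op k)) =
        (α_ _ _ _).hom ≫ (k ⟶[V] l) ◁ unc (app (op l)) ≫ lact G k l := by
      simp only [Category.assoc]
      erw [reassoc_of% hexagon]
      rw [lact, lunc, BraidedCategory.braiding_naturality_right_assoc]
    exact Eq.congr e1 e2
  exact ⟨fun h k l => (key k l).1 (h (op l) (op k)), fun h k l => (key l.unop k.unop).2 (h _ _)⟩

/-- A `Z`-indexed family between functors into `V` is `V`-natural if and only if its components
`Z ⊗ F k ⟶ G k` commute with the right actions of `K`. -/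
theorem isNatural_iff_ract {F G : EnrichedFunctor V K V} {Z : V}
    (app : ∀ k, Z ⟶ (EnrichedCategory.Hom (F.obj k) (G.obj k) : V)) :
    natHom.IsNatural F G app ↔ ∀ k l : K, lunc (app k) ▷ (k ⟶[V] l) ≫ ract G k l =
      (α_ _ _ _).hom ≫ Z ◁ ract F k l ≫ lunc (app l) := by
  have key : ∀ k l : K, (((β_ Z (k ⟶[V] l)).hom ≫ gcomp (F.map k l) (app l) =
      gcomp (app k) (G.map k l)) ↔ (lunc (app k) ▷ (k ⟶[V] l) ≫ ract G k l =
      (α_ _ _ _).hom ≫ Z ◁ ract F k l ≫ lunc (app l))) := by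
    intro k l
    rw [← unc_injective.eq_iff, unc_comp, unc_gcomp, unc_gcomp,
      ← cancel_epi ((β_ Z (F.obj k)).hom ▷ (k ⟶[V] l) ≫ (α_ _ _ _).hom)]
    have e1 : ((β_ Z (F.obj k)).hom ▷ (k ⟶[V] l) ≫ (α_ _ _ _).hom) ≫
        F.obj k ◁ (β_ Z (k ⟶[V] l)).hom ≫ (α_ _ _ _).inv ≫ unc (F.map k l) ▷ Z ≫
        unc (app l) = (α_ _ _ _).hom ≫ Z ◁ ract F k l ≫ lunc (app l) := by
      rw [lunc, BraidedCategory.braiding_naturality_right_assoc,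
        BraidedCategory.braiding_tensor_right_hom]
      simp only [Category.assoc, Iso.hom_inv_id_assoc]
      rfl
    have e2 : ((β_ Z (F.obj k)).hom ▷ (k ⟶[V] l) ≫ (α_ _ _ _).hom) ≫
        (α_ _ _ _).inv ≫ unc (app k) ▷ (k ⟶[V] l) ≫ unc (G.map k l) =
        lunc (app k) ▷ (k ⟶[V] l) ≫ ract G k l := by
      simp only [Category.assoc, Iso.hom_inv_id_assoc, lunc, ract, comp_whiskerRight]
    rw [e1, e2, eq_comm]
  exact ⟨fun h k l => (key k l).1 (h k l), fun h k l => (key k l).2 (h k l)⟩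

variable {B : Type w₁} [EnrichedCategory V B]

theorem lact_homTo (G : EnrichedFunctor V K B) (b : B) (k l : K) :
    lact (homTo G b) k l = gcomp (G.map k l) (𝟙 (G.obj l ⟶[V] b)) :=
  lunc_lcur _

theorem ract_homFrom (G : EnrichedFunctor V K B) (b : B) (k l : K) :
    ract (homFrom G b) k l = gcomp (𝟙 (b ⟶[V] G.obj k)) (G.map k l) :=
  unc_cur _

theorem whiskerLeft_lact_homTo (G : EnrichedFunctor V K B) (b : B) (k l : K) {Z : V}
    (f : Z ⟶ (G.obj l ⟶[V] b)) :
    (k ⟶[V] l) ◁ f ≫ lact (homTo G b) k l = gcomp (G.map k l) f := by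
  rw [lact_homTo]
  exact (whiskerLeft_gcomp _ _ _).trans (congrArg _ (Category.comp_id f))

theorem whiskerRight_ract_homFrom (G : EnrichedFunctor V K B) (b : B) (k l : K) {Z : V}
    (f : Z ⟶ (b ⟶[V] G.obj k)) :
    f ▷ (k ⟶[V] l) ≫ ract (homFrom G b) k l = gcomp f (G.map k l) := by
  rw [ract_homFrom]
  exact (whiskerRight_gcomp _ _ _).trans (congrArg (gcomp · _) (Category.comp_id f))

/-- A `Z`-indexed family `F k ⊗ Z ⟶ B(G k, x)` that is `V`-natural in `k`: a cocone on `G`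
weighted by the presheaf `F`, with vertex `x`. -/
def IsCocone (F : EnrichedFunctor V Kᵒᵖ V) (G : EnrichedFunctor V K B) {Z : V} {x : B}
    (φ : ∀ k, F.obj (op k) ⊗ Z ⟶ (G.obj k ⟶[V] x)) : Prop :=
  ∀ k l, lact F k l ▷ Z ≫ φ k = (α_ _ _ _).hom ≫ gcomp (G.map k l) (φ l)

/-- A `Z`-indexed family `Z ⊗ F k ⟶ B(x, G k)` that is `V`-natural in `k`: a cone on `G`
weighted by `F`, with vertex `x`. -/
def IsCone (F : EnrichedFunctor V K V) (G : EnrichedFunctor V K B) {Z : V} {x : B}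
    (ψ : ∀ k, Z ⊗ F.obj k ⟶ (x ⟶[V] G.obj k)) : Prop :=
  ∀ k l, gcomp (ψ k) (G.map k l) = (α_ _ _ _).hom ≫ Z ◁ ract F k l ≫ ψ l

/-- The family `c` exhibits `b` as the colimit of `G` weighted by the presheaf `F`, in terms of
generalised elements: every `Z`-indexed cocone factors uniquely through `c`. -/
structure IsColimitCocone (F : EnrichedFunctor V Kᵒᵖ V) (G : EnrichedFunctor V K B) (b : B)
    (c : ∀ k, F.obj (op k) ⟶ (G.obj k ⟶[V] b)) : Prop where
  natural : ∀ k l, lact F k l ≫ c k = gcomp (G.map k l) (c l)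
  existsUnique : ∀ {Z : V} {x : B} (φ : ∀ k, F.obj (op k) ⊗ Z ⟶ (G.obj k ⟶[V] x)),
    IsCocone F G φ → ∃! g : Z ⟶ (b ⟶[V] x), ∀ k, gcomp (c k) g = φ k

/-- The family `r` exhibits `b` as the limit of `G` weighted by `F`, in terms of generalised
elements: every `Z`-indexed cone factors uniquely through `r`. -/
structure IsLimitCone (F : EnrichedFunctor V K V) (G : EnrichedFunctor V K B) (b : B)
    (r : ∀ k, F.obj k ⟶ (b ⟶[V] G.obj k)) : Prop where
  natural : ∀ k l, gcomp (r k) (G.map k l) = ract F k l ≫ r l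
  existsUnique : ∀ {Z : V} {x : B} (ψ : ∀ k, Z ⊗ F.obj k ⟶ (x ⟶[V] G.obj k)),
    IsCone F G ψ → ∃! g : Z ⟶ (x ⟶[V] b), ∀ k, gcomp g (r k) = ψ k

theorem isCocone_comp {F : EnrichedFunctor V Kᵒᵖ V} {G : EnrichedFunctor V K B} {b : B}
    {c : ∀ k, F.obj (op k) ⟶ (G.obj k ⟶[V] b)}
    (hc : ∀ k l, lact F k l ≫ c k = gcomp (G.map k l) (c l)) {Z : V} {x : B}
    (g : Z ⟶ (b ⟶[V] x)) : IsCocone F G (fun k => gcomp (c k) g) := by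
  intro k l
  rw [whiskerRight_gcomp, hc, gcomp_assoc]

theorem IsColimitCocone.hom_ext {F : EnrichedFunctor V Kᵒᵖ V} {G : EnrichedFunctor V K B} {b : B}
    {c : ∀ k, F.obj (op k) ⟶ (G.obj k ⟶[V] b)} (h : IsColimitCocone F G b c) {Z : V} {x : B}
    {f g : Z ⟶ (b ⟶[V] x)} (hfg : ∀ k, gcomp (c k) f = gcomp (c k) g) : f = g :=
  (h.existsUnique _ (isCocone_comp h.natural g)).unique hfg fun _ => rfl

end Components

section PresheafMorphisms

variable {V : Type u} [Category.{v} V] [MonoidalCategory V] [SymmetricCategory V]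
  [MonoidalClosed V] [Limits.HasLimits V]
variable {K : Type v} [EnrichedCategory V K]

/-- The components `F k ⊗ Z ⟶ G k` of a generalised morphism `Z ⟶ [Kᵒᵖ, V](F, G)` of
presheaves. -/
def papp {F G : EnrichedFunctor V Kᵒᵖ V} {Z : V} (f : Z ⟶ (F ⟶[V] G)) (k : K) :
    F.obj (op k) ⊗ Z ⟶ G.obj (op k) :=
  unc (f ≫ natHom.π F G (op k))

theorem papp_comp {F G : EnrichedFunctor V Kᵒᵖ V} {Z Z' : V} (a : Z' ⟶ Z) (f : Z ⟶ (F ⟶[V] G))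
    (k : K) : papp (a ≫ f) k = F.obj (op k) ◁ a ≫ papp f k := by
  rw [papp, papp, Category.assoc, unc_comp]

theorem papp_gcomp {F G H : EnrichedFunctor V Kᵒᵖ V} {P Q : V} (f : P ⟶ (F ⟶[V] G))
    (g : Q ⟶ (G ⟶[V] H)) (k : K) :
    papp (gcomp f g) k = (α_ _ _ _).inv ≫ papp f k ▷ Q ≫ papp g k := by
  rw [papp, papp, papp, ← unc_gcomp, gcomp, gcomp, Category.assoc, eComp_π,
    MonoidalCategory.tensorHom_comp_tensorHom_assoc]

theorem papp_eId (F : EnrichedFunctor V Kᵒᵖ V) (k : K) : papp (eId V F) k = (ρ_ _).hom := by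
  rw [papp, eId_π, unc_eId]

theorem papp_natural {F G : EnrichedFunctor V Kᵒᵖ V} {Z : V} (f : Z ⟶ (F ⟶[V] G)) (k l : K) :
    lact F k l ▷ Z ≫ papp f k = (α_ _ _ _).hom ≫ (k ⟶[V] l) ◁ papp f l ≫ lact G k l :=
  (isNatural_iff_lact _).1 ((natHom.π_natural F G).precomp f) k l

theorem papp_ext {F G : EnrichedFunctor V Kᵒᵖ V} {Z : V} {f g : Z ⟶ (F ⟶[V] G)}
    (h : ∀ k, papp f k = papp g k) : f = g :=
  natHom.hom_ext fun k => unc_injective (h k.unop)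

/-- A generalised morphism of presheaves given by its components. -/
def plift {F G : EnrichedFunctor V Kᵒᵖ V} {Z : V} (φ : ∀ k : K, F.obj (op k) ⊗ Z ⟶ G.obj (op k))
    (h : ∀ k l, lact F k l ▷ Z ≫ φ k = (α_ _ _ _).hom ≫ (k ⟶[V] l) ◁ φ l ≫ lact G k l) :
    Z ⟶ (F ⟶[V] G) :=
  natHom.lift (fun k => cur (φ k.unop)) ((isNatural_iff_lact _).2 fun k l => by
    rw [unc_cur, unc_cur]
    exact h k l)

@[simp]
theorem papp_plift {F G : EnrichedFunctor V Kᵒᵖ V} {Z : V}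
    (φ : ∀ k : K, F.obj (op k) ⊗ Z ⟶ G.obj (op k))
    (h : ∀ k l, lact F k l ▷ Z ≫ φ k = (α_ _ _ _).hom ≫ (k ⟶[V] l) ◁ φ l ≫ lact G k l) (k : K) :
    papp (plift φ h) k = φ k := by
  rw [papp, plift, natHom.lift_π, unc_cur]

/-- The components `F k ⟶ G k` of a morphism of presheaves. -/
def leg {F G : EnrichedFunctor V Kᵒᵖ V} (f : 𝟙_ V ⟶ (F ⟶[V] G)) (k : K) :
    F.obj (op k) ⟶ G.obj (op k) :=
  (ρ_ _).inv ≫ papp f k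

theorem leg_natural {F G : EnrichedFunctor V Kᵒᵖ V} (f : 𝟙_ V ⟶ (F ⟶[V] G)) (k l : K) :
    lact F k l ≫ leg f k = (k ⟶[V] l) ◁ leg f l ≫ lact G k l := by
  have h := papp_natural f k l
  rw [leg, leg, rightUnitor_inv_naturality_assoc, h]
  simp

theorem leg_ucomp {F G H : EnrichedFunctor V Kᵒᵖ V} (f : 𝟙_ V ⟶ (F ⟶[V] G))
    (g : 𝟙_ V ⟶ (G ⟶[V] H)) (k : K) : leg (ucomp f g) k = leg f k ≫ leg g k := by
  rw [leg, ucomp, ← gcomp, papp_comp, papp_gcomp, leg, leg]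
  simp

theorem leg_eId (F : EnrichedFunctor V Kᵒᵖ V) (k : K) : leg (eId V F) k = 𝟙 _ := by
  rw [leg, papp_eId, Iso.inv_hom_id]

theorem papp_leftUnitor_gcomp {F G H : EnrichedFunctor V Kᵒᵖ V} {Z : V} (f : 𝟙_ V ⟶ (F ⟶[V] G))
    (g : Z ⟶ (G ⟶[V] H)) (k : K) :
    papp ((λ_ Z).inv ≫ gcomp f g) k = leg f k ▷ Z ≫ papp g k := by
  rw [papp_comp, papp_gcomp, leg]
  simp

/-- A morphism of presheaves given by its components. -/
def mkLeg {F G : EnrichedFunctor V Kᵒᵖ V} (φ : ∀ k : K, F.obj (op k) ⟶ G.obj (op k))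
    (h : ∀ k l, lact F k l ≫ φ k = (k ⟶[V] l) ◁ φ l ≫ lact G k l) : 𝟙_ V ⟶ (F ⟶[V] G) :=
  plift (fun k => (ρ_ _).hom ≫ φ k) fun k l => by
    rw [rightUnitor_naturality_assoc, h]
    simp

@[simp]
theorem leg_mkLeg {F G : EnrichedFunctor V Kᵒᵖ V} (φ : ∀ k : K, F.obj (op k) ⟶ G.obj (op k))
    (h : ∀ k l, lact F k l ≫ φ k = (k ⟶[V] l) ◁ φ l ≫ lact G k l) (k : K) :
    leg (mkLeg φ h) k = φ k := by
  rw [leg, mkLeg, papp_plift, Iso.inv_hom_id_assoc]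

end PresheafMorphisms

section FunctorMorphisms

variable {V : Type u} [Category.{v} V] [MonoidalCategory V] [SymmetricCategory V]
  [MonoidalClosed V] [Limits.HasLimits V]
variable {K : Type v} [EnrichedCategory V K]

/-- The components `Z ⊗ F k ⟶ G k` of a generalised morphism `Z ⟶ [K, V](F, G)` of functors into
`V`. Here `Z` acts from the left, as `K` acts from the right. -/
def capp {F G : EnrichedFunctor V K V} {Z : V} (f : Z ⟶ (F ⟶[V] G)) (k : K) :
    Z ⊗ F.obj k ⟶ G.obj k :=
  lunc (f ≫ natHom.π F G k)

theorem capp_comp {F G : EnrichedFunctor V K V} {Z Z' : V} (a : Z' ⟶ Z) (f : Z ⟶ (F ⟶[V] G))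
    (k : K) : capp (a ≫ f) k = a ▷ F.obj k ≫ capp f k := by
  rw [capp, capp, Category.assoc, lunc_comp]

theorem capp_gcomp {F G H : EnrichedFunctor V K V} {P Q : V} (f : P ⟶ (F ⟶[V] G))
    (g : Q ⟶ (G ⟶[V] H)) (k : K) :
    capp (gcomp f g) k =
      (β_ P Q).hom ▷ F.obj k ≫ (α_ _ _ _).hom ≫ Q ◁ capp f k ≫ capp g k := by
  rw [capp, capp, capp, ← lunc_gcomp, gcomp, gcomp, Category.assoc, eComp_π,
    MonoidalCategory.tensorHom_comp_tensorHom_assoc]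

theorem capp_natural {F G : EnrichedFunctor V K V} {Z : V} (f : Z ⟶ (F ⟶[V] G)) (k l : K) :
    capp f k ▷ (k ⟶[V] l) ≫ ract G k l = (α_ _ _ _).hom ≫ Z ◁ ract F k l ≫ capp f l :=
  (isNatural_iff_ract _).1 ((natHom.π_natural F G).precomp f) k l

theorem capp_ext {F G : EnrichedFunctor V K V} {Z : V} {f g : Z ⟶ (F ⟶[V] G)}
    (h : ∀ k, capp f k = capp g k) : f = g :=
  natHom.hom_ext fun k => lunc_injective (h k)

/-- A generalised morphism of functors into `V` given by its components. -/
def clift {F G : EnrichedFunctor V K V} {Z : V} (φ : ∀ k : K, Z ⊗ F.obj k ⟶ G.obj k)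
    (h : ∀ k l, φ k ▷ (k ⟶[V] l) ≫ ract G k l = (α_ _ _ _).hom ≫ Z ◁ ract F k l ≫ φ l) :
    Z ⟶ (F ⟶[V] G) :=
  natHom.lift (fun k => lcur (φ k)) ((isNatural_iff_ract _).2 fun k l => by
    rw [lunc_lcur, lunc_lcur]
    exact h k l)

@[simp]
theorem capp_clift {F G : EnrichedFunctor V K V} {Z : V} (φ : ∀ k : K, Z ⊗ F.obj k ⟶ G.obj k)
    (h : ∀ k l, φ k ▷ (k ⟶[V] l) ≫ ract G k l = (α_ _ _ _).hom ≫ Z ◁ ract F k l ≫ φ l) (k : K) :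
    capp (clift φ h) k = φ k := by
  rw [capp, clift, natHom.lift_π, lunc_lcur]

/-- The components `F k ⟶ G k` of a morphism of functors into `V`. -/
def cleg {F G : EnrichedFunctor V K V} (f : 𝟙_ V ⟶ (F ⟶[V] G)) (k : K) : F.obj k ⟶ G.obj k :=
  (λ_ _).inv ≫ capp f k

theorem cleg_natural {F G : EnrichedFunctor V K V} (f : 𝟙_ V ⟶ (F ⟶[V] G)) (k l : K) :
    cleg f k ▷ (k ⟶[V] l) ≫ ract G k l = ract F k l ≫ cleg f l := by
  have h := capp_natural f k l
  rw [cleg, cleg, comp_whiskerRight_assoc, h, leftUnitor_inv_naturality_assoc]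
  simp

theorem cleg_ucomp {F G H : EnrichedFunctor V K V} (f : 𝟙_ V ⟶ (F ⟶[V] G))
    (g : 𝟙_ V ⟶ (G ⟶[V] H)) (k : K) : cleg (ucomp f g) k = cleg f k ≫ cleg g k := by
  rw [cleg, ucomp, ← gcomp, capp_comp, capp_gcomp, cleg, cleg]
  simp

theorem capp_leftUnitor_gcomp {F G H : EnrichedFunctor V K V} {Z : V} (f : 𝟙_ V ⟶ (F ⟶[V] G))
    (g : Z ⟶ (G ⟶[V] H)) (k : K) :
    capp ((λ_ Z).inv ≫ gcomp f g) k = Z ◁ cleg f k ≫ capp g k := by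
  rw [capp_comp, capp_gcomp, cleg]
  simp

/-- A morphism of functors into `V` given by its components. -/
def mkCleg {F G : EnrichedFunctor V K V} (φ : ∀ k : K, F.obj k ⟶ G.obj k)
    (h : ∀ k l, φ k ▷ (k ⟶[V] l) ≫ ract G k l = ract F k l ≫ φ l) : 𝟙_ V ⟶ (F ⟶[V] G) :=
  clift (fun k => (λ_ _).hom ≫ φ k) fun k l => by
    rw [comp_whiskerRight_assoc, h]
    simp

@[simp]
theorem cleg_mkCleg {F G : EnrichedFunctor V K V} (φ : ∀ k : K, F.obj k ⟶ G.obj k)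
    (h : ∀ k l, φ k ▷ (k ⟶[V] l) ≫ ract G k l = ract F k l ≫ φ l) (k : K) :
    cleg (mkCleg φ h) k = φ k := by
  rw [cleg, mkCleg, capp_clift, Iso.inv_hom_id_assoc]

end FunctorMorphisms

section Comparison

variable {V : Type u} [Category.{v} V] [MonoidalCategory V] [SymmetricCategory V]
  [MonoidalClosed V] [Limits.HasLimits V]
variable {B : Type w} [EnrichedCategory V B] {C : Type w₁} [EnrichedCategory V C]
variable {K : Type v} [EnrichedCategory V K]

theorem comp_precomp {X Y Z : B} {P : V} (f : 𝟙_ V ⟶ (X ⟶[V] Y)) (g : P ⟶ (Y ⟶[V] Z)) :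
    g ≫ precomp f Z = (λ_ P).inv ≫ gcomp f g := by
  rw [precomp, leftUnitor_inv_naturality_assoc, ← gcomp, whiskerLeft_gcomp, Category.comp_id]

/-- A morphism of `V` is invertible if and only if it is bijective on generalised elements. -/
theorem isIso_iff_existsUnique {X Y : V} (f : X ⟶ Y) :
    IsIso f ↔ ∀ (Z : V) (y : Z ⟶ Y), ∃! x : Z ⟶ X, x ≫ f = y := by
  constructor
  · intro h Z y
    exact ⟨y ≫ inv f, by simp, fun x hx => by rw [← hx]; simp⟩
  · intro h
    obtain ⟨g, hg, -⟩ := h Y (𝟙 Y)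
    exact ⟨g, (h X f).unique (by rw [Category.assoc, hg, Category.comp_id]) (Category.id_comp f),
      hg⟩

theorem papp_homToFunctor (G : EnrichedFunctor V K B) {b x : B} {Z : V} (g : Z ⟶ (b ⟶[V] x))
    (k : K) :
    papp (g ≫ (homToFunctor G).map b x) k = gcomp (𝟙 (G.obj k ⟶[V] b)) g := by
  have h : (homToFunctor G).map b x ≫ natHom.π (homTo G b) (homTo G x) (op k) =
      homToMap G b x (op k) := natHom.lift_π _ _ _
  rw [papp, Category.assoc]
  refine (congrArg (fun t => unc (g ≫ t)) h).trans ?_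
  refine (congrArg unc (comp_post _ _ _)).trans ?_
  rw [Category.comp_id]
  exact unc_cur _

theorem capp_homFromFunctor (G : EnrichedFunctor V K B) {b x : B} {Z : V} (g : Z ⟶ (x ⟶[V] b))
    (k : K) :
    capp (g ≫ (homFromFunctor G).map (op b) (op x)) k = gcomp g (𝟙 (b ⟶[V] G.obj k)) := by
  have h : (homFromFunctor G).map (op b) (op x) ≫ natHom.π (homFrom G b) (homFrom G x) k =
      homFromMap G b x k := natHom.lift_π _ _ _
  rw [capp, Category.assoc]
  refine (congrArg (fun t => lunc (g ≫ t)) h).trans ?_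
  refine (congrArg lunc (comp_pre _ _ _)).trans ?_
  rw [Category.comp_id]
  exact lunc_lcur _

theorem papp_homToFunctor_precomp {F : EnrichedFunctor V Kᵒᵖ V} {G : EnrichedFunctor V K B} {b : B}
    (ι : 𝟙_ V ⟶ (F ⟶[V] homTo G b)) {Z : V} {x : B} (g : Z ⟶ (b ⟶[V] x)) (k : K) :
    papp (g ≫ (homToFunctor G).map b x ≫ precomp ι (homTo G x)) k = gcomp (leg ι k) g := by
  obtain ⟨g', hg', e⟩ : ∃ g' : Z ⟶ (homTo G b ⟶[V] homTo G x),
      papp g' k = gcomp (𝟙 (G.obj k ⟶[V] b)) g ∧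
      g ≫ (homToFunctor G).map b x ≫ precomp ι (homTo G x) = (λ_ Z).inv ≫ gcomp ι g' :=
    ⟨g ≫ (homToFunctor G).map b x, papp_homToFunctor G g k,
      (Category.assoc _ _ _).symm.trans (comp_precomp ι _)⟩
  refine (congrArg (fun t => papp t k) e).trans ?_
  refine Eq.trans ?_ ((whiskerRight_gcomp (leg ι k) (𝟙 _) g).trans
    (congrArg (fun t => gcomp t g) (Category.comp_id _)))
  rw [papp_leftUnitor_gcomp]
  exact congrArg (fun t => leg ι k ▷ Z ≫ t) hg'

theorem capp_homFromFunctor_precomp {F : EnrichedFunctor V K V} {G : EnrichedFunctor V K B} {b : B}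
    (ρ : 𝟙_ V ⟶ (F ⟶[V] homFrom G b)) {Z : V} {x : B} (g : Z ⟶ (x ⟶[V] b)) (k : K) :
    capp (g ≫ (homFromFunctor G).map (op b) (op x) ≫ precomp ρ (homFrom G x)) k =
      gcomp g (cleg ρ k) := by
  obtain ⟨g', hg', e⟩ : ∃ g' : Z ⟶ (homFrom G b ⟶[V] homFrom G x),
      capp g' k = gcomp g (𝟙 (b ⟶[V] G.obj k)) ∧
      g ≫ (homFromFunctor G).map (op b) (op x) ≫ precomp ρ (homFrom G x) =
        (λ_ Z).inv ≫ gcomp ρ g' :=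
    ⟨g ≫ (homFromFunctor G).map (op b) (op x), capp_homFromFunctor G g k,
      (Category.assoc _ _ _).symm.trans (comp_precomp ρ _)⟩
  refine (congrArg (fun t => capp t k) e).trans ?_
  refine Eq.trans ?_ ((whiskerLeft_gcomp (cleg ρ k) g (𝟙 _)).trans
    (congrArg (fun t => gcomp g t) (Category.comp_id _)))
  rw [capp_leftUnitor_gcomp]
  exact congrArg (fun t => Z ◁ cleg ρ k ≫ t) hg'

/-- Weighted colimits in terms of generalised elements. -/
theorem isIndexedColimit_iff {F : EnrichedFunctor V Kᵒᵖ V} {G : EnrichedFunctor V K B} {b : B}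
    (ι : 𝟙_ V ⟶ (F ⟶[V] homTo G b)) :
    IsIndexedColimit F G b ι ↔ IsColimitCocone F G b (leg ι) := by
  have hnat : ∀ k l, lact F k l ≫ leg ι k = gcomp (G.map k l) (leg ι l) := fun k l =>
    (leg_natural ι k l).trans (whiskerLeft_lact_homTo G b k l (leg ι l))
  constructor
  · rintro ⟨h⟩
    refine ⟨hnat, fun {Z x} φ hφ => ?_⟩
    have hφ' : ∀ k l, lact F k l ▷ Z ≫ φ k =
        (α_ _ _ _).hom ≫ (k ⟶[V] l) ◁ φ l ≫ lact (homTo G x) k l := fun k l =>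
      (hφ k l).trans (congrArg (fun t => (α_ _ _ _).hom ≫ t)
        (whiskerLeft_lact_homTo G x k l (φ l)).symm)
    obtain ⟨g, hg, hu⟩ := (isIso_iff_existsUnique _).1 (h x) Z
      (plift (F := F) (G := homTo G x) φ hφ')
    refine ⟨g, fun k => ?_, fun g' hg' => hu g' ?_⟩
    · rw [← papp_homToFunctor_precomp, hg]
      exact papp_plift (F := F) (G := homTo G x) φ hφ' k
    · refine papp_ext fun k => (papp_homToFunctor_precomp ι g' k).trans ?_
      exact (hg' k).trans (papp_plift (F := F) (G := homTo G x) φ hφ' k).symm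
  · intro h
    refine ⟨fun x => (isIso_iff_existsUnique _).2 fun Z y => ?_⟩
    obtain ⟨g, hg, hu⟩ := h.existsUnique (fun k => papp y k) (fun k l =>
      (papp_natural y k l).trans (congrArg (fun t => (α_ _ _ _).hom ≫ t)
        (whiskerLeft_lact_homTo G x k l (papp y l))))
    refine ⟨g, papp_ext fun k => ?_, fun g' hg' => hu g' fun k => ?_⟩
    · rw [papp_homToFunctor_precomp]
      exact hg k
    · subst hg'
      exact (papp_homToFunctor_precomp ι g' k).symm

/-- Weighted limits in terms of generalised elements. -/
theorem isIndexedLimit_iff {F : EnrichedFunctor V K V} {G : EnrichedFunctor V K B} {b : B}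
    (ρ : 𝟙_ V ⟶ (F ⟶[V] homFrom G b)) :
    IsIndexedLimit F G b ρ ↔ IsLimitCone F G b (cleg ρ) := by
  have hnat : ∀ k l, gcomp (cleg ρ k) (G.map k l) = ract F k l ≫ cleg ρ l := fun k l =>
    (whiskerRight_ract_homFrom G b k l (cleg ρ k)).symm.trans (cleg_natural ρ k l)
  constructor
  · rintro ⟨h⟩
    refine ⟨hnat, fun {Z x} φ hφ => ?_⟩
    have hφ' : ∀ k l, φ k ▷ (k ⟶[V] l) ≫ ract (homFrom G x) k l =
        (α_ _ _ _).hom ≫ Z ◁ ract F k l ≫ φ l := fun k l =>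
      (whiskerRight_ract_homFrom G x k l (φ k)).trans (hφ k l)
    obtain ⟨g, hg, hu⟩ := (isIso_iff_existsUnique _).1 (h x) Z
      (clift (F := F) (G := homFrom G x) φ hφ')
    refine ⟨g, fun k => ?_, fun g' hg' => hu g' ?_⟩
    · rw [← capp_homFromFunctor_precomp, hg]
      exact capp_clift (F := F) (G := homFrom G x) φ hφ' k
    · refine capp_ext fun k => (capp_homFromFunctor_precomp ρ g' k).trans ?_
      exact (hg' k).trans (capp_clift (F := F) (G := homFrom G x) φ hφ' k).symm
  · intro h
    refine ⟨fun x => (isIso_iff_existsUnique _).2 fun Z y => ?_⟩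
    obtain ⟨g, hg, hu⟩ := h.existsUnique (fun k => capp y k) (fun k l =>
      (whiskerRight_ract_homFrom G x k l (capp y k)).symm.trans (capp_natural y k l))
    refine ⟨g, capp_ext fun k => ?_, fun g' hg' => hu g' fun k => ?_⟩
    · rw [capp_homFromFunctor_precomp]
      exact hg k
    · subst hg'
      exact (capp_homFromFunctor_precomp ρ g' k).symm

theorem IsColimitCocone.exists_leg {F : EnrichedFunctor V Kᵒᵖ V} {G : EnrichedFunctor V K B} {b : B}
    {c : ∀ k, F.obj (op k) ⟶ (G.obj k ⟶[V] b)} (h : IsColimitCocone F G b c) :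
    ∃ ι : 𝟙_ V ⟶ (F ⟶[V] homTo G b), IsIndexedColimit F G b ι ∧ leg ι = c := by
  refine ⟨mkLeg c fun k l => (h.natural k l).trans (whiskerLeft_lact_homTo G b k l (c l)).symm, ?_⟩
  have e : leg (mkLeg (F := F) (G := homTo G b) c fun k l =>
      (h.natural k l).trans (whiskerLeft_lact_homTo G b k l (c l)).symm) = c :=
    funext fun k => leg_mkLeg (F := F) (G := homTo G b) c _ k
  rw [isIndexedColimit_iff, e]
  exact ⟨h, rfl⟩

theorem IsLimitCone.exists_cleg {F : EnrichedFunctor V K V} {G : EnrichedFunctor V K B} {b : B}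
    {r : ∀ k, F.obj k ⟶ (b ⟶[V] G.obj k)} (h : IsLimitCone F G b r) :
    ∃ ρ : 𝟙_ V ⟶ (F ⟶[V] homFrom G b), IsIndexedLimit F G b ρ ∧ cleg ρ = r := by
  refine ⟨mkCleg r fun k l => (whiskerRight_ract_homFrom G b k l (r k)).trans (h.natural k l), ?_⟩
  have e : cleg (mkCleg (F := F) (G := homFrom G b) r fun k l =>
      (whiskerRight_ract_homFrom G b k l (r k)).trans (h.natural k l)) = r :=
    funext fun k => cleg_mkCleg (F := F) (G := homFrom G b) r _ k
  rw [isIndexedLimit_iff, e]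
  exact ⟨h, rfl⟩

theorem unc_curry' {X Y : V} (f : X ⟶ Y) :
    unc (MonoidalClosed.curry' f : 𝟙_ V ⟶ (EnrichedCategory.Hom X Y : V)) = (ρ_ X).hom ≫ f :=
  unc_cur _

theorem lunc_curry' {X Y : V} (f : X ⟶ Y) :
    lunc (MonoidalClosed.curry' f : 𝟙_ V ⟶ (EnrichedCategory.Hom X Y : V)) = (λ_ X).hom ≫ f := by
  rw [lunc, unc_curry']
  simp

theorem leg_mapTo (G : EnrichedFunctor V K B) (S : EnrichedFunctor V B C) (b : B) (k : K) :
    leg (mapTo G S b) k = S.map (G.obj k) b := by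
  rw [leg, papp, mapTo, natHom.lift_π]
  exact (congrArg (fun t => (ρ_ _).inv ≫ t) (unc_curry' _)).trans (Iso.inv_hom_id_assoc _ _)

theorem cleg_mapFrom (G : EnrichedFunctor V K B) (S : EnrichedFunctor V B C) (b : B) (k : K) :
    cleg (mapFrom G S b) k = S.map b (G.obj k) := by
  rw [cleg, capp, mapFrom, natHom.lift_π]
  exact (congrArg (fun t => (λ_ _).inv ≫ t) (lunc_curry' _)).trans (Iso.inv_hom_id_assoc _ _)

theorem leg_preNat {G H : EnrichedFunctor V K B} (η : 𝟙_ V ⟶ (G ⟶[V] H)) (b : B) (k : K) :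
    leg (preNat η b) k = precomp (η ≫ natHom.π G H k) b := by
  rw [leg, papp, preNat, natHom.lift_π]
  exact (congrArg (fun t => (ρ_ _).inv ≫ t) (unc_curry' _)).trans (Iso.inv_hom_id_assoc _ _)

theorem isCocontinuous_iff {φ : ColimitIndexes V} {S : EnrichedFunctor V B C} :
    IsCocontinuous φ S ↔ ∀ (K : Type v) [EnrichedCategory V K] (F : EnrichedFunctor V Kᵒᵖ V),
      φ K F → ∀ (G : EnrichedFunctor V K B) (b : B) (c : ∀ k, F.obj (op k) ⟶ (G.obj k ⟶[V] b)),
        IsColimitCocone F G b c →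
          IsColimitCocone F (G.comp V S) (S.obj b) (fun k => c k ≫ S.map (G.obj k) b) := by
  have e : ∀ (K : Type v) [EnrichedCategory V K] (F : EnrichedFunctor V Kᵒᵖ V)
      (G : EnrichedFunctor V K B) (b : B) (ι : 𝟙_ V ⟶ (F ⟶[V] homTo G b)),
      leg (ucomp ι (mapTo G S b)) = fun k => leg ι k ≫ S.map (G.obj k) b := by
    intro K _ F G b ι
    funext k
    rw [leg_ucomp, leg_mapTo]
    rfl
  constructor
  · intro h K _ F hF G b c hc
    obtain ⟨ι, hι, rfl⟩ := hc.exists_leg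
    have := h K F hF G b ι hι
    rw [isIndexedColimit_iff, e] at this
    exact this
  · intro h K _ F hF G b ι hι
    rw [isIndexedColimit_iff, e]
    exact h K F hF G b _ ((isIndexedColimit_iff ι).1 hι)

theorem isContinuous_iff {P : LimitIndexes V} {S : EnrichedFunctor V B C} :
    IsContinuous P S ↔ ∀ (K : Type v) [EnrichedCategory V K] (F : EnrichedFunctor V K V),
      P K F → ∀ (G : EnrichedFunctor V K B) (b : B) (r : ∀ k, F.obj k ⟶ (b ⟶[V] G.obj k)),
        IsLimitCone F G b r →
          IsLimitCone F (G.comp V S) (S.obj b) (fun k => r k ≫ S.map b (G.obj k)) := by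
  have e : ∀ (K : Type v) [EnrichedCategory V K] (F : EnrichedFunctor V K V)
      (G : EnrichedFunctor V K B) (b : B) (ρ : 𝟙_ V ⟶ (F ⟶[V] homFrom G b)),
      cleg (ucomp ρ (mapFrom G S b)) = fun k => cleg ρ k ≫ S.map b (G.obj k) := by
    intro K _ F G b ρ
    funext k
    rw [cleg_ucomp, cleg_mapFrom]
    rfl
  constructor
  · intro h K _ F hF G b c hc
    obtain ⟨ρ, hρ, rfl⟩ := hc.exists_cleg
    have := h K F hF G b ρ hρ
    rw [isIndexedLimit_iff, e] at this
    exact this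
  · intro h K _ F hF G b ρ hρ
    rw [isIndexedLimit_iff, e]
    exact h K F hF G b _ ((isIndexedLimit_iff ρ).1 hρ)

theorem isCocomplete_iff {φ : ColimitIndexes V} :
    IsCocomplete φ B ↔ ∀ (K : Type v) [EnrichedCategory V K] (F : EnrichedFunctor V Kᵒᵖ V),
      φ K F → ∀ G : EnrichedFunctor V K B, ∃ (b : B) (c : ∀ k, F.obj (op k) ⟶ (G.obj k ⟶[V] b)),
        IsColimitCocone F G b c := by
  constructor
  · intro h K _ F hF G
    obtain ⟨b, ι, hι⟩ := h K F hF G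
    exact ⟨b, _, (isIndexedColimit_iff ι).1 hι⟩
  · intro h K _ F hF G
    obtain ⟨b, c, hc⟩ := h K F hF G
    obtain ⟨ι, hι, -⟩ := hc.exists_leg
    exact ⟨b, ι, hι⟩

/-- The components `C(J a, c) ⟶ B(G a, L c)` of the cocone attached to `η : G ⟶ L J`. -/
def kanLeg {A : Type v} [EnrichedCategory V A] {J : EnrichedFunctor V A C}
    {G : EnrichedFunctor V A B} {L : EnrichedFunctor V C B} (η : 𝟙_ V ⟶ (G ⟶[V] J.comp V L)) (c : C)
    (a : A) : (J.obj a ⟶[V] c) ⟶ (G.obj a ⟶[V] L.obj c) :=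
  L.map (J.obj a) c ≫ precomp (η ≫ natHom.π G (J.comp V L) a) (L.obj c)

theorem isLeftKanExtension_iff {A : Type v} [EnrichedCategory V A] {J : EnrichedFunctor V A C}
    {G : EnrichedFunctor V A B} {L : EnrichedFunctor V C B} {η : 𝟙_ V ⟶ (G ⟶[V] J.comp V L)} :
    IsLeftKanExtension J G L η ↔
      ∀ c, IsColimitCocone (homTo J c) G (L.obj c) (kanLeg η c) := by
  refine forall_congr' fun c => ?_
  have e : leg (ucomp (mapTo J L c) (preNat η (L.obj c))) = kanLeg η c := by
    funext k
    rw [leg_ucomp, leg_mapTo, leg_preNat]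
    rfl
  rw [isIndexedColimit_iff, e]

end Comparison

/-! ### Composition with morphisms, and quasi-inverses of fully faithful functors -/

section UnitGraded

variable {V : Type u} [Category.{v} V] [MonoidalCategory V]
variable {D : Type w} [EnrichedCategory V D] {E : Type w₁} [EnrichedCategory V E]

/-- Composition of a morphism `X ⟶ Y` with a generalised morphism `P ⟶ D(Y, Z)`. -/
def lmul {X Y Z : D} {P : V} (a : 𝟙_ V ⟶ (X ⟶[V] Y)) (f : P ⟶ (Y ⟶[V] Z)) : P ⟶ (X ⟶[V] Z) :=
  (λ_ P).inv ≫ gcomp a f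

/-- Composition of a generalised morphism `P ⟶ D(X, Y)` with a morphism `Y ⟶ Z`. -/
def rmul {X Y Z : D} {P : V} (f : P ⟶ (X ⟶[V] Y)) (a : 𝟙_ V ⟶ (Y ⟶[V] Z)) : P ⟶ (X ⟶[V] Z) :=
  (ρ_ P).inv ≫ gcomp f a

theorem comp_lmul {X Y Z : D} {P Q : V} (h : Q ⟶ P) (a : 𝟙_ V ⟶ (X ⟶[V] Y))
    (f : P ⟶ (Y ⟶[V] Z)) : h ≫ lmul a f = lmul a (h ≫ f) := by
  rw [lmul, lmul, leftUnitor_inv_naturality_assoc, whiskerLeft_gcomp]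

theorem comp_rmul {X Y Z : D} {P Q : V} (h : Q ⟶ P) (f : P ⟶ (X ⟶[V] Y))
    (a : 𝟙_ V ⟶ (Y ⟶[V] Z)) : h ≫ rmul f a = rmul (h ≫ f) a := by
  rw [rmul, rmul, rightUnitor_inv_naturality_assoc, whiskerRight_gcomp]

theorem lmul_map (S : EnrichedFunctor V D E) {X Y Z : D} {P : V} (a : 𝟙_ V ⟶ (X ⟶[V] Y))
    (f : P ⟶ (Y ⟶[V] Z)) : lmul a f ≫ S.map X Z = lmul (a ≫ S.map X Y) (f ≫ S.map Y Z) := by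
  rw [lmul, lmul, Category.assoc, gcomp_map]

theorem rmul_map (S : EnrichedFunctor V D E) {X Y Z : D} {P : V} (f : P ⟶ (X ⟶[V] Y))
    (a : 𝟙_ V ⟶ (Y ⟶[V] Z)) : rmul f a ≫ S.map X Z = rmul (f ≫ S.map X Y) (a ≫ S.map Y Z) := by
  rw [rmul, rmul, Category.assoc, gcomp_map]

theorem lmul_eq_rmul {X Y Z : D} (a : 𝟙_ V ⟶ (X ⟶[V] Y)) (b : 𝟙_ V ⟶ (Y ⟶[V] Z)) :
    lmul a b = rmul a b := by
  rw [lmul, rmul, unitors_inv_equal]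

theorem lmul_eId {X Y : D} {P : V} (f : P ⟶ (X ⟶[V] Y)) : lmul (eId V X) f = f := by
  rw [lmul, eId_gcomp, Iso.inv_hom_id_assoc]

theorem rmul_eId {X Y : D} {P : V} (f : P ⟶ (X ⟶[V] Y)) : rmul f (eId V Y) = f := by
  rw [rmul, gcomp_eId, Iso.inv_hom_id_assoc]

theorem gcomp_lmul {X Y Z W : D} {P Q : V} (f : P ⟶ (X ⟶[V] Y)) (a : 𝟙_ V ⟶ (Y ⟶[V] Z))
    (g : Q ⟶ (Z ⟶[V] W)) : gcomp f (lmul a g) = gcomp (rmul f a) g := by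
  rw [lmul, rmul, ← whiskerLeft_gcomp, ← whiskerRight_gcomp, gcomp_assoc]
  simp

theorem lmul_gcomp {X Y Z W : D} {P Q : V} (a : 𝟙_ V ⟶ (X ⟶[V] Y)) (f : P ⟶ (Y ⟶[V] Z))
    (g : Q ⟶ (Z ⟶[V] W)) : lmul a (gcomp f g) = gcomp (lmul a f) g := by
  rw [lmul, lmul, ← whiskerRight_gcomp, gcomp_assoc]
  simp

theorem rmul_gcomp {X Y Z W : D} {P Q : V} (f : P ⟶ (X ⟶[V] Y)) (g : Q ⟶ (Y ⟶[V] Z))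
    (a : 𝟙_ V ⟶ (Z ⟶[V] W)) : rmul (gcomp f g) a = gcomp f (rmul g a) := by
  rw [rmul, rmul, ← whiskerLeft_gcomp, gcomp_assoc]
  simp

theorem lmul_lmul {X Y Z W : D} {P : V} (a : 𝟙_ V ⟶ (X ⟶[V] Y)) (b : 𝟙_ V ⟶ (Y ⟶[V] Z))
    (f : P ⟶ (Z ⟶[V] W)) : lmul a (lmul b f) = lmul (lmul a b) f := by
  rw [lmul, gcomp_lmul, lmul_eq_rmul a b]
  rfl

theorem rmul_rmul {X Y Z W : D} {P : V} (f : P ⟶ (X ⟶[V] Y)) (a : 𝟙_ V ⟶ (Y ⟶[V] Z))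
    (b : 𝟙_ V ⟶ (Z ⟶[V] W)) : rmul (rmul f a) b = rmul f (lmul a b) := by
  rw [rmul, ← gcomp_lmul]
  rfl

theorem lmul_rmul {X Y Z W : D} {P : V} (a : 𝟙_ V ⟶ (X ⟶[V] Y)) (f : P ⟶ (Y ⟶[V] Z))
    (b : 𝟙_ V ⟶ (Z ⟶[V] W)) : lmul a (rmul f b) = rmul (lmul a f) b := by
  rw [rmul, rmul, ← comp_lmul, lmul_gcomp]

end UnitGraded

section Equivalence

variable {V : Type u} [Category.{v} V] [MonoidalCategory V] [SymmetricCategory V]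
variable {X : Type w} [EnrichedCategory V X] {Y : Type w₁} [EnrichedCategory V Y]

theorem isNatural_unit_iff {F G : EnrichedFunctor V X Y}
    (τ : ∀ x, 𝟙_ V ⟶ (F.obj x ⟶[V] G.obj x)) :
    natHom.IsNatural F G τ ↔ ∀ x y, rmul (F.map x y) (τ y) = lmul (τ x) (G.map x y) := by
  refine forall_congr' fun x => forall_congr' fun y => ?_
  rw [← cancel_epi (λ_ (x ⟶[V] y)).inv]
  refine Eq.congr_left ?_
  rw [rmul, gcomp]
  simp

/-- A quasi-inverse of a fully faithful `V`-functor `R`, given a choice, for each object `y`, of an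
object `L y` and an isomorphism `η y : y ≅ R (L y)`. -/
def inverseOfFullyFaithful (R : EnrichedFunctor V X Y) (hR : ∀ x x', IsIso (R.map x x'))
    (L : Y → X) (η : ∀ y, 𝟙_ V ⟶ (y ⟶[V] R.obj (L y))) (η' : ∀ y, 𝟙_ V ⟶ (R.obj (L y) ⟶[V] y))
    (h₁ : ∀ y, lmul (η y) (η' y) = eId V y) (h₂ : ∀ y, lmul (η' y) (η y) = eId V (R.obj (L y))) :
    EnrichedFunctor V Y X where
  obj := L
  -- `g : y ⟶ y'` is sent to the morphism that `R` maps to `η y' ∘ g ∘ (η y)⁻¹`.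
  map y y' := rmul (lmul (η' y) (𝟙 (y ⟶[V] y'))) (η y') ≫ inv (R.map (L y) (L y'))
  map_id y := by
    rw [← cancel_mono (R.map (L y) (L y)), Category.assoc, Category.assoc, IsIso.inv_hom_id,
      Category.comp_id, R.map_id, comp_rmul, comp_lmul, Category.comp_id, ← lmul_rmul,
      ← lmul_eq_rmul, lmul_eId, h₂]
  map_comp y y' y'' := by
    rw [← cancel_mono (R.map (L y) (L y'')), ← gcomp, gcomp_map]
    simp only [Category.assoc, IsIso.inv_hom_id, Category.comp_id]
    rw [comp_rmul, comp_lmul, Category.comp_id, ← gcomp_lmul, lmul_rmul, lmul_lmul, h₁,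
      lmul_eId, eComp_eq_gcomp, lmul_gcomp, rmul_gcomp]

variable (R : EnrichedFunctor V X Y) (hR : ∀ x x', IsIso (R.map x x'))
    (L : Y → X) (η : ∀ y, 𝟙_ V ⟶ (y ⟶[V] R.obj (L y))) (η' : ∀ y, 𝟙_ V ⟶ (R.obj (L y) ⟶[V] y))
    (h₁ : ∀ y, lmul (η y) (η' y) = eId V y) (h₂ : ∀ y, lmul (η' y) (η y) = eId V (R.obj (L y)))

theorem inverseOfFullyFaithful_map_comp (y y' : Y) :
    (inverseOfFullyFaithful R hR L η η' h₁ h₂).map y y' ≫ R.map (L y) (L y') =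
      rmul (lmul (η' y) (𝟙 (y ⟶[V] y'))) (η y') := by
  refine (Category.assoc _ _ _).trans ?_
  exact (congrArg (fun t => _ ≫ t) (IsIso.inv_hom_id (R.map (L y) (L y')))).trans
    (Category.comp_id _)

/-- The chosen isomorphisms `η y` form a `V`-natural isomorphism. -/
def inverseUnit : VNatIso (EnrichedFunctor.id V Y)
    ((inverseOfFullyFaithful R hR L η η' h₁ h₂).comp V R) where
  hom := η
  inv := η'
  hom_inv := h₁
  inv_hom := h₂
  natural := (isNatural_unit_iff _).2 fun y y' => by
    change rmul (𝟙 _) (η y') = lmul (η y)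
      ((inverseOfFullyFaithful R hR L η η' h₁ h₂).map y y' ≫ R.map (L y) (L y'))
    rw [inverseOfFullyFaithful_map_comp, lmul_rmul, lmul_lmul, h₁, lmul_eId]

/-- The counit is the preimage under `R` of the inverse of `η` at `R x`. -/
theorem nonempty_inverseCounit : Nonempty (VNatIso
    (R.comp V (inverseOfFullyFaithful R hR L η η' h₁ h₂)) (EnrichedFunctor.id V X)) := by
  let ε (x : X) : 𝟙_ V ⟶ (L (R.obj x) ⟶[V] x) := η' (R.obj x) ≫ inv (R.map (L (R.obj x)) x)
  let ε' (x : X) : 𝟙_ V ⟶ (x ⟶[V] L (R.obj x)) := η (R.obj x) ≫ inv (R.map x (L (R.obj x)))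
  have hε (x : X) : ε x ≫ R.map (L (R.obj x)) x = η' (R.obj x) := by simp [ε]
  have hε' (x : X) : ε' x ≫ R.map x (L (R.obj x)) = η (R.obj x) := by simp [ε']
  have k₁ (x : X) : lmul (ε x) (ε' x) = eId V (L (R.obj x)) := by
    rw [← cancel_mono (R.map (L (R.obj x)) (L (R.obj x))), lmul_map, hε, hε', h₂, R.map_id]
  have k₂ (x : X) : lmul (ε' x) (ε x) = eId V x := by
    rw [← cancel_mono (R.map x x), lmul_map, hε, hε', h₁, R.map_id]
  have key (m : ∀ y y', (y ⟶[V] y') ⟶ (L y ⟶[V] L y'))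
      (hm : ∀ y y', m y y' ≫ R.map (L y) (L y') = rmul (lmul (η' y) (𝟙 (y ⟶[V] y'))) (η y'))
      (x x' : X) : rmul (R.map x x' ≫ m (R.obj x) (R.obj x')) (ε x') =
        lmul (ε x) (𝟙 (x ⟶[V] x')) := by
    rw [← cancel_mono (R.map (L (R.obj x)) x'), rmul_map, lmul_map, Category.assoc, hm, hε, hε,
      Category.id_comp, comp_rmul, comp_lmul, Category.comp_id, rmul_rmul, h₁, rmul_eId]
  exact ⟨⟨ε, ε', k₁, k₂, (isNatural_unit_iff _).2
    (key _ (inverseOfFullyFaithful_map_comp R hR L η η' h₁ h₂))⟩⟩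

end Equivalence

/-! ### Weighted colimits and left Kan extensions -/

section ColimitCocones

variable {V : Type u} [Category.{v} V] [MonoidalCategory V] [SymmetricCategory V]
  [MonoidalClosed V]
variable {K : Type w} [EnrichedCategory V K] {B : Type w₁} [EnrichedCategory V B]

/-- The inverse of an isomorphism of presheaves is compatible with the actions. -/
theorem lact_comp_inv {F F' : EnrichedFunctor V Kᵒᵖ V} {e : ∀ k, F'.obj (op k) ≅ F.obj (op k)}
    (he : ∀ k l, lact F' k l ≫ (e k).hom = (k ⟶[V] l) ◁ (e l).hom ≫ lact F k l) (k l : K) :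
    lact F k l ≫ (e k).inv = (k ⟶[V] l) ◁ (e l).inv ≫ lact F' k l := by
  rw [Iso.comp_inv_eq, Category.assoc, he, ← MonoidalCategory.whiskerLeft_comp_assoc,
    Iso.inv_hom_id, MonoidalCategory.whiskerLeft_id, Category.id_comp]

/-- A weighted colimit may be reindexed along an isomorphism of weights. -/
theorem IsColimitCocone.reindex {F F' : EnrichedFunctor V Kᵒᵖ V} {G : EnrichedFunctor V K B} {b : B}
    {c : ∀ k, F.obj (op k) ⟶ (G.obj k ⟶[V] b)} (h : IsColimitCocone F G b c)
    (e : ∀ k, F'.obj (op k) ≅ F.obj (op k))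
    (he : ∀ k l, lact F' k l ≫ (e k).hom = (k ⟶[V] l) ◁ (e l).hom ≫ lact F k l) :
    IsColimitCocone F' G b (fun k => (e k).hom ≫ c k) := by
  have he' := lact_comp_inv he
  refine ⟨fun k l => ?_, fun {Z x} φ hφ => ?_⟩
  · rw [reassoc_of% he, h.natural, whiskerLeft_gcomp]
  · obtain ⟨g, hg, hu⟩ := h.existsUnique (fun k => (e k).inv ▷ Z ≫ φ k) (fun k l => by
      rw [← comp_whiskerRight_assoc, he', comp_whiskerRight_assoc, hφ k l,
        whisker_assoc_assoc, Iso.inv_hom_id_assoc, whiskerLeft_gcomp])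
    refine ⟨g, fun k => ?_, fun g' hg' => hu g' fun k => ?_⟩
    · rw [← whiskerRight_gcomp, hg, hom_inv_whiskerRight_assoc]
    · rw [← hg' k, whiskerRight_gcomp, Iso.inv_hom_id_assoc]

/-- A weighted colimit may be replaced by an isomorphic object. -/
theorem IsColimitCocone.ofIso {F : EnrichedFunctor V Kᵒᵖ V} {G : EnrichedFunctor V K B} {b b' : B}
    {c : ∀ k, F.obj (op k) ⟶ (G.obj k ⟶[V] b)} (h : IsColimitCocone F G b c)
    {s : 𝟙_ V ⟶ (b ⟶[V] b')} {t : 𝟙_ V ⟶ (b' ⟶[V] b)} (hst : lmul s t = eId V b)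
    (hts : lmul t s = eId V b') {c' : ∀ k, F.obj (op k) ⟶ (G.obj k ⟶[V] b')}
    (hc' : ∀ k, rmul (c k) s = c' k) :
    IsColimitCocone F G b' c' := by
  obtain rfl : (fun k => rmul (c k) s) = c' := funext hc'
  refine ⟨fun k l => ?_, fun {Z x} φ hφ => ?_⟩
  · rw [comp_rmul, h.natural, rmul_gcomp]
  · obtain ⟨g, hg, hu⟩ := h.existsUnique φ hφ
    refine ⟨lmul t g, fun k => ?_, fun g' hg' => ?_⟩
    · rw [← gcomp_lmul, lmul_lmul, hst, lmul_eId, hg]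
    · have : lmul s g' = g := hu _ fun k => by rw [gcomp_lmul]; exact hg' k
      rw [← this, lmul_lmul, hts, lmul_eId]

/-- Two colimits of the same diagram are canonically isomorphic. -/
theorem IsColimitCocone.exists_iso {F : EnrichedFunctor V Kᵒᵖ V} {G : EnrichedFunctor V K B}
    {b b' : B} {c : ∀ k, F.obj (op k) ⟶ (G.obj k ⟶[V] b)}
    {c' : ∀ k, F.obj (op k) ⟶ (G.obj k ⟶[V] b')} (h : IsColimitCocone F G b c)
    (h' : IsColimitCocone F G b' c') :
    ∃ (s : 𝟙_ V ⟶ (b ⟶[V] b')) (t : 𝟙_ V ⟶ (b' ⟶[V] b)), lmul s t = eId V b ∧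
      lmul t s = eId V b' ∧ ∀ k, rmul (c k) s = c' k := by
  have cocone : ∀ {b : B} {c : ∀ k, F.obj (op k) ⟶ (G.obj k ⟶[V] b)},
      IsColimitCocone F G b c → IsCocone F G (fun k => (ρ_ _).hom ≫ c k) := by
    intro b c h k l
    rw [rightUnitor_naturality_assoc, h.natural, ← whiskerLeft_gcomp]
    simp
  obtain ⟨s, hs, -⟩ := h.existsUnique _ (cocone h')
  obtain ⟨t, ht, -⟩ := h'.existsUnique _ (cocone h)
  have hs' : ∀ k, rmul (c k) s = c' k := fun k => by rw [rmul, hs, Iso.inv_hom_id_assoc]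
  have ht' : ∀ k, rmul (c' k) t = c k := fun k => by rw [rmul, ht, Iso.inv_hom_id_assoc]
  refine ⟨s, t, h.hom_ext fun k => ?_, h'.hom_ext fun k => ?_, hs'⟩
  · rw [gcomp_lmul, hs', gcomp_eId, ht]
  · rw [gcomp_lmul, ht', gcomp_eId, hs]

variable {C : Type w₂} [EnrichedCategory V C] {C' : Type*} [EnrichedCategory V C']

/-- If the functors `B(L -, x)` are of the form `C'(i -, N)` for suitable `N`, then `L` preserves
every colimit that `i` preserves. -/
theorem IsColimitCocone.map_of_relativeAdjoint {F : EnrichedFunctor V Kᵒᵖ V}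
    {D : EnrichedFunctor V K C} {E : C} {e : ∀ k, F.obj (op k) ⟶ (D.obj k ⟶[V] E)}
    (L : EnrichedFunctor V C B) (i : EnrichedFunctor V C C')
    (he : ∀ k l, lact F k l ≫ e k = gcomp (D.map k l) (e l))
    (h : IsColimitCocone F (D.comp V i) (i.obj E) (fun k => e k ≫ i.map (D.obj k) E))
    (N : B → C') (θ : ∀ c x, (L.obj c ⟶[V] x) ≅ (i.obj c ⟶[V] N x))
    (hθ : ∀ c c' x, gcomp (L.map c c') (𝟙 (L.obj c' ⟶[V] x)) ≫ (θ c x).hom =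
      gcomp (i.map c c') (θ c' x).hom) :
    IsColimitCocone F (D.comp V L) (L.obj E) (fun k => e k ≫ L.map (D.obj k) E) := by
  have hθ' : ∀ {P Q : V} {c c' : C} {x : B} (p : P ⟶ (c ⟶[V] c')) (g : Q ⟶ (L.obj c' ⟶[V] x)),
      gcomp (p ≫ L.map c c') g ≫ (θ c x).hom = gcomp (p ≫ i.map c c') (g ≫ (θ c' x).hom) := by
    intro P Q c c' x p g
    have := congrArg (fun t => (p ⊗ₘ g) ≫ t) (hθ c c' x)
    simpa only [tensor_gcomp, tensor_gcomp_assoc, Category.comp_id] using this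
  refine ⟨fun k l => ?_, fun {Z x} φ hφ => ?_⟩
  · exact (Category.assoc _ _ _).symm.trans ((congrArg (fun t => t ≫ L.map (D.obj k) E)
      (he k l)).trans (gcomp_map L _ _))
  · obtain ⟨g, hg, hu⟩ := h.existsUnique (fun k => φ k ≫ (θ (D.obj k) x).hom) (fun k l =>
      (Category.assoc _ _ _).symm.trans ((congrArg (fun t => t ≫ (θ (D.obj k) x).hom)
        (hφ k l)).trans ((Category.assoc _ _ _).trans
          (congrArg (fun t => (α_ _ _ _).hom ≫ t) (hθ' (D.map k l) (φ l))))))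
    refine ⟨g ≫ (θ E x).inv, fun k => ?_, fun g' hg' => ?_⟩
    · have h1 := hθ' (e k) (g ≫ (θ E x).inv)
      rw [Category.assoc, Iso.inv_hom_id, Category.comp_id] at h1
      exact (cancel_mono (θ (D.obj k) x).hom).1 (h1.trans (hg k))
    · rw [Iso.eq_comp_inv]
      refine hu _ fun k => ?_
      exact (hθ' (e k) g').symm.trans (congrArg (fun t => t ≫ (θ (D.obj k) x).hom) (hg' k))

end ColimitCocones

section KanExtensions

variable {V : Type u} [Category.{v} V] [MonoidalCategory V] [SymmetricCategory V]
  [MonoidalClosed V] [Limits.HasLimits V]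
variable {B : Type w} [EnrichedCategory V B] {C : Type w₁} [EnrichedCategory V C]
variable {A : Type v} [EnrichedCategory V A]

/-- The components of the Kan extension cocone are composites with the unit. -/
theorem kanLeg_eq {J : EnrichedFunctor V A C} {G : EnrichedFunctor V A B}
    {L : EnrichedFunctor V C B} (η : 𝟙_ V ⟶ (G ⟶[V] J.comp V L)) (c : C) (a : A) :
    kanLeg η c a = lmul (η ≫ natHom.π G (J.comp V L) a) (L.map (J.obj a) c) :=
  comp_precomp (η ≫ natHom.π G (J.comp V L) a) _

theorem gcomp_kanLeg {J : EnrichedFunctor V A C} {G : EnrichedFunctor V A B}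
    {L : EnrichedFunctor V C B} (η : 𝟙_ V ⟶ (G ⟶[V] J.comp V L)) {c c' : C} {a : A} {P Q : V}
    (p : P ⟶ (J.obj a ⟶[V] c)) (q : Q ⟶ (c ⟶[V] c')) :
    gcomp (p ≫ kanLeg η c a) (q ≫ L.map c c') = gcomp p q ≫ kanLeg η c' a := by
  have key {X : B} (n : 𝟙_ V ⟶ (X ⟶[V] L.obj (J.obj a))) :
      gcomp (p ≫ lmul n (L.map (J.obj a) c)) (q ≫ L.map c c') =
        gcomp p q ≫ lmul n (L.map (J.obj a) c') := by
    rw [comp_lmul, comp_lmul, gcomp_map, lmul_gcomp]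
  rw [kanLeg_eq, kanLeg_eq]
  exact key _

/-- Cocones weighted by `C(J -, c)`, with the action of `A` on the weight made explicit. -/
theorem isCocone_homTo_iff {J : EnrichedFunctor V A C} {G : EnrichedFunctor V A B} {c : C} {Z : V}
    {x : B} (φ : ∀ a, (J.obj a ⟶[V] c) ⊗ Z ⟶ (G.obj a ⟶[V] x)) :
    IsCocone (homTo J c) G φ ↔ ∀ a a', gcomp (J.map a a') (𝟙 (J.obj a' ⟶[V] c)) ▷ Z ≫ φ a =
      (α_ _ _ _).hom ≫ gcomp (G.map a a') (φ a') :=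
  forall_congr' fun a => forall_congr' fun a' => Eq.congr_left
    (congrArg (fun t => t ▷ Z ≫ φ a) (lact_homTo J c a a'))

theorem IsColimitCocone.homTo_natural {J : EnrichedFunctor V A C} {G : EnrichedFunctor V A B}
    {c : C} {b : B} {k : ∀ a, (J.obj a ⟶[V] c) ⟶ (G.obj a ⟶[V] b)}
    (h : IsColimitCocone (homTo J c) G b k)
    (a a' : A) {Q : V} (q : Q ⟶ (J.obj a' ⟶[V] c)) :
    gcomp (J.map a a') q ≫ k a = gcomp (G.map a a') (q ≫ k a') := by
  have h1 := congrArg (fun t => t ≫ k a) (lact_homTo J c a a')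
  have h2 : gcomp (J.map a a') (𝟙 (J.obj a' ⟶[V] c)) ≫ k a = gcomp (G.map a a') (k a') :=
    h1.symm.trans (h.natural a a')
  rw [← whiskerLeft_gcomp, ← h2, whiskerLeft_gcomp_assoc, Category.comp_id]

/-- If `L c` is, for every `c`, the colimit `C(J -, c) * G`, naturally in `c`, then `L` is a left
Kan extension of `G` along `J`; its unit is found by inserting identities. -/
theorem exists_unit_of_colimits (J : EnrichedFunctor V A C) (G : EnrichedFunctor V A B)
    (L : EnrichedFunctor V C B) (k : ∀ c a, (J.obj a ⟶[V] c) ⟶ (G.obj a ⟶[V] L.obj c))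
    (hk : ∀ c, IsColimitCocone (homTo J c) G (L.obj c) (k c))
    (hm : ∀ c c' a, gcomp (k c a) (L.map c c') =
      gcomp (𝟙 (J.obj a ⟶[V] c)) (𝟙 (c ⟶[V] c')) ≫ k c' a) :
    ∃ η : 𝟙_ V ⟶ (G ⟶[V] J.comp V L), IsLeftKanExtension J G L η := by
  have hnat (c : C) (a a' : A) {Q : V} (q : Q ⟶ (J.obj a' ⟶[V] c)) :
      gcomp (J.map a a') q ≫ k c a = gcomp (G.map a a') (q ≫ k c a') :=
    (hk c).homTo_natural a a' q
  let η (a : A) : 𝟙_ V ⟶ (G.obj a ⟶[V] L.obj (J.obj a)) := eId V (J.obj a) ≫ k (J.obj a) a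
  have hη (a : A) (c : C) {Q : V} (q : Q ⟶ (J.obj a ⟶[V] c)) :
      lmul (η a) (q ≫ L.map (J.obj a) c) = q ≫ k c a := by
    rw [lmul, ← tensor_gcomp, hm, tensor_gcomp_assoc, Category.comp_id, Category.comp_id,
      eId_gcomp, Category.assoc, Iso.inv_hom_id_assoc]
  have hη' : natHom.IsNatural G (J.comp V L) η := by
    refine (isNatural_unit_iff _).2 fun a a' => ?_
    refine Eq.trans ?_ (hη a (J.obj a') (J.map a a')).symm
    change rmul (G.map a a') (eId V (J.obj a') ≫ k (J.obj a') a') = _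
    rw [rmul, ← hnat, gcomp_eId, Category.assoc, Iso.inv_hom_id_assoc]
  refine ⟨natHom.lift _ hη', isLeftKanExtension_iff.2 fun c => ?_⟩
  have : kanLeg (natHom.lift _ hη') c = k c := by
    funext a
    have e : natHom.lift η hη' ≫ natHom.π G (J.comp V L) a = η a := natHom.lift_π _ _ _
    have e' := hη a c (𝟙 _)
    rw [Category.id_comp, Category.id_comp] at e'
    rw [kanLeg_eq]
    exact (congrArg (fun t => lmul t (L.map (J.obj a) c)) e).trans e'
  rw [this]
  exact hk c

/-- A left Kan extension exists as soon as the colimits that compute it do. -/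
theorem hasLeftKanExtension_of_colimits (J : EnrichedFunctor V A C) (G : EnrichedFunctor V A B)
    (h : ∀ c, ∃ (b : B) (k : ∀ a, (J.obj a ⟶[V] c) ⟶ (G.obj a ⟶[V] b)),
      IsColimitCocone (homTo J c) G b k) : HasLeftKanExtension J G := by
  choose b k hk using h
  have hnat (c : C) (a a' : A) {Q : V} (q : Q ⟶ (J.obj a' ⟶[V] c)) :
      gcomp (J.map a a') q ≫ k c a = gcomp (G.map a a') (q ≫ k c a') :=
    (hk c).homTo_natural a a' q
  have hext (c : C) {Z : V} {x : B} {f g : Z ⟶ (b c ⟶[V] x)}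
      (hfg : ∀ a, gcomp (k c a) f = gcomp (k c a) g) : f = g := (hk c).hom_ext hfg
  -- Composition with `C(c, c')` makes the chosen colimits functorial.
  have hm (c c' : C) : ∃ m : (c ⟶[V] c') ⟶ (b c ⟶[V] b c'), ∀ a,
      gcomp (k c a) m = gcomp (𝟙 (J.obj a ⟶[V] c)) (𝟙 (c ⟶[V] c')) ≫ k c' a := by
    have e (a a' : A) : gcomp (J.map a a') (𝟙 (J.obj a' ⟶[V] c)) ▷ (c ⟶[V] c') ≫
        gcomp (𝟙 (J.obj a ⟶[V] c)) (𝟙 (c ⟶[V] c')) ≫ k c' a = (α_ _ _ _).hom ≫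
          gcomp (G.map a a') (gcomp (𝟙 (J.obj a' ⟶[V] c)) (𝟙 (c ⟶[V] c')) ≫ k c' a') := by
      rw [← hnat, ← Category.assoc, ← Category.assoc, whiskerRight_gcomp, Category.comp_id,
        gcomp_assoc]
    exact ((hk c).existsUnique (fun a => gcomp (𝟙 (J.obj a ⟶[V] c)) (𝟙 (c ⟶[V] c')) ≫ k c' a)
      ((isCocone_homTo_iff _).2 e)).exists
  choose m hm using hm
  have hfac (c c' : C) (a : A) {P Q : V} (p : P ⟶ (J.obj a ⟶[V] c)) (q : Q ⟶ (c ⟶[V] c')) :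
      gcomp (p ≫ k c a) (q ≫ m c c') = gcomp p q ≫ k c' a := by
    rw [← tensor_gcomp, hm, tensor_gcomp_assoc, Category.comp_id, Category.comp_id]
  have hfac' (c c' : C) (a : A) {Q : V} (q : Q ⟶ (c ⟶[V] c')) :
      gcomp (k c a) (q ≫ m c c') = gcomp (𝟙 (J.obj a ⟶[V] c)) q ≫ k c' a := by
    rw [← hfac, Category.id_comp]
  let L : EnrichedFunctor V C B :=
    { obj := b
      map := m
      map_id := fun c => hext c fun a => by
        rw [hfac', gcomp_eId, gcomp_eId, Category.assoc, Category.id_comp]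
      map_comp := fun c c' c'' => hext c fun a => by
        rw [hfac', ← gcomp, eComp_eq_gcomp]
        have h1 := gcomp_assoc (k c a) (m c c') (m c' c'')
        have h3 := hfac c' c'' a (gcomp (𝟙 (J.obj a ⟶[V] c)) (𝟙 (c ⟶[V] c'))) (𝟙 _)
        rw [Category.id_comp] at h3
        rw [hm, h3, gcomp_assoc, Category.assoc] at h1
        exact (cancel_epi _).1 h1 }
  obtain ⟨η, hη⟩ := exists_unit_of_colimits J G L k hk hm
  exact ⟨L, η, hη⟩

section Restriction

variable {J : EnrichedFunctor V A C} {S : EnrichedFunctor V C B}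

theorem braiding_rotate (P Q Z : V) :
    (β_ (P ⊗ Q) Z).hom ≫ (α_ Z P Q).inv ≫ (β_ Z P).hom ▷ Q ≫ (α_ P Z Q).hom =
      (α_ P Q Z).hom ≫ P ◁ (β_ Q Z).hom := by
  rw [BraidedCategory.braiding_tensor_left_hom]
  simp only [Category.assoc, Iso.hom_inv_id_assoc]
  rw [← comp_whiskerRight_assoc, SymmetricCategory.symmetry, MonoidalCategory.id_whiskerRight,
    Category.id_comp, Iso.inv_hom_id, Category.comp_id]

theorem braiding_rotate' (P Q Z : V) :
    P ◁ (β_ Z Q).hom ≫ (α_ P Q Z).inv ≫ (β_ (P ⊗ Q) Z).hom ≫ (α_ Z P Q).inv =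
      (α_ P Z Q).inv ≫ (β_ P Z).hom ▷ Q := by
  rw [BraidedCategory.braiding_tensor_left_hom]
  simp only [Category.assoc, Iso.hom_inv_id, Iso.inv_hom_id_assoc, Category.comp_id]
  rw [← MonoidalCategory.whiskerLeft_comp_assoc, SymmetricCategory.symmetry,
    MonoidalCategory.whiskerLeft_id, Category.id_comp]

/-- If `S` is the left Kan extension of its restriction along `J`, then every `V`-natural family
between the restrictions of `S` and `T` extends uniquely to a `V`-natural family between `S` and
`T`. -/
theorem existsUnique_extension
    (h : ∀ c, IsColimitCocone (homTo J c) (J.comp V S) (S.obj c) (fun a => S.map (J.obj a) c))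
    (T : EnrichedFunctor V C B) {Z : V} (τ : ∀ a, Z ⟶ (S.obj (J.obj a) ⟶[V] T.obj (J.obj a)))
    (hτ : natHom.IsNatural (J.comp V S) (J.comp V T) τ) :
    ∃! σ : ∀ c, Z ⟶ (S.obj c ⟶[V] T.obj c),
      natHom.IsNatural S T σ ∧ ∀ a, σ (J.obj a) = τ a := by
  have hτ' (a a' : A) : (β_ Z (a ⟶[V] a')).hom ≫ gcomp (J.map a a' ≫ S.map _ _) (τ a') =
      gcomp (τ a) (J.map a a' ≫ T.map _ _) := hτ a a'
  have hext (c : C) {P : V} {x : B} {f g : P ⟶ (S.obj c ⟶[V] x)}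
      (hfg : ∀ a, gcomp (S.map (J.obj a) c) f = gcomp (S.map (J.obj a) c) g) : f = g :=
    (h c).hom_ext hfg
  -- Naturality forces the composite of `S(J a, c)` and `σ c` to be that of `τ a` and `T(J a, c)`.
  have hσ (c : C) : ∃ σ : Z ⟶ (S.obj c ⟶[V] T.obj c), ∀ a, gcomp (S.map (J.obj a) c) σ =
      (β_ (J.obj a ⟶[V] c) Z).hom ≫ gcomp (τ a) (T.map (J.obj a) c) := by
    refine ((h c).existsUnique (fun a => (β_ (J.obj a ⟶[V] c) Z).hom ≫
      gcomp (τ a) (T.map (J.obj a) c)) ((isCocone_homTo_iff _).2 fun a a' => ?_)).exists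
    have e : gcomp (J.map a a') (𝟙 (J.obj a' ⟶[V] c)) ▷ Z ≫ (β_ (J.obj a ⟶[V] c) Z).hom ≫
        gcomp (τ a) (T.map (J.obj a) c) = (β_ _ Z).hom ≫ gcomp (τ a)
          (gcomp (J.map a a' ≫ T.map (J.obj a) (J.obj a')) (T.map (J.obj a') c)) := by
      rw [BraidedCategory.braiding_naturality_left_assoc, whiskerLeft_gcomp, gcomp_map,
        Category.id_comp]
    have e2 := gcomp_assoc (τ a) (J.map a a' ≫ T.map (J.obj a) (J.obj a')) (T.map (J.obj a') c)
    rw [← hτ', ← whiskerRight_gcomp, gcomp_assoc, ← Iso.inv_comp_eq] at e2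
    refine e.trans ?_
    rw [← e2, reassoc_of% (braiding_rotate (a ⟶[V] a') (J.obj a' ⟶[V] c) Z), whiskerLeft_gcomp]
    rfl
  choose σ hσ using hσ
  refine ⟨σ, ⟨fun c d => ?_, fun a => ?_⟩, fun σ' hσ' => funext fun c => hext c fun a => ?_⟩
  · change (β_ _ _).hom ≫ gcomp (S.map c d) (σ d) = gcomp (σ c) (T.map c d)
    refine hext c fun a => ?_
    have e1 : gcomp (S.map (J.obj a) c) (gcomp (σ c) (T.map c d)) =
        (α_ _ _ _).inv ≫ (β_ _ _).hom ▷ _ ≫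
          gcomp (gcomp (τ a) (T.map (J.obj a) c)) (T.map c d) := by
      rw [whiskerRight_gcomp, ← hσ, gcomp_assoc, Iso.inv_hom_id_assoc]
    have e2 : gcomp (S.map (J.obj a) c) (gcomp (S.map c d) (σ d)) =
        (α_ _ _ _).inv ≫ (β_ _ _).hom ≫ (α_ _ _ _).inv ≫
          gcomp (gcomp (τ a) (T.map (J.obj a) c)) (T.map c d) := by
      have e3 := gcomp_map S (𝟙 (J.obj a ⟶[V] c)) (𝟙 (c ⟶[V] d))
      have e4 := gcomp_map T (𝟙 (J.obj a ⟶[V] c)) (𝟙 (c ⟶[V] d))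
      rw [Category.id_comp, Category.id_comp] at e3 e4
      rw [gcomp_assoc (τ a), Iso.inv_hom_id_assoc, Iso.eq_inv_comp, ← gcomp_assoc,
        ← e3, ← e4, ← whiskerRight_gcomp, hσ, BraidedCategory.braiding_naturality_left_assoc,
        whiskerLeft_gcomp]
    rw [← whiskerLeft_gcomp, e1, e2,
      reassoc_of% (braiding_rotate' (J.obj a ⟶[V] c) (c ⟶[V] d) Z)]
  · have e := congrArg (fun t => eId V (J.obj a) ▷ Z ≫ t) (hσ (J.obj a) a)
    rw [whiskerRight_gcomp, S.map_id, eId_gcomp, BraidedCategory.braiding_naturality_left_assoc,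
      whiskerLeft_gcomp, T.map_id, gcomp_eId] at e
    rw [← cancel_epi (λ_ Z).hom]
    refine e.trans ?_
    simp
  · rw [hσ, ← hσ'.2 a]
    have := hσ'.1 (J.obj a) c
    rw [← cancel_epi (β_ Z (J.obj a ⟶[V] c)).hom, SymmetricCategory.symmetry_assoc]
    exact this

/-- As `V`-natural families out of `S` are determined by their restriction to the small category
`A`, the object `[C, B](S, T)` exists even if `C` is large: it is `[A, B](S J, T J)`. -/
theorem hasNatHom_of_extension
    (h : ∀ c, IsColimitCocone (homTo J c) (J.comp V S) (S.obj c) (fun a => S.map (J.obj a) c))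
    (T : EnrichedFunctor V C B) : HasNatHom S T := by
  obtain ⟨p, ⟨hp, hpJ⟩, -⟩ := existsUnique_extension h T (natHom.π (J.comp V S) (J.comp V T))
    (natHom.π_natural _ _)
  refine natHom.hasNatHom_of_universal (natHom (J.comp V S) (J.comp V T)) p hp fun Z app happ => ?_
  have hr := isNatural_restriction J happ
  obtain ⟨σ, -, hu⟩ := existsUnique_extension h T _ hr
  refine ⟨natHom.lift _ hr, fun c => ?_, fun f hf => natHom.hom_ext fun a => ?_⟩
  · have e1 := hu _ ⟨hp.precomp (natHom.lift _ hr), fun a =>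
      (congrArg (fun t => natHom.lift _ hr ≫ t) (hpJ a)).trans (natHom.lift_π _ hr a)⟩
    have e2 := hu _ ⟨happ, fun a => rfl⟩
    exact congrFun (e1.trans e2.symm) c
  · exact ((congrArg (fun t => f ≫ t) (hpJ a)).symm.trans (hf (J.obj a))).trans
      (natHom.lift_π _ hr a).symm

/-- If `S` is the left Kan extension of its restriction along `J`, then restriction along `J` is an
isomorphism `[C, B](S, T) ≅ [A, B](S J, T J)`. -/
theorem isIso_restrictionMap
    (h : ∀ c, IsColimitCocone (homTo J c) (J.comp V S) (S.obj c) (fun a => S.map (J.obj a) c))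
    (T : EnrichedFunctor V C B) [HasNatHom S T] : IsIso (restrictionMap J S T) := by
  rw [isIso_iff_existsUnique]
  intro Z y
  obtain ⟨σ, ⟨hσ, hσJ⟩, hu⟩ := existsUnique_extension h T _ ((natHom.π_natural _ _).precomp y)
  refine ⟨natHom.lift σ hσ, natHom.hom_ext fun a => ?_, fun f hf => natHom.hom_ext fun c => ?_⟩
  · refine (Category.assoc _ _ _).trans ((congrArg (fun t => natHom.lift σ hσ ≫ t)
      (restrictionMap_π J S T a)).trans ((natHom.lift_π σ hσ (J.obj a)).trans (hσJ a)))
  · rw [natHom.lift_π]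
    refine congrFun (hu (fun c => f ≫ natHom.π S T c) ⟨(natHom.π_natural S T).precomp f,
      fun a => ?_⟩) c
    subst hf
    exact ((Category.assoc _ _ _).trans (congrArg (fun t => f ≫ t) (restrictionMap_π J S T a))).symm

end Restriction

end KanExtensions

/-! ### The enriched Yoneda lemma -/

section Yoneda

variable {V : Type u} [Category.{v} V] [MonoidalCategory V] [SymmetricCategory V]
  [MonoidalClosed V] [Limits.HasLimits V]
variable {A : Type v} [EnrichedCategory V A]

theorem lact_yoneda (a b c : A) : lact ((yoneda A).obj a) b c = eComp V b c a :=
  (lact_homTo (EnrichedFunctor.id V A) a b c).trans (eComp_eq_gcomp b c a).symm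

theorem papp_yoneda_map (a b c : A) : papp ((yoneda A).map a b) c = eComp V c a b := by
  have h := papp_homToFunctor (EnrichedFunctor.id V A) (𝟙 (a ⟶[V] b)) c
  rw [Category.id_comp] at h
  exact h.trans (eComp_eq_gcomp c a b).symm

/-- The components `A(b, a) ⊗ Z ⟶ F b` of a generalised morphism `A(-, a) ⟶ F`. -/
def yapp {F : EnrichedFunctor V Aᵒᵖ V} {Z : V} {a : A} (f : Z ⟶ ((yoneda A).obj a ⟶[V] F)) (b : A) :
    (b ⟶[V] a) ⊗ Z ⟶ F.obj (op b) :=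
  papp f b

/-- The value at the identity of a generalised morphism `A(-, a) ⟶ F`. -/
def yval {F : EnrichedFunctor V Aᵒᵖ V} {Z : V} {a : A} (f : Z ⟶ ((yoneda A).obj a ⟶[V] F)) :
    Z ⟶ F.obj (op a) :=
  (λ_ Z).inv ≫ eId V a ▷ Z ≫ yapp f a

theorem yapp_natural {F : EnrichedFunctor V Aᵒᵖ V} {Z : V} {a : A}
    (f : Z ⟶ ((yoneda A).obj a ⟶[V] F)) (b c : A) :
    eComp V b c a ▷ Z ≫ yapp f b = (α_ _ _ _).hom ≫ (b ⟶[V] c) ◁ yapp f c ≫ lact F b c :=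
  (congrArg (fun t => t ▷ Z ≫ yapp f b) (lact_yoneda a b c)).symm.trans (papp_natural f b c)

/-- A generalised morphism `A(-, a) ⟶ F` is determined by its value at the identity. -/
theorem yapp_eq {F : EnrichedFunctor V Aᵒᵖ V} {Z : V} {a : A} (f : Z ⟶ ((yoneda A).obj a ⟶[V] F))
    (b : A) : yapp f b = (b ⟶[V] a) ◁ yval f ≫ lact F b a := by
  have h := yapp_natural f b a
  rw [← Iso.inv_comp_eq] at h
  have ht : (b ⟶[V] a) ◁ (λ_ Z).inv ≫ (α_ _ _ _).inv = (ρ_ (b ⟶[V] a)).inv ▷ Z := by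
    rw [Iso.comp_inv_eq, triangle_assoc_comp_right_inv]
  rw [yval, MonoidalCategory.whiskerLeft_comp_assoc, MonoidalCategory.whiskerLeft_comp_assoc, ← h,
    associator_inv_naturality_middle_assoc, reassoc_of% ht, ← comp_whiskerRight_assoc,
    ← comp_whiskerRight_assoc, Category.assoc, e_comp_id, MonoidalCategory.id_whiskerRight,
    Category.id_comp]

/-- The generalised morphism `F a ⟶ [Aᵒᵖ, V](A(-, a), F)` given by the action of `A` on `F`. -/
def yonedaHom (F : EnrichedFunctor V Aᵒᵖ V) (a : A) : F.obj (op a) ⟶ ((yoneda A).obj a ⟶[V] F) :=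
  plift (F := (yoneda A).obj a) (fun b => lact F b a) fun b c =>
    (congrArg (fun t => t ▷ _ ≫ lact F b a) (lact_yoneda a b c)).trans (lact_comp F b c a)

theorem papp_yonedaHom (F : EnrichedFunctor V Aᵒᵖ V) (a b : A) :
    papp (yonedaHom F a) b = lact F b a :=
  papp_plift (F := (yoneda A).obj a) (fun b => lact F b a) (fun b c =>
    (congrArg (fun t => t ▷ _ ≫ lact F b a) (lact_yoneda a b c)).trans (lact_comp F b c a)) b

/-- The enriched Yoneda lemma: `F a ≅ [Aᵒᵖ, V](A(-, a), F)`. -/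
def yonedaIso (F : EnrichedFunctor V Aᵒᵖ V) (a : A) :
    F.obj (op a) ≅ ((yoneda A).obj a ⟶[V] F) where
  hom := yonedaHom F a
  inv := yval (𝟙 _)
  hom_inv_id := by
    have e' := papp_comp (yonedaHom F a) (𝟙 _) a
    rw [Category.comp_id, papp_yonedaHom] at e'
    rw [yval, leftUnitor_inv_naturality_assoc, whisker_exchange_assoc]
    refine (congrArg (fun t => (λ_ _).inv ≫ eId V a ▷ _ ≫ t) e'.symm).trans ?_
    rw [lact_id, Iso.inv_hom_id]
  inv_hom_id := papp_ext fun b => by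
    rw [papp_comp]
    exact (congrArg (fun t => (b ⟶[V] a) ◁ _ ≫ t) (papp_yonedaHom F a b)).trans
      (yapp_eq (𝟙 ((yoneda A).obj a ⟶[V] F)) b).symm

theorem papp_yonedaIso_hom (F : EnrichedFunctor V Aᵒᵖ V) (a b : A) :
    papp (yonedaIso F a).hom b = lact F b a :=
  papp_yonedaHom F a b

/-- The isomorphism `F a ≅ [Aᵒᵖ, V](A(-, a), F)` is natural in `F`. -/
theorem gcomp_yonedaIso_hom {F F' : EnrichedFunctor V Aᵒᵖ V} {Z : V} (g : Z ⟶ (F ⟶[V] F')) (a : A) :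
    gcomp (yonedaIso F a).hom g = papp g a ≫ (yonedaIso F' a).hom := by
  refine papp_ext fun b => ?_
  rw [papp_gcomp, papp_comp, papp_yonedaIso_hom, papp_yonedaIso_hom]
  exact (Iso.inv_comp_eq _).2 (papp_natural g b a)

/-- The isomorphism `F a ≅ [Aᵒᵖ, V](A(-, a), F)` is natural in `a`. -/
theorem gcomp_yoneda_map_yonedaIso_hom (F : EnrichedFunctor V Aᵒᵖ V) (a b : A) :
    gcomp ((yoneda A).map b a) (yonedaIso F a).hom = lact F b a ≫ (yonedaIso F b).hom := by
  refine papp_ext fun c => ?_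
  rw [papp_gcomp, papp_comp, papp_yonedaIso_hom, papp_yonedaIso_hom, papp_yoneda_map]
  exact (Iso.inv_comp_eq _).2 (lact_comp F c b a)

theorem isIso_yoneda_map (a b : A) : IsIso ((yoneda (V := V) A).map a b) := by
  have : (yoneda (V := V) A).map a b = (yonedaIso (V := V) ((yoneda A).obj b) a).hom := by
    refine papp_ext fun c => ?_
    rw [papp_yoneda_map]
    exact ((papp_yonedaIso_hom ((yoneda A).obj b) a c).trans (lact_yoneda b c a)).symm
  rw [this]
  exact (yonedaIso ((yoneda A).obj b) a).isIso_hom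

/-- Every presheaf is the colimit of the representables, weighted by itself. -/
theorem isColimitCocone_yoneda (F : EnrichedFunctor V Aᵒᵖ V) :
    IsColimitCocone F (yoneda A) F (fun a => (yonedaIso F a).hom) := by
  refine ⟨fun a b => (gcomp_yoneda_map_yonedaIso_hom F b a).symm, fun {Z X} φ hφ => ?_⟩
  refine ⟨plift (fun a => φ a ≫ (yonedaIso X a).inv) fun a b => ?_, fun a => ?_, fun g hg => ?_⟩
  · rw [← Category.assoc, hφ a b, Category.assoc]
    refine congrArg (fun t => (α_ _ _ _).hom ≫ t) ?_
    rw [Iso.comp_inv_eq, Category.assoc, ← gcomp_yoneda_map_yonedaIso_hom, whiskerLeft_gcomp,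
      Category.assoc, Iso.inv_hom_id, Category.comp_id]
  · rw [gcomp_yonedaIso_hom, papp_plift, Category.assoc, Iso.inv_hom_id, Category.comp_id]
  · refine papp_ext fun a => ?_
    rw [papp_plift, Iso.eq_comp_inv, ← gcomp_yonedaIso_hom]
    exact hg a

theorem ract_coyoneda (a b c : A) : ract ((coyoneda A).obj (op a)) b c = eComp V a b c :=
  (ract_homFrom (EnrichedFunctor.id V A) a b c).trans (eComp_eq_gcomp a b c).symm

theorem capp_coyoneda_map (a b c : A) :
    capp ((coyoneda A).map (op b) (op a)) c = eComp V a b c := by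
  have h := capp_homFromFunctor (EnrichedFunctor.id V A) (𝟙 (a ⟶[V] b)) c
  have h' : capp ((coyoneda A).map (op b) (op a)) c = gcomp (𝟙 (a ⟶[V] b)) (𝟙 (b ⟶[V] c)) :=
    (congrArg (fun t => capp t c) (Category.id_comp _)).symm.trans h
  exact h'.trans (eComp_eq_gcomp a b c).symm

/-- The components `Z ⊗ A(a, b) ⟶ H b` of a generalised morphism `A(a, -) ⟶ H`. -/
def cyapp {H : EnrichedFunctor V A V} {Z : V} {a : A} (f : Z ⟶ ((coyoneda A).obj (op a) ⟶[V] H))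
    (b : A) : Z ⊗ (a ⟶[V] b) ⟶ H.obj b :=
  capp f b

/-- The value at the identity of a generalised morphism `A(a, -) ⟶ H`. -/
def cyval {H : EnrichedFunctor V A V} {Z : V} {a : A} (f : Z ⟶ ((coyoneda A).obj (op a) ⟶[V] H)) :
    Z ⟶ H.obj a :=
  (ρ_ Z).inv ≫ Z ◁ eId V a ≫ cyapp f a

theorem cyapp_natural {H : EnrichedFunctor V A V} {Z : V} {a : A}
    (f : Z ⟶ ((coyoneda A).obj (op a) ⟶[V] H)) (b c : A) :
    cyapp f b ▷ (b ⟶[V] c) ≫ ract H b c = (α_ _ _ _).hom ≫ Z ◁ eComp V a b c ≫ cyapp f c :=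
  (capp_natural f b c).trans
    (congrArg (fun t => (α_ _ _ _).hom ≫ Z ◁ t ≫ cyapp f c) (ract_coyoneda a b c))

/-- A generalised morphism `A(a, -) ⟶ H` is determined by its value at the identity. -/
theorem cyapp_eq {H : EnrichedFunctor V A V} {Z : V} {a : A}
    (f : Z ⟶ ((coyoneda A).obj (op a) ⟶[V] H)) (b : A) :
    cyapp f b = cyval f ▷ (a ⟶[V] b) ≫ ract H a b := by
  rw [cyval, comp_whiskerRight_assoc, comp_whiskerRight_assoc, cyapp_natural f a b,
    associator_naturality_middle_assoc, ← MonoidalCategory.whiskerLeft_comp_assoc,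
    triangle_assoc_comp_right_inv_assoc, ← MonoidalCategory.whiskerLeft_comp_assoc,
    e_id_comp, MonoidalCategory.whiskerLeft_id, Category.id_comp]

/-- The generalised morphism `H a ⟶ [A, V](A(a, -), H)` given by the action of `A` on `H`. -/
def coyonedaHom (H : EnrichedFunctor V A V) (a : A) :
    H.obj a ⟶ ((coyoneda A).obj (op a) ⟶[V] H) :=
  clift (F := (coyoneda A).obj (op a)) (fun b => ract H a b) fun b c =>
    ((Iso.eq_inv_comp _).1 (ract_comp H a b c)).symm.trans
      (congrArg (fun t => (α_ _ _ _).hom ≫ _ ◁ t ≫ ract H a c) (ract_coyoneda a b c).symm)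

theorem capp_coyonedaHom (H : EnrichedFunctor V A V) (a b : A) :
    capp (coyonedaHom H a) b = ract H a b :=
  capp_clift (F := (coyoneda A).obj (op a)) (fun b => ract H a b) (fun b c =>
    ((Iso.eq_inv_comp _).1 (ract_comp H a b c)).symm.trans
      (congrArg (fun t => (α_ _ _ _).hom ≫ _ ◁ t ≫ ract H a c) (ract_coyoneda a b c).symm)) b

/-- The enriched Yoneda lemma: `H a ≅ [A, V](A(a, -), H)`. -/
def coyonedaIso (H : EnrichedFunctor V A V) (a : A) :
    H.obj a ≅ ((coyoneda A).obj (op a) ⟶[V] H) where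
  hom := coyonedaHom H a
  inv := cyval (𝟙 _)
  hom_inv_id := by
    have e' := capp_comp (coyonedaHom H a) (𝟙 _) a
    rw [Category.comp_id, capp_coyonedaHom] at e'
    rw [cyval, rightUnitor_inv_naturality_assoc, ← whisker_exchange_assoc]
    refine (congrArg (fun t => (ρ_ _).inv ≫ _ ◁ eId V a ≫ t) e'.symm).trans ?_
    rw [ract_id, Iso.inv_hom_id]
  inv_hom_id := capp_ext fun b => by
    rw [capp_comp]
    exact (congrArg (fun t => _ ▷ (a ⟶[V] b) ≫ t) (capp_coyonedaHom H a b)).trans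
      (cyapp_eq (𝟙 ((coyoneda A).obj (op a) ⟶[V] H)) b).symm

theorem capp_coyonedaIso_hom (H : EnrichedFunctor V A V) (a b : A) :
    capp (coyonedaIso H a).hom b = ract H a b :=
  capp_coyonedaHom H a b

/-- The isomorphism `H a ≅ [A, V](A(a, -), H)` is natural in `H`. -/
theorem gcomp_coyonedaIso_hom {H H' : EnrichedFunctor V A V} {Z : V} (g : Z ⟶ (H ⟶[V] H')) (a : A) :
    gcomp (coyonedaIso H a).hom g = (β_ _ _).hom ≫ capp g a ≫ (coyonedaIso H' a).hom := by
  refine capp_ext fun b => ?_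
  rw [capp_gcomp, capp_comp, capp_comp, capp_coyonedaIso_hom, capp_coyonedaIso_hom]
  exact congrArg (fun t => _ ≫ t) (capp_natural g a b).symm

/-- The isomorphism `H a ≅ [A, V](A(a, -), H)` is natural in `a`. -/
theorem gcomp_coyoneda_map_coyonedaIso_hom (H : EnrichedFunctor V A V) (a b : A) :
    gcomp ((coyoneda A).map (op b) (op a)) (coyonedaIso H a).hom =
      (β_ (a ⟶[V] b) (H.obj a)).hom ≫ ract H a b ≫ (coyonedaIso H b).hom := by
  refine capp_ext fun c => ?_
  rw [capp_gcomp, capp_comp, capp_comp, capp_coyonedaIso_hom, capp_coyonedaIso_hom,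
    capp_coyoneda_map]
  exact congrArg (fun t => _ ≫ t) ((Iso.eq_inv_comp _).1 (ract_comp H a b c))

end Yoneda

/-! ### Tensor products of functors -/

section FunctorsFromActions

variable {V : Type u} [Category.{v} V] [MonoidalCategory V] [SymmetricCategory V]
  [MonoidalClosed V]
variable {K : Type w} [EnrichedCategory V K]

/-- A functor `K → V` given by its action. -/
def functorOfRact (obj : K → V) (act : ∀ k l : K, obj k ⊗ (k ⟶[V] l) ⟶ obj l)
    (act_id : ∀ k, obj k ◁ eId V k ≫ act k k = (ρ_ _).hom)
    (act_comp : ∀ j k l : K, obj j ◁ eComp V j k l ≫ act j l =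
      (α_ _ _ _).inv ≫ act j k ▷ _ ≫ act k l) : EnrichedFunctor V K V where
  obj := obj
  map k l := cur (act k l)
  map_id k := by
    rw [comp_cur, act_id]
    rfl
  map_comp j k l := by
    refine unc_injective ?_
    rw [← gcomp, comp_cur, unc_gcomp, unc_cur, unc_cur, unc_cur, act_comp]

theorem ract_functorOfRact (obj : K → V) (act : ∀ k l : K, obj k ⊗ (k ⟶[V] l) ⟶ obj l)
    (act_id : ∀ k, obj k ◁ eId V k ≫ act k k = (ρ_ _).hom)
    (act_comp : ∀ j k l : K, obj j ◁ eComp V j k l ≫ act j l =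
      (α_ _ _ _).inv ≫ act j k ▷ _ ≫ act k l) (k l : K) :
    ract (functorOfRact obj act act_id act_comp) k l = act k l :=
  unc_cur _

/-- A presheaf on `K` given by its action. -/
def presheafOfLact (obj : K → V) (act : ∀ k l : K, (k ⟶[V] l) ⊗ obj l ⟶ obj k)
    (act_id : ∀ k, eId V k ▷ obj k ≫ act k k = (λ_ _).hom)
    (act_comp : ∀ j k l : K, eComp V j k l ▷ obj l ≫ act j l =
      (α_ _ _ _).hom ≫ (j ⟶[V] k) ◁ act k l ≫ act j k) : EnrichedFunctor V Kᵒᵖ V where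
  obj k := obj k.unop
  map k l := lcur (P := (l.unop ⟶[V] k.unop)) (act l.unop k.unop)
  map_id k := by
    refine lunc_injective ?_
    refine (lunc_comp _ _).trans ?_
    rw [lunc_lcur, lunc_eId]
    exact act_id k.unop
  map_comp j k l := by
    refine lunc_injective ?_
    rw [← gcomp, lunc_gcomp, eComp_op_eq]
    refine (lunc_comp _ _).trans ?_
    rw [lunc_lcur, lunc_lcur, lunc_lcur]
    refine (comp_whiskerRight_assoc _ _ _ _).trans ?_
    exact congrArg (fun t => _ ≫ t) (act_comp l.unop k.unop j.unop)

theorem lact_presheafOfLact (obj : K → V) (act : ∀ k l : K, (k ⟶[V] l) ⊗ obj l ⟶ obj k)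
    (act_id : ∀ k, eId V k ▷ obj k ≫ act k k = (λ_ _).hom)
    (act_comp : ∀ j k l : K, eComp V j k l ▷ obj l ≫ act j l =
      (α_ _ _ _).hom ≫ (j ⟶[V] k) ◁ act k l ≫ act j k) (k l : K) :
    lact (presheafOfLact obj act act_id act_comp) k l = act k l :=
  lunc_lcur _

end FunctorsFromActions

section Tensors

variable {V : Type u} [Category.{v} V] [MonoidalCategory V] [SymmetricCategory V]
  [MonoidalClosed V]
variable {K : Type w} [EnrichedCategory V K]

/-- A family `H k ⊗ F k ⟶ x` which identifies the two actions of `K`. -/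
def IsBalanced (H : EnrichedFunctor V K V) (F : EnrichedFunctor V Kᵒᵖ V) {x : V}
    (φ : ∀ k, H.obj k ⊗ F.obj (op k) ⟶ x) : Prop :=
  ∀ k l, ract H k l ▷ F.obj (op l) ≫ φ l = (α_ _ _ _).hom ≫ H.obj k ◁ lact F k l ≫ φ k

/-- The family `lam` exhibits `t` as the tensor product `∫^k H k ⊗ F k` over `K`. -/
structure IsTensor (H : EnrichedFunctor V K V) (F : EnrichedFunctor V Kᵒᵖ V) (t : V)
    (lam : ∀ k, H.obj k ⊗ F.obj (op k) ⟶ t) : Prop where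
  balanced : IsBalanced H F lam
  existsUnique : ∀ {x : V} (φ : ∀ k, H.obj k ⊗ F.obj (op k) ⟶ x), IsBalanced H F φ →
    ∃! g : t ⟶ x, ∀ k, lam k ≫ g = φ k

namespace IsTensor

variable {H : EnrichedFunctor V K V} {F : EnrichedFunctor V Kᵒᵖ V} {t : V}
  {lam : ∀ k, H.obj k ⊗ F.obj (op k) ⟶ t}

/-- Tensor products are preserved by `- ⊗ Z`. -/
theorem existsUnique_right (h : IsTensor H F t lam) {Z x : V}
    (φ : ∀ k, (H.obj k ⊗ F.obj (op k)) ⊗ Z ⟶ x)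
    (hφ : ∀ k l, (ract H k l ▷ F.obj (op l)) ▷ Z ≫ φ l =
      (α_ _ _ _).hom ▷ Z ≫ (H.obj k ◁ lact F k l) ▷ Z ≫ φ k) :
    ∃! g : t ⊗ Z ⟶ x, ∀ k, lam k ▷ Z ≫ g = φ k := by
  obtain ⟨g, hg, hu⟩ := h.existsUnique (fun k => lcur (φ k)) fun k l => lunc_injective <| by
    rw [lunc_comp, lunc_comp, lunc_comp, lunc_lcur, lunc_lcur, hφ]
  refine ⟨lunc g, fun k => ?_, fun g' hg' => ?_⟩
  · rw [← lunc_comp, hg, lunc_lcur]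
  · rw [← hu (lcur g') fun k => lunc_injective (by rw [lunc_comp, lunc_lcur, lunc_lcur, hg']),
      lunc_lcur]

/-- Tensor products are preserved by `W ⊗ -`. -/
theorem existsUnique_left (h : IsTensor H F t lam) {W x : V}
    (φ : ∀ k, W ⊗ (H.obj k ⊗ F.obj (op k)) ⟶ x)
    (hφ : ∀ k l, W ◁ (ract H k l ▷ F.obj (op l)) ≫ φ l =
      W ◁ (α_ _ _ _).hom ≫ W ◁ (H.obj k ◁ lact F k l) ≫ φ k) :
    ∃! g : W ⊗ t ⟶ x, ∀ k, W ◁ lam k ≫ g = φ k := by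
  obtain ⟨g, hg, hu⟩ := h.existsUnique (fun k => cur (φ k)) fun k l => by
    rw [comp_cur, comp_cur, comp_cur, hφ]
  refine ⟨unc g, fun k => ?_, fun g' hg' => ?_⟩
  · rw [← unc_comp, hg, unc_cur]
  · rw [← hu (cur g') fun k => by rw [comp_cur, hg'], unc_cur]

theorem hom_ext_right (h : IsTensor H F t lam) {Z x : V} {f g : t ⊗ Z ⟶ x}
    (hfg : ∀ k, lam k ▷ Z ≫ f = lam k ▷ Z ≫ g) : f = g := by
  refine (h.existsUnique_right (fun k => lam k ▷ Z ≫ g) fun k l => ?_).unique hfg fun _ => rfl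
  rw [← comp_whiskerRight_assoc, h.balanced k l]
  simp

theorem hom_ext_left (h : IsTensor H F t lam) {W x : V} {f g : W ⊗ t ⟶ x}
    (hfg : ∀ k, W ◁ lam k ≫ f = W ◁ lam k ≫ g) : f = g := by
  refine (h.existsUnique_left (fun k => W ◁ lam k ≫ g) fun k l => ?_).unique hfg fun _ => rfl
  rw [← MonoidalCategory.whiskerLeft_comp_assoc, h.balanced k l]
  simp

end IsTensor

theorem isBalanced_unc_iff {G : EnrichedFunctor V K V} {F : EnrichedFunctor V Kᵒᵖ V} {t : V}
    {c : ∀ k, F.obj (op k) ⟶ (EnrichedCategory.Hom (G.obj k) t : V)} :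
    IsBalanced G F (fun k => unc (c k)) ↔
      ∀ k l, lact F k l ≫ c k = gcomp (G.map k l) (c l) := by
  refine forall_congr' fun k => forall_congr' fun l => ?_
  rw [← unc_injective.eq_iff, unc_comp, unc_gcomp, Iso.eq_inv_comp, eq_comm]
  rfl

/-- In `V`, the colimit of `G` weighted by `F` is the tensor product of `G` and `F`. -/
theorem isColimitCocone_iff_isTensor {G : EnrichedFunctor V K V} {F : EnrichedFunctor V Kᵒᵖ V}
    {t : V} {c : ∀ k, F.obj (op k) ⟶ (EnrichedCategory.Hom (G.obj k) t : V)} :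
    IsColimitCocone F G t c ↔ IsTensor G F t (fun k => unc (c k)) := by
  constructor
  · intro h
    refine ⟨isBalanced_unc_iff.2 h.natural, fun {x} φ hφ => ?_⟩
    have hk (g : t ⟶ x) (k : K) : gcomp (c k) (cur ((ρ_ t).hom ≫ g)) = (ρ_ _).hom ≫ cur (φ k) ↔
        unc (c k) ≫ g = φ k := by
      rw [← unc_injective.eq_iff, unc_gcomp, unc_comp, unc_cur, unc_cur,
        rightUnitor_naturality_assoc, rightUnitor_tensor_hom, Category.assoc,
        Iso.inv_hom_id_assoc, cancel_epi]
    have hφ' : ∀ k l, lact F k l ≫ cur (φ k) = gcomp (G.map k l) (cur (φ l)) :=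
      isBalanced_unc_iff.1 (by simpa only [unc_cur] using hφ)
    obtain ⟨g, hg, hu⟩ := h.existsUnique (Z := 𝟙_ V) (x := x) (fun k => (ρ_ _).hom ≫ cur (φ k))
      fun k l => by
        rw [rightUnitor_naturality_assoc, hφ', ← whiskerLeft_gcomp, rightUnitor_tensor_hom,
          Category.assoc]
    refine ⟨(ρ_ t).inv ≫ unc g, fun k => (hk _ k).1 ?_, fun g' hg' => ?_⟩
    · rw [Iso.hom_inv_id_assoc, cur_unc]
      exact hg k
    · rw [Iso.eq_inv_comp, ← hu _ fun k => (hk g' k).2 (hg' k), unc_cur]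
  · intro h
    refine ⟨isBalanced_unc_iff.1 h.balanced, fun {Z x} φ hφ => ?_⟩
    have hk (g : Z ⟶ (EnrichedCategory.Hom t x : V)) (k : K) : gcomp (c k) g = φ k ↔
        unc (c k) ▷ Z ≫ unc g = (α_ _ _ _).hom ≫ unc (φ k) := by
      rw [← unc_injective.eq_iff, unc_gcomp, Iso.inv_comp_eq]
    obtain ⟨g, hg, hu⟩ := h.existsUnique_right (fun k => (α_ _ _ _).hom ≫ unc (φ k)) fun k l => by
      have e := congrArg unc (hφ k l)
      rw [unc_comp, unc_comp, unc_gcomp] at e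
      rw [associator_naturality_left_assoc, associator_naturality_middle_assoc, e,
        pentagon_assoc, Iso.hom_inv_id_assoc]
      rfl
    refine ⟨cur g, fun k => (hk _ k).2 ?_, fun g' hg' => ?_⟩
    · rw [unc_cur]
      exact hg k
    · rw [← hu _ fun k => (hk g' k).1 (hg' k), cur_unc]

theorem braiding_reverse (P Q R : V) :
    (β_ P Q).hom ▷ R ≫ (β_ (Q ⊗ P) R).hom ≫ (α_ R Q P).inv =
      (α_ P Q R).hom ≫ P ◁ (β_ Q R).hom ≫ (β_ P (R ⊗ Q)).hom := by
  rw [BraidedCategory.braiding_naturality_left_assoc, BraidedCategory.braiding_tensor_left_hom,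
    BraidedCategory.braiding_tensor_right_hom]
  simp only [Category.assoc]

/-- The tensor product is symmetric, up to the identification of `K` with `Kᵒᵖᵒᵖ`. -/
theorem isTensor_swap_iff {H : EnrichedFunctor V K V} {F : EnrichedFunctor V Kᵒᵖ V}
    {W : EnrichedFunctor V Kᵒᵖᵒᵖ V} {t : V} {lam : ∀ k, F.obj k ⊗ W.obj (op k) ⟶ t}
    (e : ∀ k, H.obj k ≅ W.obj (op (op k)))
    (he : ∀ k l : K, (k ⟶[V] l) ◁ (e k).hom ≫ lact W (op l) (op k) =
      (β_ _ _).hom ≫ ract H k l ≫ (e l).hom) :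
    IsTensor F W t lam ↔
      IsTensor H F t (fun k => (β_ _ _).hom ≫ F.obj (op k) ◁ (e k).hom ≫ lam (op k)) := by
  have key (a b : K) {x : V} (m : F.obj (op a) ⊗ W.obj (op (op a)) ⟶ x)
      (m' : F.obj (op b) ⊗ W.obj (op (op b)) ⟶ x)
      (r : F.obj (op b) ⊗ (a ⟶[V] b) ⟶ F.obj (op a)) (hr : r = (β_ _ _).hom ≫ lact F a b)
      (s : (a ⟶[V] b) ⊗ W.obj (op (op a)) ⟶ W.obj (op (op b)))
      (hs : (a ⟶[V] b) ◁ (e a).hom ≫ s = (β_ _ _).hom ≫ ract H a b ≫ (e b).hom) :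
      r ▷ W.obj (op (op a)) ≫ m = (α_ _ _ _).hom ≫ F.obj (op b) ◁ s ≫ m' ↔
      ract H a b ▷ F.obj (op b) ≫ (β_ _ _).hom ≫ F.obj (op b) ◁ (e b).hom ≫ m' =
        (α_ _ _ _).hom ≫ H.obj a ◁ lact F a b ≫ (β_ _ _).hom ≫ F.obj (op a) ◁ (e a).hom ≫ m := by
    have h := braiding_reverse (F.obj (op b)) (a ⟶[V] b) (H.obj a)
    have e₁ : (F.obj (op b) ⊗ (a ⟶[V] b)) ◁ (e a).hom ≫ r ▷ W.obj (op (op a)) ≫ m =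
        ((β_ (F.obj (op b)) (a ⟶[V] b)).hom ▷ H.obj a ≫
          (β_ ((a ⟶[V] b) ⊗ F.obj (op b)) (H.obj a)).hom ≫ (α_ _ _ _).inv) ≫ (α_ _ _ _).hom ≫
          H.obj a ◁ lact F a b ≫ (β_ _ _).hom ≫ F.obj (op a) ◁ (e a).hom ≫ m := by
      rw [Category.assoc, Category.assoc, Iso.inv_hom_id_assoc,
        ← BraidedCategory.braiding_naturality_left_assoc, SymmetricCategory.symmetry_assoc,
        ← comp_whiskerRight_assoc, ← hr, whisker_exchange_assoc]
    have e₂ : (F.obj (op b) ⊗ (a ⟶[V] b)) ◁ (e a).hom ≫ (α_ _ _ _).hom ≫ F.obj (op b) ◁ s ≫ m' =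
        ((β_ (F.obj (op b)) (a ⟶[V] b)).hom ▷ H.obj a ≫
          (β_ ((a ⟶[V] b) ⊗ F.obj (op b)) (H.obj a)).hom ≫ (α_ _ _ _).inv) ≫
          ract H a b ▷ F.obj (op b) ≫ (β_ _ _).hom ≫ F.obj (op b) ◁ (e b).hom ≫ m' := by
      rw [h, Category.assoc, Category.assoc, ← BraidedCategory.braiding_naturality_right_assoc,
        SymmetricCategory.symmetry_assoc, associator_naturality_right_assoc,
        ← MonoidalCategory.whiskerLeft_comp_assoc, hs, MonoidalCategory.whiskerLeft_comp_assoc,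
        MonoidalCategory.whiskerLeft_comp_assoc]
    rw [← cancel_epi ((F.obj (op b) ⊗ (a ⟶[V] b)) ◁ (e a).hom), e₁, e₂, cancel_epi, eq_comm]
  have hbal {x : V} (φ : ∀ k, F.obj k ⊗ W.obj (op k) ⟶ x) : IsBalanced F W φ ↔
      IsBalanced H F (fun k => (β_ _ _).hom ≫ F.obj (op k) ◁ (e k).hom ≫ φ (op k)) :=
    ⟨fun h a b => (key a b _ _ _ (braiding_lunc _).symm _ (he a b)).1 (h (op b) (op a)),
      fun h b a => (key a.unop b.unop _ _ _ (braiding_lunc _).symm _ (he a.unop b.unop)).2 (h _ _)⟩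
  have hlam {x : V} (φ φ' : ∀ k, F.obj k ⊗ W.obj (op k) ⟶ x) : (∀ k, φ k = φ' k) ↔
      ∀ k, (β_ _ _).hom ≫ F.obj (op k) ◁ (e k).hom ≫ φ (op k) =
        (β_ _ _).hom ≫ F.obj (op k) ◁ (e k).hom ≫ φ' (op k) := by
    refine ⟨fun h k => by rw [h], fun h k => ?_⟩
    have := h k.unop
    rw [cancel_epi, cancel_epi] at this
    exact this
  have hsurj {x : V} (φ : ∀ k, H.obj k ⊗ F.obj (op k) ⟶ x) :
      ∃ φ' : ∀ k, F.obj k ⊗ W.obj (op k) ⟶ x,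
        φ = fun k => (β_ _ _).hom ≫ F.obj (op k) ◁ (e k).hom ≫ φ' (op k) := by
    refine ⟨fun k => F.obj k ◁ (e k.unop).inv ≫ (β_ _ _).hom ≫ φ k.unop, funext fun k => ?_⟩
    change _ = _ ≫ _ ≫ F.obj (op k) ◁ (e k).inv ≫ (β_ _ _).hom ≫ φ k
    rw [whiskerLeft_hom_inv_assoc, SymmetricCategory.symmetry_assoc]
  constructor
  · intro h
    refine ⟨(hbal _).1 h.balanced, fun {x} φ hφ => ?_⟩
    obtain ⟨φ', rfl⟩ := hsurj φ
    obtain ⟨g, hg, hu⟩ := h.existsUnique φ' ((hbal _).2 hφ)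
    refine ⟨g, fun k => ?_, fun g' hg' => hu g' ((hlam _ _).2 fun k => ?_)⟩
    · rw [Category.assoc, Category.assoc]
      exact (hlam (fun k => lam k ≫ g) φ').1 hg k
    · have := hg' k
      rwa [Category.assoc, Category.assoc] at this
  · intro h
    refine ⟨(hbal _).2 h.balanced, fun {x} φ hφ => ?_⟩
    obtain ⟨g, hg, hu⟩ := h.existsUnique _ ((hbal _).1 hφ)
    refine ⟨g, (hlam _ _).2 fun k => ?_, fun g' hg' => hu g' fun k => ?_⟩
    · have := hg k
      rwa [Category.assoc, Category.assoc] at this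
    · rw [Category.assoc, Category.assoc]
      exact (hlam (fun k => lam k ≫ g') φ).1 hg' k

end Tensors

section Coyoneda

variable {V : Type u} [Category.{v} V] [MonoidalCategory V] [SymmetricCategory V]
  [MonoidalClosed V] [Limits.HasLimits V]
variable {A : Type v} [EnrichedCategory V A]

/-- The colimit `[A, V](A(-, -), H) * F` is the tensor product of `H` and `F`. -/
theorem isColimitCocone_coyoneda_iff {H : EnrichedFunctor V A V} {F : EnrichedFunctor V Aᵒᵖ V}
    {t : V} {κ : ∀ a : Aᵒᵖ, ((coyoneda A).obj a ⟶[V] H) ⟶ (EnrichedCategory.Hom (F.obj a) t : V)} :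
    IsColimitCocone (homTo (coyoneda A) H) F t κ ↔
      IsTensor H F t (fun a => lunc ((coyonedaIso H a).hom ≫ κ (op a))) := by
  refine isColimitCocone_iff_isTensor.trans ?_
  refine (isTensor_swap_iff (W := homTo (coyoneda A) H) (coyonedaIso H) fun a b => ?_).trans ?_
  · exact (whiskerLeft_lact_homTo (coyoneda A) H (op b) (op a) (coyonedaIso H a).hom).trans
      (gcomp_coyoneda_map_coyonedaIso_hom H a b)
  · refine iff_of_eq (congrArg (IsTensor H F t) (funext fun a => ?_))
    rw [lunc, unc_comp]
    rfl

theorem gcomp_eq_braiding_iff {X Y Z P Q R : V} (f : P ⟶ (EnrichedCategory.Hom X Y : V))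
    (g : Q ⟶ (EnrichedCategory.Hom Y Z : V)) (m : Q ⊗ P ⟶ R)
    (n : R ⟶ (EnrichedCategory.Hom X Z : V)) :
    gcomp f g = ((β_ P Q).hom ≫ m) ≫ n ↔
      Q ◁ lunc f ≫ lunc g = (α_ Q P X).inv ≫ m ▷ X ≫ lunc n := by
  rw [← lunc_injective.eq_iff, lunc_gcomp, lunc_comp, comp_whiskerRight_assoc, cancel_epi,
    Iso.eq_inv_comp]

/-- The family `lam` exhibits `L : [A, V] → V` as the functor `- * F`: its value at `H` is the
tensor product of `H` and `F`, and `lam H a : H a ⊗ F a ⟶ L H` is natural in `H`. -/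
structure IsTensorFunctor (F : EnrichedFunctor V Aᵒᵖ V)
    (L : EnrichedFunctor V (EnrichedFunctor V A V) V)
    (lam : ∀ (H : EnrichedFunctor V A V) (a : A), H.obj a ⊗ F.obj (op a) ⟶ L.obj H) : Prop where
  isTensor : ∀ H, IsTensor H F (L.obj H) (lam H)
  natural : ∀ (H H' : EnrichedFunctor V A V) (a : A),
    (H ⟶[V] H') ◁ lam H a ≫ lunc (L.map H H') =
      (α_ _ _ _).inv ≫ capp (𝟙 (H ⟶[V] H')) a ▷ F.obj (op a) ≫ lam H' a

/-- A presheaf `F` is flat if and only if the functor `- * F`, described by tensor products instead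
of as a left Kan extension, exists and is continuous. -/
theorem isFlat_iff {P : LimitIndexes V} {F : EnrichedFunctor V Aᵒᵖ V} :
    IsFlat P A F ↔ ∃ (L : EnrichedFunctor V (EnrichedFunctor V A V) V)
      (lam : ∀ (H : EnrichedFunctor V A V) (a : A), H.obj a ⊗ F.obj (op a) ⟶ L.obj H),
      IsTensorFunctor F L lam ∧ IsContinuous P L := by
  constructor
  · rintro ⟨L, η, hη, hL⟩
    rw [isLeftKanExtension_iff] at hη
    refine ⟨L, fun H a => lunc ((coyonedaIso H a).hom ≫ kanLeg η H (op a)),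
      ⟨fun H => isColimitCocone_coyoneda_iff.1 (hη H), fun H H' a => ?_⟩, hL⟩
    have h := gcomp_kanLeg η (coyonedaIso H a).hom (𝟙 (H ⟶[V] H'))
    rw [gcomp_coyonedaIso_hom, Category.id_comp] at h
    refine (gcomp_eq_braiding_iff _ _ _ _).1 (h.trans ?_)
    simp only [Category.assoc]
  · rintro ⟨L, lam, hlam, hL⟩
    let κ (H : EnrichedFunctor V A V) (a : Aᵒᵖ) :
        ((coyoneda A).obj a ⟶[V] H) ⟶ (EnrichedCategory.Hom (F.obj a) (L.obj H) : V) :=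
      (coyonedaIso H a.unop).inv ≫ lcur (lam H a.unop)
    have hκ (H : EnrichedFunctor V A V) (a : A) : (coyonedaIso H a).hom ≫ κ H (op a) =
        lcur (lam H a) := Iso.hom_inv_id_assoc _ _
    obtain ⟨η, hη⟩ := exists_unit_of_colimits (coyoneda A) F L κ (fun H => by
      rw [isColimitCocone_coyoneda_iff]
      simp only [hκ, lunc_lcur]
      exact hlam.isTensor H) fun H H' a => by
        rw [← cancel_epi ((coyonedaIso H a.unop).hom ▷ _)]
        refine (whiskerRight_gcomp _ _ _).trans ?_
        refine Eq.trans ?_ (whiskerRight_gcomp_assoc _ _ _ _).symm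
        refine (congrArg (fun t => gcomp t (L.map H H')) (hκ H a.unop)).trans ?_
        have e := gcomp_coyonedaIso_hom (𝟙 (H ⟶[V] H')) a.unop
        have e' : gcomp (lcur (lam H a.unop)) (L.map H H') =
            ((β_ _ _).hom ≫ capp (𝟙 _) a.unop) ≫ lcur (lam H' a.unop) := by
          rw [gcomp_eq_braiding_iff, lunc_lcur, lunc_lcur]
          exact hlam.natural H H' a.unop
        rw [Category.comp_id, e]
        refine e'.trans ((congrArg (fun t => _ ≫ t) (hκ H' a.unop)).symm.trans ?_)
        simp only [Category.assoc]
    exact ⟨L, η, hη, hL⟩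

end Coyoneda

/-! ### Representable presheaves are flat -/

section RelativeAdjoint

variable {V : Type u} [Category.{v} V] [MonoidalCategory V] [SymmetricCategory V]
  [MonoidalClosed V]
variable {K : Type w} [EnrichedCategory V K] {B : Type w₁} [EnrichedCategory V B]
variable {C : Type w₂} [EnrichedCategory V C]

/-- If the functors `B(x, S -)` are representable, then `S` preserves limits. -/
theorem IsLimitCone.map_of_adjoint {W : EnrichedFunctor V K V}
    {D : EnrichedFunctor V K C} {X : C} {r : ∀ k, W.obj k ⟶ (X ⟶[V] D.obj k)}
    (h : IsLimitCone W D X r) (S : EnrichedFunctor V C B)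
    (N : B → C) (θ : ∀ x c, (N x ⟶[V] c) ≅ (x ⟶[V] S.obj c))
    (hθ : ∀ x c c', gcomp (𝟙 (N x ⟶[V] c)) (𝟙 (c ⟶[V] c')) ≫ (θ x c').hom =
      gcomp (θ x c).hom (S.map c c')) :
    IsLimitCone W (D.comp V S) (S.obj X) (fun k => r k ≫ S.map X (D.obj k)) := by
  have hθ' : ∀ {P Q : V} {c c' : C} {x : B} (g : P ⟶ (N x ⟶[V] c)) (p : Q ⟶ (c ⟶[V] c')),
      gcomp g p ≫ (θ x c').hom = gcomp (g ≫ (θ x c).hom) (p ≫ S.map c c') := by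
    intro P Q c c' x g p
    have := congrArg (fun t => (g ⊗ₘ p) ≫ t) (hθ x c c')
    simpa only [tensor_gcomp, tensor_gcomp_assoc, Category.comp_id] using this
  refine ⟨fun k l => ?_, fun {Z x} ψ hψ => ?_⟩
  · exact (gcomp_map S _ _).symm.trans ((congrArg (fun t => t ≫ S.map X (D.obj l))
      (h.natural k l)).trans (Category.assoc _ _ _))
  · have hinv : ∀ k, (ψ k ≫ (θ x (D.obj k)).inv) ≫ (θ x (D.obj k)).hom = ψ k := fun k =>
      (Category.assoc _ _ _).trans ((congrArg (fun t => ψ k ≫ t) (Iso.inv_hom_id _)).trans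
        (Category.comp_id _))
    obtain ⟨g, hg, hu⟩ := h.existsUnique (fun k => ψ k ≫ (θ x (D.obj k)).inv) fun k l => by
      rw [← cancel_mono (θ x (D.obj l)).hom, hθ', hinv, Category.assoc, Category.assoc, hinv]
      exact hψ k l
    refine ⟨g ≫ (θ x X).hom, fun k => ?_, fun g' hg' => ?_⟩
    · refine (hθ' g (r k)).symm.trans ?_
      rw [hg, hinv]
    · rw [← Iso.comp_inv_eq]
      refine hu _ fun k => ?_
      rw [← cancel_mono (θ x (D.obj k)).hom, hθ', hinv, Category.assoc, Iso.inv_hom_id,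
        Category.comp_id]
      exact hg' k

end RelativeAdjoint

section Evaluation

variable {V : Type u} [Category.{v} V] [MonoidalCategory V] [SymmetricCategory V]
  [MonoidalClosed V] [Limits.HasLimits V]
variable {A : Type v} [EnrichedCategory V A]

/-- Evaluation at `a`, as a functor `[A, V] → V`. -/
def evaluation (a : A) : EnrichedFunctor V (EnrichedFunctor V A V) V where
  obj H := H.obj a
  map H H' := natHom.π H H' a
  map_id H := eId_π H a
  map_comp H H' H'' := eComp_π H H' H'' a

theorem lunc_evaluation_map (a : A) (H H' : EnrichedFunctor V A V) :
    lunc ((evaluation a).map H H') = capp (𝟙 (H ⟶[V] H')) a :=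
  congrArg lunc (Category.id_comp _).symm

/-- The free functor `x ⊗ A(a, -)`. -/
def freeFunctor (a : A) (x : V) : EnrichedFunctor V A V :=
  functorOfRact (fun b => x ⊗ (a ⟶[V] b)) (fun b c => (α_ _ _ _).hom ≫ x ◁ eComp V a b c)
    (fun b => by
      rw [associator_naturality_right_assoc, ← MonoidalCategory.whiskerLeft_comp]
      have h := e_comp_id V a b
      rw [Iso.inv_comp_eq, Category.comp_id] at h
      rw [h, rightUnitor_tensor_hom])
    (fun b c d => by
      rw [associator_naturality_right_assoc, ← MonoidalCategory.whiskerLeft_comp, ← e_assoc]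
      simp only [MonoidalCategory.whiskerLeft_comp, comp_whiskerRight, Category.assoc,
        associator_naturality_middle_assoc, pentagon_inv_hom_hom_hom_inv_assoc])

theorem ract_freeFunctor (a : A) (x : V) (b c : A) :
    ract (freeFunctor a x) b c = (α_ _ _ _).hom ≫ x ◁ eComp V a b c :=
  ract_functorOfRact _ _ _ _ b c

/-- The unit `x ⟶ x ⊗ A(a, a)`. -/
def freeUnit (a : A) (x : V) : x ⟶ (freeFunctor a x).obj a :=
  (ρ_ x).inv ≫ x ◁ eId V a

/-- The universal property of the free functor. -/
theorem existsUnique_freeFunctor (a : A) (x : V) (H : EnrichedFunctor V A V) {Z : V}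
    (y : Z ⊗ x ⟶ H.obj a) :
    ∃! f : Z ⟶ (freeFunctor a x ⟶[V] H), Z ◁ freeUnit a x ≫ capp f a = y := by
  have hφ' (b c : A) : ((α_ Z x (a ⟶[V] b)).inv ≫ y ▷ (a ⟶[V] b) ≫ ract H a b) ▷ (b ⟶[V] c) ≫
      ract H b c = (α_ Z (x ⊗ (a ⟶[V] b)) (b ⟶[V] c)).hom ≫
        Z ◁ ((α_ x (a ⟶[V] b) (b ⟶[V] c)).hom ≫ x ◁ eComp V a b c) ≫
        (α_ Z x (a ⟶[V] c)).inv ≫ y ▷ (a ⟶[V] c) ≫ ract H a c := by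
    rw [MonoidalCategory.whiskerLeft_comp_assoc,
      associator_inv_naturality_right_assoc, whisker_exchange_assoc, ract_comp,
      associator_inv_naturality_left_assoc]
    simp
  have hφ (b c : A) : ((α_ Z x (a ⟶[V] b)).inv ≫ y ▷ (a ⟶[V] b) ≫ ract H a b) ▷ (b ⟶[V] c) ≫
      ract H b c = (α_ Z (x ⊗ (a ⟶[V] b)) (b ⟶[V] c)).hom ≫ Z ◁ ract (freeFunctor a x) b c ≫
        (α_ Z x (a ⟶[V] c)).inv ≫ y ▷ (a ⟶[V] c) ≫ ract H a c :=
    (hφ' b c).trans (congrArg (fun t => (α_ Z (x ⊗ (a ⟶[V] b)) (b ⟶[V] c)).hom ≫ Z ◁ t ≫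
      (α_ Z x (a ⟶[V] c)).inv ≫ y ▷ (a ⟶[V] c) ≫ ract H a c) (ract_freeFunctor a x b c).symm)
  have hu' (b : A) : ((ρ_ x).inv ≫ x ◁ eId V a) ▷ (a ⟶[V] b) ≫ (α_ x (a ⟶[V] a) (a ⟶[V] b)).hom ≫
      x ◁ eComp V a a b = 𝟙 (x ⊗ (a ⟶[V] b)) := by
    rw [comp_whiskerRight_assoc, associator_naturality_middle_assoc,
      triangle_assoc_comp_right_inv_assoc, ← MonoidalCategory.whiskerLeft_comp,
      ← MonoidalCategory.whiskerLeft_comp, e_id_comp, MonoidalCategory.whiskerLeft_id]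
  have hu (b : A) : freeUnit a x ▷ (a ⟶[V] b) ≫ ract (freeFunctor a x) a b =
      𝟙 ((freeFunctor a x).obj b) := by
    rw [ract_freeFunctor]
    exact hu' b
  have hy : Z ◁ ((ρ_ x).inv ≫ x ◁ eId V a) ≫ (α_ Z x (a ⟶[V] a)).inv ≫ y ▷ (a ⟶[V] a) ≫
      ract H a a = y := by
    rw [MonoidalCategory.whiskerLeft_comp_assoc, associator_inv_naturality_right_assoc,
      whisker_exchange_assoc, ract_id]
    simp
  refine ⟨clift (F := freeFunctor a x) (G := H)
    (fun b => (α_ Z x (a ⟶[V] b)).inv ≫ y ▷ (a ⟶[V] b) ≫ ract H a b) hφ, ?_, fun f hf => ?_⟩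
  · refine (congrArg (fun t => Z ◁ freeUnit a x ≫ t)
      (capp_clift (F := freeFunctor a x) (G := H) _ hφ a)).trans ?_
    exact hy
  · refine capp_ext fun b => ?_
    refine Eq.trans ?_ (capp_clift (F := freeFunctor a x) (G := H) _ hφ b).symm
    have h := capp_natural f a b
    have h' := congrArg (fun t => (Z ◁ freeUnit a x) ▷ (a ⟶[V] b) ≫ t) h
    rw [← comp_whiskerRight_assoc, hf, associator_naturality_middle_assoc,
      ← MonoidalCategory.whiskerLeft_comp_assoc, hu] at h'
    refine (Iso.eq_inv_comp _).2 (Eq.trans ?_ h'.symm)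
    exact congrArg (fun t => (α_ _ _ _).hom ≫ t) ((congrArg (fun t => t ≫ capp f b)
      (MonoidalCategory.whiskerLeft_id Z _)).trans (Category.id_comp _)).symm

/-- Evaluation at `a` is continuous since it has the left adjoint `x ↦ x ⊗ A(a, -)`. -/
theorem isContinuous_evaluation (P : LimitIndexes V) (a : A) :
    IsContinuous P (evaluation (V := V) a) := by
  rw [isContinuous_iff]
  intro K _ F hF G b r hr
  -- The adjunction isomorphism `[A, V](x ⊗ A(a, -), H) ≅ [x, H a]`.
  let θ (x : V) (H : EnrichedFunctor V A V) : (freeFunctor a x ⟶[V] H) ⟶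
    (EnrichedCategory.Hom x (H.obj a) : V) :=
    lcur (_ ◁ freeUnit a x ≫ capp (𝟙 (freeFunctor a x ⟶[V] H)) a)
  have hθ (x : V) (H : EnrichedFunctor V A V) {Z : V} (f : Z ⟶ (freeFunctor a x ⟶[V] H)) :
      lunc (f ≫ θ x H) = Z ◁ freeUnit a x ≫ capp f a := by
    rw [lunc_comp, lunc_lcur, ← whisker_exchange_assoc, ← capp_comp, Category.comp_id]
  have hi (x : V) (H : EnrichedFunctor V A V) : IsIso (θ x H) := by
    rw [isIso_iff_existsUnique]
    intro Z y
    simp only [← lunc_injective.eq_iff, hθ]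
    exact existsUnique_freeFunctor a x H (lunc y)
  refine hr.map_of_adjoint (evaluation a) (freeFunctor a)
    (fun x H => @asIso _ _ _ _ (θ x H) (hi x H)) fun x c c' => ?_
  change gcomp _ _ ≫ θ x c' = gcomp (θ x c) _
  refine lunc_injective ?_
  rw [hθ, capp_gcomp]
  refine Eq.trans ?_ (lunc_gcomp _ _).symm
  refine Eq.trans ?_ (congrArg (fun t => _ ≫ _ ≫ _ ◁ lunc (θ x c) ≫ t)
    (lunc_evaluation_map a c c').symm)
  have h := hθ x c (𝟙 _)
  rw [Category.id_comp] at h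
  rw [h, MonoidalCategory.whiskerLeft_comp_assoc, whisker_exchange_assoc,
    associator_naturality_right_assoc]

end Evaluation

section Representable

variable {V : Type u} [Category.{v} V] [MonoidalCategory V] [SymmetricCategory V]
  [MonoidalClosed V] [Limits.HasLimits V]
variable {A : Type v} [EnrichedCategory V A]

/-- `H * A(-, a) = H a`. -/
theorem isTensor_yoneda (H : EnrichedFunctor V A V) (a : A) :
    IsTensor H ((yoneda A).obj a) (H.obj a) (fun b => ract H b a) := by
  have hbal {x : V} (φ : ∀ b : A, H.obj b ⊗ (b ⟶[V] a) ⟶ x) :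
      IsBalanced H ((yoneda A).obj a) φ ↔ ∀ b c : A, ract H b c ▷ (c ⟶[V] a) ≫ φ c =
        (α_ _ _ _).hom ≫ H.obj b ◁ eComp V b c a ≫ φ b :=
    forall_congr' fun b => forall_congr' fun c => Eq.congr_right
      (congrArg (fun t => (α_ _ _ _).hom ≫ H.obj b ◁ t ≫ φ b) (lact_yoneda a b c))
  have key {x : V} (φ : ∀ b : A, H.obj b ⊗ (b ⟶[V] a) ⟶ x) (hφ : ∀ b c : A,
      ract H b c ▷ (c ⟶[V] a) ≫ φ c = (α_ _ _ _).hom ≫ H.obj b ◁ eComp V b c a ≫ φ b) :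
      ∃! g : H.obj a ⟶ x, ∀ b, ract H b a ≫ g = φ b := by
    refine ⟨(ρ_ _).inv ≫ H.obj a ◁ eId V a ≫ φ a, fun b => ?_, fun g hg => ?_⟩
    · rw [rightUnitor_inv_naturality_assoc, ← whisker_exchange_assoc, hφ,
        associator_naturality_right_assoc, rightUnitor_tensor_inv, Category.assoc,
        Iso.inv_hom_id_assoc, ← MonoidalCategory.whiskerLeft_comp_assoc,
        ← MonoidalCategory.whiskerLeft_comp_assoc, Category.assoc, e_comp_id,
        MonoidalCategory.whiskerLeft_id, Category.id_comp]
    · rw [← hg a, reassoc_of% (ract_id H a), Iso.inv_hom_id_assoc]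
  exact ⟨(hbal _).2 fun b c => ((Iso.eq_inv_comp _).1 (ract_comp H b c a)).symm,
    fun {x} φ hφ => key φ ((hbal φ).1 hφ)⟩

/-- Representables are flat: `- * A(-, a)` is evaluation at `a`. -/
theorem isFlat_yoneda (P : LimitIndexes V) (a : A) : IsFlat P A ((yoneda A).obj a) := by
  refine isFlat_iff.2 ⟨evaluation a, fun H b => ract H b a,
    ⟨fun H => isTensor_yoneda H a, fun H H' b => ?_⟩, isContinuous_evaluation P a⟩
  rw [lunc_evaluation_map]
  exact ((Iso.inv_comp_eq _).2 (capp_natural (𝟙 (H ⟶[V] H')) b a)).symm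

end Representable

section Replete

variable {V : Type u} [Category.{v} V] [MonoidalCategory V] [SymmetricCategory V]
  [MonoidalClosed V]
variable {K : Type w} [EnrichedCategory V K]

theorem IsTensor.reindex {H : EnrichedFunctor V K V} {F F' : EnrichedFunctor V Kᵒᵖ V} {t : V}
    {lam : ∀ k, H.obj k ⊗ F.obj (op k) ⟶ t} (h : IsTensor H F t lam)
    (e : ∀ k, F'.obj (op k) ≅ F.obj (op k))
    (he : ∀ k l, lact F' k l ≫ (e k).hom = (k ⟶[V] l) ◁ (e l).hom ≫ lact F k l) :
    IsTensor H F' t (fun k => H.obj k ◁ (e k).hom ≫ lam k) := by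
  have h' : IsColimitCocone F H t (fun k => cur (lam k)) := by
    rw [isColimitCocone_iff_isTensor]
    simpa only [unc_cur] using h
  simpa only [isColimitCocone_iff_isTensor, unc_comp, unc_cur] using h'.reindex e he

/-- A `V`-natural isomorphism of presheaves, in terms of isomorphisms in `V` that are compatible
with the actions. -/
theorem VNatIso.exists_legIso {F F' : EnrichedFunctor V Kᵒᵖ V} (τ : VNatIso F F') :
    ∃ e : ∀ k : K, F.obj (op k) ≅ F'.obj (op k),
      ∀ k l, lact F k l ≫ (e k).hom = (k ⟶[V] l) ◁ (e l).hom ≫ lact F' k l := by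
  have key {X Y : V} (f : 𝟙_ V ⟶ (EnrichedCategory.Hom X Y : V))
      (g : 𝟙_ V ⟶ (EnrichedCategory.Hom Y X : V)) (h : lmul f g = eId V X) :
      ((ρ_ X).inv ≫ unc f) ≫ (ρ_ Y).inv ≫ unc g = 𝟙 X := by
    have h' := congrArg unc h
    rw [lmul, unc_comp, unc_gcomp, unc_eId] at h'
    have h'' := congrArg (fun t => (ρ_ X).inv ≫ t) h'
    simp only [Iso.inv_hom_id] at h''
    rw [← h'', Category.assoc, rightUnitor_inv_naturality_assoc]
    simp
  refine ⟨fun k => ⟨(ρ_ _).inv ≫ unc (τ.hom (op k)), (ρ_ _).inv ≫ unc (τ.inv (op k)),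
    key _ _ (τ.hom_inv (op k)), key _ _ (τ.inv_hom (op k))⟩, fun k l => ?_⟩
  have h := (isNatural_iff_lact _).1 τ.natural k l
  change lact F k l ≫ (ρ_ _).inv ≫ unc (τ.hom (op k)) =
    (k ⟶[V] l) ◁ ((ρ_ _).inv ≫ unc (τ.hom (op l))) ≫ lact F' k l
  rw [rightUnitor_inv_naturality_assoc, h]
  simp

variable [Limits.HasLimits V] {A : Type v} [EnrichedCategory V A]

/-- An isomorphism in the `V`-category of presheaves, in terms of isomorphisms in `V` that are
compatible with the actions. -/
theorem exists_legIso_of_lmul {F F' : EnrichedFunctor V Aᵒᵖ V} {s : 𝟙_ V ⟶ (F ⟶[V] F')}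
    {t : 𝟙_ V ⟶ (F' ⟶[V] F)} (hst : lmul s t = eId V F) (hts : lmul t s = eId V F') :
    ∃ e : ∀ k : A, F.obj (op k) ≅ F'.obj (op k),
      ∀ k l, lact F k l ≫ (e k).hom = (k ⟶[V] l) ◁ (e l).hom ≫ lact F' k l :=
  ⟨fun k => ⟨leg s k, leg t k,
    (leg_ucomp s t k).symm.trans ((congrArg (fun f => leg f k) hst).trans (leg_eId F k)),
    (leg_ucomp t s k).symm.trans ((congrArg (fun f => leg f k) hts).trans (leg_eId F' k))⟩,
    fun k l => leg_natural s k l⟩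

/-- Flatness is invariant under isomorphisms of presheaves, given by their components. -/
theorem IsFlat.of_legIso {P : LimitIndexes V} {F F' : EnrichedFunctor V Aᵒᵖ V} (h : IsFlat P A F)
    (e : ∀ k : A, F'.obj (op k) ≅ F.obj (op k))
    (he : ∀ k l, lact F' k l ≫ (e k).hom = (k ⟶[V] l) ◁ (e l).hom ≫ lact F k l) :
    IsFlat P A F' := by
  rw [isFlat_iff] at h ⊢
  obtain ⟨L, lam, hlam, hL⟩ := h
  refine ⟨L, fun H a => H.obj a ◁ (e a).hom ≫ lam H a,
    ⟨fun H => (hlam.isTensor H).reindex e he, fun H H' a => ?_⟩, hL⟩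
  rw [MonoidalCategory.whiskerLeft_comp_assoc, hlam.natural, associator_inv_naturality_right_assoc,
    whisker_exchange_assoc]

theorem IsFlat.of_lmul {P : LimitIndexes V} {F F' : EnrichedFunctor V Aᵒᵖ V} (h : IsFlat P A F)
    {s : 𝟙_ V ⟶ (F' ⟶[V] F)} {t : 𝟙_ V ⟶ (F ⟶[V] F')} (hst : lmul s t = eId V F')
    (hts : lmul t s = eId V F) : IsFlat P A F' := by
  obtain ⟨e, he⟩ := exists_legIso_of_lmul hst hts
  exact h.of_legIso e he

end Replete

/-! ### Pointwise colimits of presheaves -/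

section PointwiseColimits

variable {V : Type u} [Category.{v} V] [MonoidalCategory V] [SymmetricCategory V]
  [MonoidalClosed V] [Limits.HasLimits V]
variable {A : Type v} [EnrichedCategory V A] {K : Type v} [EnrichedCategory V K]

/-- The functor `k ↦ (G k) a`, for a functor `G : K → [Aᵒᵖ, V]`. -/
def evalAt (G : EnrichedFunctor V K (EnrichedFunctor V Aᵒᵖ V)) (a : A) : EnrichedFunctor V K V :=
  functorOfRact (fun k => (G.obj k).obj (op a)) (fun k l => papp (G.map k l) a)
    (fun k => by rw [← papp_comp, G.map_id, papp_eId])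
    (fun j k l => by rw [← papp_comp, G.map_comp, ← gcomp, papp_gcomp])

theorem ract_evalAt (G : EnrichedFunctor V K (EnrichedFunctor V Aᵒᵖ V)) (a : A) (k l : K) :
    ract (evalAt G a) k l = papp (G.map k l) a :=
  ract_functorOfRact _ _ _ _ k l

theorem isBalanced_evalAt_iff {F : EnrichedFunctor V Kᵒᵖ V}
    {G : EnrichedFunctor V K (EnrichedFunctor V Aᵒᵖ V)} {a : A} {x : V}
    {φ : ∀ k, (G.obj k).obj (op a) ⊗ F.obj (op k) ⟶ x} :
    IsBalanced (evalAt G a) F φ ↔ ∀ k l, papp (G.map k l) a ▷ F.obj (op l) ≫ φ l =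
      (α_ _ _ _).hom ≫ (G.obj k).obj (op a) ◁ lact F k l ≫ φ k :=
  forall_congr' fun k => forall_congr' fun l => Eq.congr_left
    (congrArg (fun t => t ▷ F.obj (op l) ≫ φ l) (ract_evalAt G a k l))

theorem IsTensor.hom_ext_middle {H : EnrichedFunctor V K V} {F : EnrichedFunctor V Kᵒᵖ V} {t : V}
    {lam : ∀ k, H.obj k ⊗ F.obj (op k) ⟶ t} (h : IsTensor H F t lam) {W Z x : V}
    {f g : W ⊗ (t ⊗ Z) ⟶ x}
    (hfg : ∀ k, W ◁ (lam k ▷ Z) ≫ f = W ◁ (lam k ▷ Z) ≫ g) : f = g := by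
  refine cur_injective (h.hom_ext_right fun k => ?_)
  rw [comp_cur, comp_cur, hfg]

/-- Weighted colimits in a presheaf category are computed pointwise, as tensor products. -/
theorem exists_pointwise_colimit {F : EnrichedFunctor V Kᵒᵖ V}
    {G : EnrichedFunctor V K (EnrichedFunctor V Aᵒᵖ V)}
    (h : ∀ a, ∃ (t : V) (lam : ∀ k, (G.obj k).obj (op a) ⊗ F.obj (op k) ⟶ t),
      IsTensor (evalAt G a) F t lam) :
    ∃ (E : EnrichedFunctor V Aᵒᵖ V) (e : ∀ k, F.obj (op k) ⟶ (G.obj k ⟶[V] E)),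
      IsColimitCocone F G E e ∧
        ∀ a, IsTensor (evalAt G a) F (E.obj (op a)) (fun k => papp (e k) a) := by
  choose t lam hlam using h
  have bal (a : A) (k l : K) : papp (G.map k l) a ▷ F.obj (op l) ≫ lam a l =
      (α_ _ _ _).hom ≫ (G.obj k).obj (op a) ◁ lact F k l ≫ lam a k :=
    isBalanced_evalAt_iff.1 (hlam a).balanced k l
  have ext_left (a : A) {W x : V} {f g : W ⊗ t a ⟶ x}
      (hfg : ∀ k, W ◁ lam a k ≫ f = W ◁ lam a k ≫ g) : f = g := (hlam a).hom_ext_left hfg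
  have ext_middle (a : A) {W Z x : V} {f g : W ⊗ (t a ⊗ Z) ⟶ x}
      (hfg : ∀ k, W ◁ (lam a k ▷ Z) ≫ f = W ◁ (lam a k ▷ Z) ≫ g) : f = g :=
    (hlam a).hom_ext_middle hfg
  -- The action of `A` on `t` is induced by its actions on the presheaves `G k`.
  have hact (a b : A) : ∃ act : (a ⟶[V] b) ⊗ t b ⟶ t a, ∀ k, (a ⟶[V] b) ◁ lam b k ≫ act =
      (α_ _ _ _).inv ≫ lact (G.obj k) a b ▷ F.obj (op k) ≫ lam a k := by
    refine ((hlam b).existsUnique_left (fun k =>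
      (α_ (a ⟶[V] b) ((G.obj k).obj (op b)) (F.obj (op k))).inv ≫
        lact (G.obj k) a b ▷ F.obj (op k) ≫ lam a k) fun k l => ?_).exists
    have e : (a ⟶[V] b) ◁ papp (G.map k l) b ≫ lact (G.obj l) a b =
        (α_ _ _ _).inv ≫ lact (G.obj k) a b ▷ (k ⟶[V] l) ≫ papp (G.map k l) a :=
      ((Iso.inv_comp_eq _).2 (papp_natural (G.map k l) a b)).symm
    have e' : (a ⟶[V] b) ◁ (papp (G.map k l) b ▷ F.obj (op l)) ≫
        (α_ _ _ _).inv ≫ lact (G.obj l) a b ▷ F.obj (op l) ≫ lam a l =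
        (a ⟶[V] b) ◁ (α_ _ _ _).hom ≫ (a ⟶[V] b) ◁ ((G.obj k).obj (op b) ◁ lact F k l) ≫
        (α_ _ _ _).inv ≫ lact (G.obj k) a b ▷ F.obj (op k) ≫ lam a k := by
      rw [associator_inv_naturality_middle_assoc, ← comp_whiskerRight_assoc, e,
        comp_whiskerRight_assoc, comp_whiskerRight_assoc, bal,
        associator_naturality_left_assoc, associator_inv_naturality_right_assoc,
        whisker_exchange_assoc]
      simp
    exact (congrArg (fun s => (a ⟶[V] b) ◁ (s ▷ F.obj (op l)) ≫
      (α_ _ _ _).inv ≫ lact (G.obj l) a b ▷ F.obj (op l) ≫ lam a l) (ract_evalAt G b k l)).trans e'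
  choose act hact using hact
  let E : EnrichedFunctor V Aᵒᵖ V := presheafOfLact t act
    (fun a => ext_left a fun k => by
      rw [whisker_exchange_assoc, hact, associator_inv_naturality_left_assoc,
        ← comp_whiskerRight_assoc, lact_id]
      simp)
    (fun a b c => ext_left c fun k => by
      rw [whisker_exchange_assoc, hact, associator_inv_naturality_left_assoc,
        ← comp_whiskerRight_assoc, lact_comp, associator_naturality_right_assoc,
        ← MonoidalCategory.whiskerLeft_comp_assoc, hact, MonoidalCategory.whiskerLeft_comp_assoc,
        MonoidalCategory.whiskerLeft_comp_assoc, hact, associator_inv_naturality_middle_assoc]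
      simp)
  have hE (a b : A) : lact E a b = act a b := lact_presheafOfLact _ _ _ _ a b
  have he₀ (k : K) (a b : A) : lact (G.obj k) a b ▷ F.obj (op k) ≫ lam a k =
      (α_ _ _ _).hom ≫ (a ⟶[V] b) ◁ lam b k ≫ act a b := by
    rw [hact, Iso.hom_inv_id_assoc]
  have he (k : K) : ∃ e : F.obj (op k) ⟶ (G.obj k ⟶[V] E), ∀ a, papp e a = lam a k := by
    have hn (a b : A) : lact (G.obj k) a b ▷ F.obj (op k) ≫ lam a k =
        (α_ _ _ _).hom ≫ (a ⟶[V] b) ◁ lam b k ≫ lact E a b := (he₀ k a b).trans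
      (congrArg (fun s => (α_ _ _ _).hom ≫ (a ⟶[V] b) ◁ lam b k ≫ s) (hE a b).symm)
    exact ⟨plift (F := G.obj k) (G := E) (fun a => lam a k) hn, fun a =>
      papp_plift (F := G.obj k) (G := E) (fun a => lam a k) hn a⟩
  choose e he using he
  refine ⟨E, e, ⟨fun k l => papp_ext fun a => ?_, fun {Z x} φ hφ => ?_⟩, fun a => ?_⟩
  · rw [papp_comp, papp_gcomp, he, he, Iso.eq_inv_comp]
    exact (bal a k l).symm
  · -- A cocone factors pointwise, and the factorisations commute with the actions of `A`.
    have hg (a : A) : ∃! g : t a ⊗ Z ⟶ x.obj (op a), ∀ k, lam a k ▷ Z ≫ g =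
        (α_ _ _ _).hom ≫ papp (φ k) a := by
      refine (hlam a).existsUnique_right (fun k => (α_ ((G.obj k).obj (op a)) _ Z).hom ≫
        papp (φ k) a) fun k l => ?_
      have h1 := congrArg (fun s => papp s a) (hφ k l)
      simp only [papp_comp, papp_gcomp] at h1
      have e' : papp (G.map k l) a ▷ F.obj (op l) ▷ Z ≫ (α_ _ _ _).hom ≫ papp (φ l) a =
          (α_ _ _ _).hom ▷ Z ≫ ((G.obj k).obj (op a) ◁ lact F k l) ▷ Z ≫
            (α_ _ _ _).hom ≫ papp (φ k) a := by
        rw [associator_naturality_left_assoc, associator_naturality_middle_assoc, h1,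
          pentagon_assoc, Iso.hom_inv_id_assoc]
      exact (congrArg (fun s => s ▷ F.obj (op l) ▷ Z ≫ (α_ _ _ _).hom ≫ papp (φ l) a)
        (ract_evalAt G a k l)).trans e'
    choose g hg hgu using hg
    have hgn (a b : A) : act a b ▷ Z ≫ g a =
        (α_ _ _ _).hom ≫ (a ⟶[V] b) ◁ g b ≫ lact x a b := by
      rw [← Iso.inv_comp_eq]
      refine ext_middle b fun k => ?_
      rw [associator_inv_naturality_middle_assoc, ← comp_whiskerRight_assoc, hact,
        comp_whiskerRight_assoc, comp_whiskerRight_assoc, hg,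
        ← MonoidalCategory.whiskerLeft_comp_assoc, hg, MonoidalCategory.whiskerLeft_comp_assoc,
        associator_naturality_left_assoc, papp_natural]
      simp
    have hgn' (a b : A) : lact E a b ▷ Z ≫ g a =
        (α_ _ _ _).hom ≫ (a ⟶[V] b) ◁ g b ≫ lact x a b :=
      (congrArg (fun s => s ▷ Z ≫ g a) (hE a b)).trans (hgn a b)
    obtain ⟨g', hg'⟩ : ∃ g' : Z ⟶ (E ⟶[V] x), ∀ a, papp g' a = g a :=
      ⟨plift (F := E) (G := x) g hgn', fun a => papp_plift (F := E) (G := x) g hgn' a⟩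
    have hpapp (f : Z ⟶ (E ⟶[V] x)) (k : K) (a : A) : papp (gcomp (e k) f) a =
        (α_ _ _ _).inv ≫ lam a k ▷ Z ≫ papp f a := by
      rw [papp_gcomp, he]
      rfl
    refine ⟨g', fun k => papp_ext fun a => ?_, fun f hf => papp_ext fun a => ?_⟩
    · rw [hpapp, hg', hg, Iso.inv_hom_id_assoc]
    · rw [hg']
      refine hgu a _ fun k => ?_
      rw [← Iso.inv_comp_eq, ← hpapp, hf]
  · exact (congrArg (IsTensor (evalAt G a) F (t a)) (funext fun k => he k a)).mpr (hlam a)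

end PointwiseColimits

/-! ### The functor `H ↦ H * G -` -/

section PointwiseLimits

variable {V : Type u} [Category.{v} V] [MonoidalCategory V] [SymmetricCategory V]
  [MonoidalClosed V] [Limits.HasLimits V]
variable {K : Type v} [EnrichedCategory V K] {M : Type w} [EnrichedCategory V M]

/-- A cone in `[K, V]` is a limit cone as soon as its components are. -/
theorem isLimitCone_of_pointwise {W : EnrichedFunctor V M V}
    {D : EnrichedFunctor V M (EnrichedFunctor V K V)} {Y : EnrichedFunctor V K V}
    {r : ∀ m, W.obj m ⟶ (Y ⟶[V] D.obj m)}
    (hr : ∀ m n, gcomp (r m) (D.map m n) = ract W m n ≫ r n)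
    (h : ∀ (k : K) {Z x : V}
      (ψ : ∀ m, Z ⊗ W.obj m ⟶ (EnrichedCategory.Hom x ((D.obj m).obj k) : V)),
      (∀ m n, gcomp (ψ m) (D.map m n ≫ natHom.π (D.obj m) (D.obj n) k) =
        (α_ _ _ _).hom ≫ Z ◁ ract W m n ≫ ψ n) →
      ∃! g : Z ⟶ (EnrichedCategory.Hom x (Y.obj k) : V),
        ∀ m, gcomp g (r m ≫ natHom.π Y (D.obj m) k) = ψ m) :
    IsLimitCone W D Y r := by
  have π_gcomp {F G H : EnrichedFunctor V K V} {P Q : V} (f : P ⟶ (F ⟶[V] G)) (g : Q ⟶ (G ⟶[V] H))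
      (k : K) : gcomp f g ≫ natHom.π F H k =
        gcomp (f ≫ natHom.π F G k) (g ≫ natHom.π G H k) := gcomp_map (evaluation k) f g
  have hext (k : K) {Z x : V} {g g' : Z ⟶ (EnrichedCategory.Hom x (Y.obj k) : V)}
      (hg : ∀ m, gcomp g (r m ≫ natHom.π Y (D.obj m) k) =
        gcomp g' (r m ≫ natHom.π Y (D.obj m) k)) : g = g' := by
    refine (h k (fun m => gcomp g' (r m ≫ natHom.π Y (D.obj m) k)) fun m n => ?_).unique hg
      fun _ => rfl
    rw [gcomp_assoc, ← π_gcomp, hr, whiskerLeft_gcomp, Category.assoc]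
  refine ⟨hr, fun {Z x} ψ hψ => ?_⟩
  have hg (k : K) := h k (x := x.obj k) (fun m => ψ m ≫ natHom.π x (D.obj m) k) fun m n => by
    rw [← π_gcomp, hψ, Category.assoc, Category.assoc]
  choose g hg hgu using hg
  have hn : natHom.IsNatural x Y g := fun k l => hext l fun m => by
    change gcomp ((β_ _ _).hom ≫ gcomp (x.map k l) (g l)) _ = gcomp (gcomp (g k) (Y.map k l)) _
    have h1 : (β_ _ _).hom ≫ gcomp (Y.map k l) (r m ≫ natHom.π Y (D.obj m) l) =
        gcomp (r m ≫ natHom.π Y (D.obj m) k) ((D.obj m).map k l) :=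
      (natHom.π_natural Y (D.obj m)).precomp (r m) k l
    have h2 : (β_ _ _).hom ≫ gcomp (x.map k l) (ψ m ≫ natHom.π x (D.obj m) l) =
        gcomp (ψ m ≫ natHom.π x (D.obj m) k) ((D.obj m).map k l) :=
      (natHom.π_natural x (D.obj m)).precomp (ψ m) k l
    have h1' : gcomp (Y.map k l) (r m ≫ natHom.π Y (D.obj m) l) = (β_ _ _).hom ≫
        gcomp (r m ≫ natHom.π Y (D.obj m) k) ((D.obj m).map k l) := by
      rw [← h1, SymmetricCategory.symmetry_assoc]
    rw [← whiskerRight_gcomp, gcomp_assoc, hg, gcomp_assoc (g k), h1',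
      ← whiskerLeft_gcomp (β_ _ _).hom (g k)]
    have h3 : gcomp (g k) (gcomp (r m ≫ natHom.π Y (D.obj m) k) ((D.obj m).map k l)) =
        (α_ _ _ _).inv ≫ gcomp (ψ m ≫ natHom.π x (D.obj m) k) ((D.obj m).map k l) := by
      rw [Iso.eq_inv_comp, ← gcomp_assoc, hg]
    rw [h3, ← h2, BraidedCategory.braiding_tensor_left_hom]
    simp only [Category.assoc, Iso.inv_hom_id_assoc]
    rw [← MonoidalCategory.whiskerLeft_comp_assoc, SymmetricCategory.symmetry,
      MonoidalCategory.whiskerLeft_id, Category.id_comp, Iso.hom_inv_id_assoc]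
  refine ⟨natHom.lift g hn, fun m => natHom.hom_ext fun k => ?_, fun f hf =>
    natHom.hom_ext fun k => ?_⟩
  · rw [π_gcomp, natHom.lift_π, hg]
  · rw [natHom.lift_π]
    refine hgu k _ fun m => ?_
    rw [← π_gcomp, hf]

end PointwiseLimits

section TensorFamily

variable {V : Type u} [Category.{v} V] [MonoidalCategory V] [SymmetricCategory V]
  [MonoidalClosed V] [Limits.HasLimits V]
variable {A : Type v} [EnrichedCategory V A] {K : Type v} [EnrichedCategory V K]

theorem IsTensorFunctor.natural_comp {F : EnrichedFunctor V Aᵒᵖ V}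
    {L : EnrichedFunctor V (EnrichedFunctor V A V) V}
    {lam : ∀ (H : EnrichedFunctor V A V) (a : A), H.obj a ⊗ F.obj (op a) ⟶ L.obj H}
    (h : IsTensorFunctor F L lam) {H H' : EnrichedFunctor V A V} {Z : V} (f : Z ⟶ (H ⟶[V] H'))
    (a : A) : Z ◁ lam H a ≫ lunc (f ≫ L.map H H') =
      (α_ _ _ _).inv ≫ capp f a ▷ F.obj (op a) ≫ lam H' a := by
  have e := capp_comp f (𝟙 _) a
  rw [Category.comp_id] at e
  rw [lunc_comp, whisker_exchange_assoc, h.natural, e, comp_whiskerRight_assoc,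
    associator_inv_naturality_left_assoc]

variable {G : EnrichedFunctor V K (EnrichedFunctor V Aᵒᵖ V)}
  {L : K → EnrichedFunctor V (EnrichedFunctor V A V) V}
  {lam : ∀ (k : K) (H : EnrichedFunctor V A V) (a : A),
    H.obj a ⊗ (G.obj k).obj (op a) ⟶ (L k).obj H}

theorem exists_tensorAct (hlam : ∀ k, IsTensorFunctor (G.obj k) (L k) (lam k))
    (H : EnrichedFunctor V A V) (k l : K) :
    ∃ act : (L k).obj H ⊗ (k ⟶[V] l) ⟶ (L l).obj H, ∀ a, lam k H a ▷ (k ⟶[V] l) ≫ act =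
      (α_ _ _ _).hom ≫ H.obj a ◁ papp (G.map k l) a ≫ lam l H a := by
  refine (((hlam k).isTensor H).existsUnique_right (fun a => (α_ (H.obj a) _ (k ⟶[V] l)).hom ≫
    H.obj a ◁ papp (G.map k l) a ≫ lam l H a) fun a b => ?_).exists
  have h := ((hlam l).isTensor H).balanced a b
  rw [associator_naturality_left_assoc, ← whisker_exchange_assoc, h,
    associator_naturality_middle_assoc, associator_naturality_right_assoc,
    ← MonoidalCategory.whiskerLeft_comp_assoc, ← MonoidalCategory.whiskerLeft_comp_assoc,
    papp_natural]
  simp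

/-- The action of `K` on the tensor products `H * G k`. -/
def tensorAct (hlam : ∀ k, IsTensorFunctor (G.obj k) (L k) (lam k))
    (H : EnrichedFunctor V A V) (k l : K) : (L k).obj H ⊗ (k ⟶[V] l) ⟶ (L l).obj H :=
  (exists_tensorAct hlam H k l).choose

theorem whiskerRight_tensorAct (hlam : ∀ k, IsTensorFunctor (G.obj k) (L k) (lam k))
    (H : EnrichedFunctor V A V) (k l : K) (a : A) :
    lam k H a ▷ (k ⟶[V] l) ≫ tensorAct hlam H k l =
      (α_ _ _ _).hom ≫ H.obj a ◁ papp (G.map k l) a ≫ lam l H a :=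
  (exists_tensorAct hlam H k l).choose_spec a

/-- The functor `k ↦ H * G k`. -/
def tensorFamilyObj (hlam : ∀ k, IsTensorFunctor (G.obj k) (L k) (lam k))
    (H : EnrichedFunctor V A V) : EnrichedFunctor V K V :=
  functorOfRact (fun k => (L k).obj H) (tensorAct hlam H)
    (fun k => ((hlam k).isTensor H).hom_ext_right fun a => by
      rw [← whisker_exchange_assoc, whiskerRight_tensorAct, associator_naturality_right_assoc,
        ← MonoidalCategory.whiskerLeft_comp_assoc, ← papp_comp, G.map_id, papp_eId]
      simp)
    (fun j k l => ((hlam j).isTensor H).hom_ext_right fun a => by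
      rw [← whisker_exchange_assoc, whiskerRight_tensorAct, associator_naturality_right_assoc,
        ← MonoidalCategory.whiskerLeft_comp_assoc, ← papp_comp, G.map_comp, ← gcomp, papp_gcomp,
        associator_inv_naturality_left_assoc, ← comp_whiskerRight_assoc, whiskerRight_tensorAct,
        comp_whiskerRight_assoc, comp_whiskerRight_assoc, whiskerRight_tensorAct]
      simp)

theorem ract_tensorFamilyObj (hlam : ∀ k, IsTensorFunctor (G.obj k) (L k) (lam k))
    (H : EnrichedFunctor V A V) (k l : K) :
    ract (tensorFamilyObj hlam H) k l = tensorAct hlam H k l :=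
  ract_functorOfRact _ _ _ _ k l

theorem isNatural_tensorFamily (hlam : ∀ k, IsTensorFunctor (G.obj k) (L k) (lam k))
    (H H' : EnrichedFunctor V A V) :
    natHom.IsNatural (tensorFamilyObj hlam H) (tensorFamilyObj hlam H')
      (fun k => (L k).map H H') := by
  refine (isNatural_iff_ract _).2 fun k l => ?_
  have e : lunc ((L k).map H H') ▷ (k ⟶[V] l) ≫ tensorAct hlam H' k l =
      (α_ _ _ _).hom ≫ (H ⟶[V] H') ◁ tensorAct hlam H k l ≫ lunc ((L l).map H H') := by
    rw [← Iso.inv_comp_eq]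
    refine ((hlam k).isTensor H).hom_ext_middle fun a => ?_
    rw [associator_inv_naturality_middle_assoc, ← comp_whiskerRight_assoc, (hlam k).natural,
      comp_whiskerRight_assoc, comp_whiskerRight_assoc, whiskerRight_tensorAct,
      ← MonoidalCategory.whiskerLeft_comp_assoc, whiskerRight_tensorAct,
      MonoidalCategory.whiskerLeft_comp_assoc, MonoidalCategory.whiskerLeft_comp_assoc,
      (hlam l).natural, associator_naturality_left_assoc, associator_inv_naturality_right_assoc,
      ← whisker_exchange_assoc]
    simp
  refine (congrArg (fun t => lunc ((L k).map H H') ▷ (k ⟶[V] l) ≫ t)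
    (ract_tensorFamilyObj hlam H' k l)).trans (e.trans ?_)
  exact congrArg (fun t => (α_ _ _ _).hom ≫ (H ⟶[V] H') ◁ t ≫ lunc ((L l).map H H'))
    (ract_tensorFamilyObj hlam H k l).symm

/-- The action on morphisms of `H ↦ H * G -`. -/
def tensorFamilyMap (hlam : ∀ k, IsTensorFunctor (G.obj k) (L k) (lam k))
    (H H' : EnrichedFunctor V A V) :
    (H ⟶[V] H') ⟶ (tensorFamilyObj hlam H ⟶[V] tensorFamilyObj hlam H') :=
  natHom.lift _ (isNatural_tensorFamily hlam H H')

theorem tensorFamilyMap_π (hlam : ∀ k, IsTensorFunctor (G.obj k) (L k) (lam k))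
    (H H' : EnrichedFunctor V A V) (k : K) :
    tensorFamilyMap hlam H H' ≫ natHom.π _ _ k = (L k).map H H' :=
  natHom.lift_π _ _ k

/-- The functor `[A, V] → [K, V]`, `H ↦ H * G -`. -/
def tensorFamily (hlam : ∀ k, IsTensorFunctor (G.obj k) (L k) (lam k)) :
    EnrichedFunctor V (EnrichedFunctor V A V) (EnrichedFunctor V K V) where
  obj H := tensorFamilyObj hlam H
  map H H' := tensorFamilyMap hlam H H'
  map_id H := natHom.hom_ext fun k => by
    rw [Category.assoc, tensorFamilyMap_π]
    exact ((L k).map_id H).trans (eId_π (tensorFamilyObj hlam H) k).symm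
  map_comp H H' H'' := natHom.hom_ext fun k => by
    rw [Category.assoc, tensorFamilyMap_π]
    refine ((L k).map_comp H H' H'').trans (Eq.trans ?_
      (gcomp_map (evaluation k) (tensorFamilyMap hlam H H') (tensorFamilyMap hlam H' H'')).symm)
    exact (congrArg₂ gcomp (tensorFamilyMap_π hlam H H' k) (tensorFamilyMap_π hlam H' H'' k)).symm

theorem tensorFamily_map_π (hlam : ∀ k, IsTensorFunctor (G.obj k) (L k) (lam k))
    (H H' : EnrichedFunctor V A V) (k : K) :
    (tensorFamily hlam).map H H' ≫ natHom.π _ _ k = (L k).map H H' :=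
  tensorFamilyMap_π hlam H H' k

theorem capp_tensorFamily_map (hlam : ∀ k, IsTensorFunctor (G.obj k) (L k) (lam k))
    (H H' : EnrichedFunctor V A V) (k : K) :
    capp ((tensorFamily hlam).map H H') k = lunc ((L k).map H H') :=
  congrArg lunc (tensorFamily_map_π hlam H H' k)

/-- Limits in `[K, V]` being computed pointwise, `H ↦ H * G -` is continuous if all the functors
`- * G k` are. -/
theorem isContinuous_tensorFamily {P : LimitIndexes V}
    (hlam : ∀ k, IsTensorFunctor (G.obj k) (L k) (lam k)) (hL : ∀ k, IsContinuous P (L k)) :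
    IsContinuous P (tensorFamily hlam) := by
  rw [isContinuous_iff]
  intro M _ W hW D X r hr
  refine isLimitCone_of_pointwise (fun m n => ?_) fun k Z x ψ hψ => ?_
  · exact (gcomp_map (tensorFamily hlam) _ _).symm.trans ((congrArg (fun t => t ≫ _)
      (hr.natural m n)).trans (Category.assoc _ _ _))
  · have h := isContinuous_iff.1 (hL k) M W hW D X r hr
    have hπ {Q : V} {H H' : EnrichedFunctor V A V} (f : Q ⟶ (H ⟶[V] H')) :
        (f ≫ (tensorFamily hlam).map H H') ≫ natHom.π _ _ k = f ≫ (L k).map H H' :=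
      (Category.assoc _ _ _).trans (congrArg (fun t => f ≫ t) (tensorFamily_map_π hlam H H' k))
    obtain ⟨g, hg, hgu⟩ := h.existsUnique ψ fun m n =>
      (congrArg (gcomp (ψ m)) (hπ (D.map m n))).symm.trans (hψ m n)
    exact ⟨g, fun m => (congrArg (gcomp g) (hπ (r m))).trans (hg m), fun g' hg' => hgu g' fun m =>
      (congrArg (gcomp g') (hπ (r m))).symm.trans (hg' m)⟩

end TensorFamily

/-! ### Flat colimits of flat presheaves -/

section Associativity

variable {V : Type u} [Category.{v} V] [MonoidalCategory V] [SymmetricCategory V]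
  [MonoidalClosed V] [Limits.HasLimits V]
variable {A : Type v} [EnrichedCategory V A] {K : Type v} [EnrichedCategory V K]
variable {G : EnrichedFunctor V K (EnrichedFunctor V Aᵒᵖ V)}
  {L : K → EnrichedFunctor V (EnrichedFunctor V A V) V}
  {lam : ∀ (k : K) (H : EnrichedFunctor V A V) (a : A),
    H.obj a ⊗ (G.obj k).obj (op a) ⟶ (L k).obj H}
  {hlam : ∀ k, IsTensorFunctor (G.obj k) (L k) (lam k)}
  {F : EnrichedFunctor V Kᵒᵖ V} {H : EnrichedFunctor V A V} {t : V}

theorem isBalanced_tensorFamilyObj_iff {μ : ∀ k, (L k).obj H ⊗ F.obj (op k) ⟶ t} :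
    IsBalanced (tensorFamilyObj hlam H) F μ ↔
      ∀ k l, tensorAct hlam H k l ▷ F.obj (op l) ≫ μ l =
        (α_ _ _ _).hom ≫ (L k).obj H ◁ lact F k l ≫ μ k :=
  forall_congr' fun k => forall_congr' fun l => Eq.congr_left
    (congrArg (fun s => s ▷ F.obj (op l) ≫ μ l) (ract_tensorFamilyObj hlam H k l))

variable {E : EnrichedFunctor V Aᵒᵖ V} {e : ∀ k, F.obj (op k) ⟶ (G.obj k ⟶[V] E)}

/-- The map `H a ⊗ (G * F) a ⟶ (H * G) * F` induced by the maps `H a ⊗ G k a ⟶ H * G k`. -/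
theorem exists_outerTensor {μ : ∀ k, (L k).obj H ⊗ F.obj (op k) ⟶ t}
    (hμ : IsTensor (tensorFamilyObj hlam H) F t μ) {a : A}
    (he : IsTensor (evalAt G a) F (E.obj (op a)) (fun k => papp (e k) a)) :
    ∃ ν : H.obj a ⊗ E.obj (op a) ⟶ t, ∀ k, H.obj a ◁ papp (e k) a ≫ ν =
      (α_ _ _ _).inv ≫ lam k H a ▷ F.obj (op k) ≫ μ k := by
  refine (he.existsUnique_left (fun k => (α_ (H.obj a) ((G.obj k).obj (op a)) (F.obj (op k))).inv ≫
    lam k H a ▷ F.obj (op k) ≫ μ k) fun k l => ?_).exists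
  have hbal := isBalanced_tensorFamilyObj_iff.1 hμ.balanced k l
  have h : H.obj a ◁ papp (G.map k l) a ≫ lam l H a = (α_ _ _ _).inv ≫
      lam k H a ▷ (k ⟶[V] l) ≫ tensorAct hlam H k l := by
    rw [whiskerRight_tensorAct, Iso.inv_hom_id_assoc]
  have h' : H.obj a ◁ (papp (G.map k l) a ▷ F.obj (op l)) ≫ (α_ _ _ _).inv ≫
      lam l H a ▷ F.obj (op l) ≫ μ l = H.obj a ◁ (α_ _ _ _).hom ≫
      H.obj a ◁ ((G.obj k).obj (op a) ◁ lact F k l) ≫ (α_ _ _ _).inv ≫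
      lam k H a ▷ F.obj (op k) ≫ μ k := by
    rw [associator_inv_naturality_middle_assoc, ← comp_whiskerRight_assoc, h,
      comp_whiskerRight_assoc, comp_whiskerRight_assoc, hbal,
      associator_naturality_left_assoc, associator_inv_naturality_right_assoc,
      whisker_exchange_assoc]
    simp
  exact (congrArg (fun s => H.obj a ◁ (s ▷ F.obj (op l)) ≫ (α_ _ _ _).inv ≫
    lam l H a ▷ F.obj (op l) ≫ μ l) (ract_evalAt G a k l)).trans h'

/-- Associativity of tensor products: `H * (G * F) = (H * G) * F`. -/
theorem isTensor_outerTensor {μ : ∀ k, (L k).obj H ⊗ F.obj (op k) ⟶ t}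
    (hμ : IsTensor (tensorFamilyObj hlam H) F t μ)
    (he : ∀ a, IsTensor (evalAt G a) F (E.obj (op a)) (fun k => papp (e k) a))
    {ν : ∀ a, H.obj a ⊗ E.obj (op a) ⟶ t} (hν : ∀ a k, H.obj a ◁ papp (e k) a ≫ ν a =
      (α_ _ _ _).inv ≫ lam k H a ▷ F.obj (op k) ≫ μ k) :
    IsTensor H E t ν := by
  have hnat (k : K) (a b : A) : (a ⟶[V] b) ◁ papp (e k) b ≫ lact E a b = (α_ _ _ _).inv ≫
      lact (G.obj k) a b ▷ F.obj (op k) ≫ papp (e k) a :=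
    ((Iso.inv_comp_eq _).2 (papp_natural (e k) a b)).symm
  have hlbal (k : K) (a b : A) : ract H a b ▷ (G.obj k).obj (op b) ≫ lam k H b =
      (α_ _ _ _).hom ≫ H.obj a ◁ lact (G.obj k) a b ≫ lam k H a :=
    ((hlam k).isTensor H).balanced a b
  have hebal (a : A) (k l : K) : papp (G.map k l) a ▷ F.obj (op l) ≫ papp (e l) a =
      (α_ _ _ _).hom ≫ (G.obj k).obj (op a) ◁ lact F k l ≫ papp (e k) a :=
    isBalanced_evalAt_iff.1 (he a).balanced k l
  have heext (a : A) {W x : V} {f g : W ⊗ E.obj (op a) ⟶ x}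
      (hfg : ∀ k, W ◁ papp (e k) a ≫ f = W ◁ papp (e k) a ≫ g) : f = g := (he a).hom_ext_left hfg
  refine ⟨fun a b => heext b fun k => ?_, fun {x} φ hφ => ?_⟩
  · rw [whisker_exchange_assoc, hν, associator_naturality_right_assoc,
      ← MonoidalCategory.whiskerLeft_comp_assoc, hnat, MonoidalCategory.whiskerLeft_comp_assoc,
      MonoidalCategory.whiskerLeft_comp_assoc, hν, associator_inv_naturality_left_assoc,
      ← comp_whiskerRight_assoc, hlbal, comp_whiskerRight_assoc, comp_whiskerRight_assoc,
      associator_inv_naturality_middle_assoc]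
    simp
  · have hm (k : K) : ∃! m : (L k).obj H ⊗ F.obj (op k) ⟶ x, ∀ a, lam k H a ▷ F.obj (op k) ≫ m =
        (α_ _ _ _).hom ≫ H.obj a ◁ papp (e k) a ≫ φ a := by
      refine ((hlam k).isTensor H).existsUnique_right (fun a => (α_ (H.obj a) _ _).hom ≫
        H.obj a ◁ papp (e k) a ≫ φ a) fun a b => ?_
      rw [associator_naturality_left_assoc, ← whisker_exchange_assoc, hφ a b,
        associator_naturality_middle_assoc, associator_naturality_right_assoc,
        ← MonoidalCategory.whiskerLeft_comp_assoc, ← MonoidalCategory.whiskerLeft_comp_assoc,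
        hnat]
      simp
    choose m hm hmu using hm
    have hmbal : IsBalanced (tensorFamilyObj hlam H) F m := by
      refine isBalanced_tensorFamilyObj_iff.2 fun k l =>
        (cancel_epi (α_ _ _ _).inv).1 (((hlam k).isTensor H).hom_ext_right fun a => ?_)
      rw [associator_inv_naturality_left_assoc, ← comp_whiskerRight_assoc, whiskerRight_tensorAct,
        comp_whiskerRight_assoc, comp_whiskerRight_assoc, hm, Iso.inv_hom_id_assoc,
        ← whisker_exchange_assoc, hm, associator_naturality_middle_assoc,
        associator_naturality_right_assoc, ← MonoidalCategory.whiskerLeft_comp_assoc,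
        ← MonoidalCategory.whiskerLeft_comp_assoc, hebal]
      simp
    obtain ⟨g, hg, hgu⟩ := hμ.existsUnique m hmbal
    refine ⟨g, fun a => heext a fun k => ?_, fun g' hg' => hgu g' fun k => ?_⟩
    · have hg₀ : μ k ≫ g = m k := hg k
      rw [reassoc_of% (hν a k), hg₀, hm, Iso.inv_hom_id_assoc]
    · refine hmu k _ fun a => ?_
      rw [← Iso.inv_comp_eq, ← hg' a, reassoc_of% (hν a k)]
      rfl

end Associativity

section Closure

variable {V : Type u} [Category.{v} V] [MonoidalCategory V] [SymmetricCategory V]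
  [MonoidalClosed V] [Limits.HasLimits V]
variable {A : Type v} [EnrichedCategory V A] {K : Type v} [EnrichedCategory V K]

theorem IsFlat.exists_isTensor {P : LimitIndexes V} {F : EnrichedFunctor V Aᵒᵖ V}
    (hF : IsFlat P A F) (H : EnrichedFunctor V A V) :
    ∃ (t : V) (lam : ∀ a, H.obj a ⊗ F.obj (op a) ⟶ t), IsTensor H F t lam := by
  obtain ⟨L, lam, h, -⟩ := isFlat_iff.1 hF
  exact ⟨L.obj H, lam H, h.isTensor H⟩

theorem IsContinuous.comp {P : LimitIndexes V} {B : Type w} [EnrichedCategory V B] {C : Type w₁}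
    [EnrichedCategory V C] {D : Type w₂} [EnrichedCategory V D] {S : EnrichedFunctor V B C}
    {T : EnrichedFunctor V C D} (hS : IsContinuous P S) (hT : IsContinuous P T) :
    IsContinuous P (S.comp V T) := by
  rw [isContinuous_iff] at hS hT ⊢
  intro K _ F hF G b r hr
  have h := hT K F hF _ _ _ (hS K F hF G b r hr)
  have e (k l : K) : (G.map k l ≫ S.map _ _) ≫ T.map _ _ = G.map k l ≫ S.map _ _ ≫ T.map _ _ :=
    Category.assoc _ _ _
  have e' (k : K) : (r k ≫ S.map b (G.obj k)) ≫ T.map _ _ = r k ≫ S.map b (G.obj k) ≫ T.map _ _ :=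
    Category.assoc _ _ _
  refine ⟨fun k l => ?_, fun {Z x} ψ hψ => ?_⟩
  · exact (congrArg₂ gcomp (e' k) (e k l)).symm.trans
      ((h.natural k l).trans (congrArg (fun t => ract F k l ≫ t) (e' l)))
  · obtain ⟨g, hg, hgu⟩ := h.existsUnique ψ fun k l =>
      (congrArg (gcomp (ψ k)) (e k l)).trans (hψ k l)
    exact ⟨g, fun k => (congrArg (gcomp g) (e' k)).symm.trans (hg k), fun g' hg' => hgu g' fun k =>
      (congrArg (gcomp g') (e' k)).trans (hg' k)⟩

/-- A flat colimit `E = G * F` of flat presheaves is flat: as `H * E = (H * G -) * F`, the functor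
`- * E` is the composite of `H ↦ H * G -`, from `[A, V]` to `[K, V]`, and of `- * F`, and both are
continuous. -/
theorem isFlat_of_colimit {P : LimitIndexes V} {F : EnrichedFunctor V Kᵒᵖ V} (hF : IsFlat P K F)
    {G : EnrichedFunctor V K (EnrichedFunctor V Aᵒᵖ V)} (hG : ∀ k, IsFlat P A (G.obj k))
    {E : EnrichedFunctor V Aᵒᵖ V} {e : ∀ k, F.obj (op k) ⟶ (G.obj k ⟶[V] E)}
    (he : ∀ a, IsTensor (evalAt G a) F (E.obj (op a)) (fun k => papp (e k) a)) :
    IsFlat P A E := by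
  obtain ⟨LF, lamF, hlamF, hLF⟩ := isFlat_iff.1 hF
  choose L lam hlam hL using fun k => isFlat_iff.1 (hG k)
  let μ (H : EnrichedFunctor V A V) (k : K) : (L k).obj H ⊗ F.obj (op k) ⟶
    LF.obj (tensorFamilyObj hlam H) := lamF (tensorFamilyObj hlam H) k
  have hμ (H : EnrichedFunctor V A V) : IsTensor (tensorFamilyObj hlam H) F _ (μ H) :=
    hlamF.isTensor (tensorFamilyObj hlam H)
  choose ν hν using fun H a => exists_outerTensor (hμ H) (he a)
  refine isFlat_iff.2 ⟨(tensorFamily hlam).comp V LF, ν,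
    ⟨fun H => isTensor_outerTensor (hμ H) he (hν H), fun H H' a => ?_⟩,
    (isContinuous_tensorFamily hlam hL).comp hLF⟩
  have h1 (k : K) : (H ⟶[V] H') ◁ μ H k ≫ lunc ((tensorFamily hlam).map H H' ≫ LF.map _ _) =
      (α_ _ _ _).inv ≫ lunc ((L k).map H H') ▷ F.obj (op k) ≫ μ H' k :=
    (hlamF.natural_comp ((tensorFamily hlam).map H H') k).trans
      (congrArg (fun s => (α_ _ _ _).inv ≫ s ▷ F.obj (op k) ≫ μ H' k)
        (capp_tensorFamily_map hlam H H' k))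
  have heext (a : A) {W x : V} {f g : W ⊗ E.obj (op a) ⟶ x}
      (hfg : ∀ k, W ◁ papp (e k) a ≫ f = W ◁ papp (e k) a ≫ g) : f = g := (he a).hom_ext_left hfg
  have h3 (k : K) : (H ⟶[V] H') ◁ lam k H a ≫ lunc ((L k).map H H') =
      (α_ _ _ _).inv ≫ capp (𝟙 (H ⟶[V] H')) a ▷ (G.obj k).obj (op a) ≫ lam k H' a :=
    (hlam k).natural H H' a
  -- Naturality of `ν` in `H` can be tested on the components `papp (e k) a` of the colimit.
  have h4 {y : V} (l : (H ⟶[V] H') ⊗ LF.obj (tensorFamilyObj hlam H) ⟶ y)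
      (f : ∀ k, (L k).obj H' ⊗ F.obj (op k) ⟶ y) (g : H'.obj a ⊗ E.obj (op a) ⟶ y)
      (hl : ∀ k, (H ⟶[V] H') ◁ μ H k ≫ l =
        (α_ _ _ _).inv ≫ lunc ((L k).map H H') ▷ F.obj (op k) ≫ f k)
      (hg : ∀ k, H'.obj a ◁ papp (e k) a ≫ g =
        (α_ _ _ _).inv ≫ lam k H' a ▷ F.obj (op k) ≫ f k) :
      (α_ _ _ _).hom ≫ (H ⟶[V] H') ◁ ν H a ≫ l =
        capp (𝟙 (H ⟶[V] H')) a ▷ E.obj (op a) ≫ g := heext a fun k => by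
    rw [whisker_exchange_assoc, hg, associator_naturality_right_assoc,
      ← MonoidalCategory.whiskerLeft_comp_assoc, hν, MonoidalCategory.whiskerLeft_comp_assoc,
      MonoidalCategory.whiskerLeft_comp_assoc, hl, associator_inv_naturality_middle_assoc,
      ← comp_whiskerRight_assoc, h3, comp_whiskerRight_assoc, comp_whiskerRight_assoc,
      associator_inv_naturality_left_assoc]
    simp
  have h2 : (α_ _ _ _).hom ≫ (H ⟶[V] H') ◁ ν H a ≫
      lunc ((tensorFamily hlam).map H H' ≫ LF.map _ _) =
        capp (𝟙 (H ⟶[V] H')) a ▷ E.obj (op a) ≫ ν H' a := h4 _ (μ H') (ν H' a) h1 (hν H' a)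
  exact (Iso.eq_inv_comp _).2 h2

end Closure

/-! ### The unit of a left Kan extension along a fully faithful functor -/

section KanUnit

variable {V : Type u} [Category.{v} V] [MonoidalCategory V] [SymmetricCategory V]

/-- The pointwise inverse of a `V`-natural family is `V`-natural. -/
theorem isNatural_inverse {X : Type w} [EnrichedCategory V X] {Y : Type w₁} [EnrichedCategory V Y]
    {F G : EnrichedFunctor V X Y} {τ : ∀ x, 𝟙_ V ⟶ (F.obj x ⟶[V] G.obj x)}
    (hτ : natHom.IsNatural F G τ) {σ : ∀ x, 𝟙_ V ⟶ (G.obj x ⟶[V] F.obj x)}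
    (h₁ : ∀ x, lmul (τ x) (σ x) = eId V (F.obj x)) (h₂ : ∀ x, lmul (σ x) (τ x) = eId V (G.obj x)) :
    natHom.IsNatural G F σ := by
  rw [isNatural_unit_iff] at hτ ⊢
  intro x y
  have h := congrArg (fun t => lmul (σ x) (rmul t (σ y))) (hτ x y)
  simp only [rmul_rmul, h₁, rmul_eId] at h
  rw [h, ← lmul_rmul, lmul_lmul, h₂, lmul_eId]

variable [MonoidalClosed V] [Limits.HasLimits V]
variable {A : Type v} [EnrichedCategory V A] {B : Type w} [EnrichedCategory V B]
  {C : Type w₁} [EnrichedCategory V C]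

/-- The colimit of `G` weighted by `A(-, a)` is `G a`. -/
theorem isColimitCocone_representable (G : EnrichedFunctor V A B) (a : A) :
    IsColimitCocone ((yoneda A).obj a) G (G.obj a) (fun b => G.map b a) := by
  have key {Z : V} {x : B} (φ : ∀ b : A, (b ⟶[V] a) ⊗ Z ⟶ (G.obj b ⟶[V] x))
      (hφ : ∀ b c : A, eComp V b c a ▷ Z ≫ φ b = (α_ _ _ _).hom ≫ gcomp (G.map b c) (φ c)) :
      ∃! g : Z ⟶ (G.obj a ⟶[V] x), ∀ b, gcomp (G.map b a) g = φ b := by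
    refine ⟨(λ_ Z).inv ≫ eId V a ▷ Z ≫ φ a, fun b => ?_, fun g hg => ?_⟩
    · have ht : (b ⟶[V] a) ◁ (λ_ Z).inv ≫ (α_ _ _ _).inv = (ρ_ (b ⟶[V] a)).inv ▷ Z := by
        rw [Iso.comp_inv_eq, triangle_assoc_comp_right_inv]
      have h := hφ b a
      rw [← Iso.inv_comp_eq] at h
      rw [← whiskerLeft_gcomp, ← whiskerLeft_gcomp, ← h, associator_inv_naturality_middle_assoc,
        reassoc_of% ht, ← comp_whiskerRight_assoc, ← comp_whiskerRight_assoc, Category.assoc,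
        e_comp_id, MonoidalCategory.id_whiskerRight, Category.id_comp]
    · rw [← hg a, whiskerRight_gcomp, G.map_id, eId_gcomp, Iso.inv_hom_id_assoc]
  refine ⟨fun b c => ?_, fun {Z x} φ hφ => key φ fun b c => ?_⟩
  · exact (congrArg (fun t => t ≫ G.map b a) (lact_yoneda a b c)).trans (G.map_comp b c a)
  · exact (congrArg (fun t => t ▷ Z ≫ φ b) (lact_yoneda a b c)).symm.trans (hφ b c)

/-- The unit of a left Kan extension along a fully faithful functor is pointwise invertible:
`L (J a)` and `G a` are both the colimit of `G` weighted by `C(J -, J a) ≅ A(-, a)`. -/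
theorem IsLeftKanExtension.exists_unit_inverse {J : EnrichedFunctor V A C}
    (hJ : ∀ a b, IsIso (J.map a b)) {G : EnrichedFunctor V A B} {L : EnrichedFunctor V C B}
    {η : 𝟙_ V ⟶ (G ⟶[V] J.comp V L)} (h : IsLeftKanExtension J G L η) (a : A) :
    ∃ s : 𝟙_ V ⟶ (L.obj (J.obj a) ⟶[V] G.obj a),
      lmul (η ≫ natHom.π G (J.comp V L) a) s = eId V (G.obj a) ∧
        lmul s (η ≫ natHom.π G (J.comp V L) a) = eId V (L.obj (J.obj a)) := by
  rw [isLeftKanExtension_iff] at h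
  have he (b c : A) : lact (homTo J (J.obj a)) b c ≫
      @inv V _ (b ⟶[V] a) (J.obj b ⟶[V] J.obj a) (J.map b a) (hJ b a) =
      (b ⟶[V] c) ◁ @inv V _ (c ⟶[V] a) (J.obj c ⟶[V] J.obj a) (J.map c a) (hJ c a) ≫
        eComp V b c a := by
    have := hJ b a
    have := hJ c a
    obtain ⟨l, hl⟩ : ∃ l : (b ⟶[V] c) ⊗ (J.obj c ⟶[V] J.obj a) ⟶ (J.obj b ⟶[V] J.obj a),
      l = lact (homTo J (J.obj a)) b c := ⟨_, rfl⟩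
    have hl' : (b ⟶[V] c) ◁ J.map c a ≫ l = eComp V b c a ≫ J.map b a := by
      rw [hl, J.map_comp]
      exact whiskerLeft_lact_homTo _ _ _ _ _
    have hl'' : l ≫ inv (J.map b a) = (b ⟶[V] c) ◁ inv (J.map c a) ≫ eComp V b c a := by
      rw [IsIso.comp_inv_eq, Category.assoc, ← hl', ← MonoidalCategory.whiskerLeft_comp_assoc,
        IsIso.inv_hom_id, MonoidalCategory.whiskerLeft_id, Category.id_comp]
    exact (congrArg (fun t => t ≫ inv (J.map b a)) hl.symm).trans hl''
  have hr := (isColimitCocone_representable G a).reindex (F' := homTo J (J.obj a))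
    (fun b => (asIso (J.map b a)).symm) fun b c => by
      refine (he b c).trans (congrArg (fun t => _ ≫ t) (lact_yoneda a b c).symm)
  obtain ⟨s, t, hst, hts, hs⟩ := (h (J.obj a)).exists_iso hr
  obtain ⟨n, hn⟩ : ∃ n : 𝟙_ V ⟶ (G.obj a ⟶[V] L.obj (J.obj a)),
    n = η ≫ natHom.π G (J.comp V L) a := ⟨_, rfl⟩
  have hk : eId V (J.obj a) ≫ kanLeg η (J.obj a) a = n := by
    rw [kanLeg_eq]
    refine (comp_lmul _ _ _).trans ((congrArg (lmul _) (L.map_id (J.obj a))).trans ?_)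
    exact (lmul_eq_rmul _ _).trans ((rmul_eId _).trans hn.symm)
  have hns : lmul n s = eId V (G.obj a) := by
    have e1 : eId V (J.obj a) ≫ inv (J.map a a) = eId V a := by
      rw [IsIso.comp_inv_eq, J.map_id]
    calc lmul n s = rmul (eId V (J.obj a) ≫ kanLeg η (J.obj a) a) s := by
          rw [lmul_eq_rmul, hk]
      _ = eId V (J.obj a) ≫ rmul (kanLeg η (J.obj a) a) s := (comp_rmul _ _ _).symm
      _ = _ := (congrArg (fun t => eId V (J.obj a) ≫ t) (hs a)).trans
          ((Category.assoc _ _ _).symm.trans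
            ((congrArg (fun t => t ≫ G.map a a) e1).trans (G.map_id a)))
  have hnt : n = t := by
    have e := congrArg (fun m => lmul m t) hns
    simp only [← lmul_lmul, hst, lmul_eId] at e
    rwa [lmul_eq_rmul, rmul_eId] at e
  rw [← hn]
  exact ⟨s, hns, (congrArg (lmul s) hnt).trans hst⟩

end KanUnit

/-! ### The category of flat presheaves -/

section FlatPresheaves

variable {V : Type u} [Category.{v} V] [MonoidalCategory V] [SymmetricCategory V]
  [MonoidalClosed V] [Limits.HasLimits V]

/-- The inclusion of a full subcategory of a functor `V`-category. -/
def FunctorSub.incl {C : Type w} [EnrichedCategory V C] {D : Type w₁} [EnrichedCategory V D]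
    [∀ F G : EnrichedFunctor V C D, HasNatHom F G] (W : EnrichedFunctor V C D → Prop)
    [HasNatHoms W] : EnrichedFunctor V (FunctorSub W) (EnrichedFunctor V C D) where
  obj := FunctorSub.obj
  map F G := 𝟙 (natHom F.obj G.obj)
  map_id F := Category.comp_id _
  map_comp F G H := by
    refine (Category.comp_id _).trans (Eq.symm ?_)
    refine (congrArg (fun t => t ≫ _) (id_tensorHom_id _ _)).trans (Category.id_comp _)

variable {P : LimitIndexes V} {A : Type v} [EnrichedCategory V A]
variable {K : Type v} [EnrichedCategory V K]

/-- Flat colimits of flat presheaves exist in the presheaf category, and are flat. The tensor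
products that compute them pointwise exist because the index is flat. -/
theorem exists_flat_colimit {F : EnrichedFunctor V Kᵒᵖ V} (hF : IsFlat P K F)
    {G : EnrichedFunctor V K (EnrichedFunctor V Aᵒᵖ V)} (hG : ∀ k, IsFlat P A (G.obj k)) :
    ∃ (E : EnrichedFunctor V Aᵒᵖ V) (e : ∀ k, F.obj (op k) ⟶ (G.obj k ⟶[V] E)),
      IsColimitCocone F G E e ∧ IsFlat P A E := by
  obtain ⟨E, e, he, hp⟩ := exists_pointwise_colimit (F := F) (G := G)
    fun a => hF.exists_isTensor (evalAt G a) |>.imp fun t h => h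
  exact ⟨E, e, he, isFlat_of_colimit hF hG hp⟩

variable (P A) in
/-- The flat presheaves are the closure of `A` under flat colimits. Minimality holds because every
presheaf is the colimit of representables indexed by itself. -/
theorem isClosure_isFlat : IsClosure (flatIndexes P) (IsFlat P A) where
  replete F G := fun ⟨τ⟩ hF => by
    obtain ⟨e, he⟩ := τ.exists_legIso
    exact hF.of_legIso (fun k => (e k).symm) (lact_comp_inv he)
  representable := isFlat_yoneda P
  colimit K _ F hF G hG E ι hι := by
    obtain ⟨E', e', he', hE'⟩ := exists_flat_colimit hF hG
    obtain ⟨s, t, hst, hts, -⟩ := ((isIndexedColimit_iff ι).1 hι).exists_iso he'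
    exact hE'.of_lmul hst hts
  minimal W' hW' F hF := by
    obtain ⟨ι, hι, -⟩ := (isColimitCocone_yoneda F).exists_leg
    exact hW'.colimit A F hF (yoneda A) hW'.representable F ι hι

/-- A full subcategory reflects colimits. -/
theorem IsColimitCocone.of_incl {W : EnrichedFunctor V Aᵒᵖ V → Prop} {F : EnrichedFunctor V Kᵒᵖ V}
    {G : EnrichedFunctor V K (FunctorSub W)} {b : FunctorSub W}
    {c : ∀ k, F.obj (op k) ⟶ (G.obj k ⟶[V] b)}
    (h : IsColimitCocone F (G.comp V (FunctorSub.incl W)) b.obj c) : IsColimitCocone F G b c := by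
  have hG (k l : K) : (G.comp V (FunctorSub.incl W)).map k l = G.map k l := Category.comp_id _
  refine ⟨fun k l => (h.natural k l).trans ?_, fun {Z x} φ hφ => ?_⟩
  · exact congrArg (fun t => gcomp t (c l)) (hG k l)
  · refine h.existsUnique (Z := Z) (x := x.obj) φ fun k l => (hφ k l).trans ?_
    exact congrArg (fun t => (α_ _ _ _).hom ≫ gcomp t (φ l)) (hG k l).symm

theorem exists_colimit_flatCat {F : EnrichedFunctor V Kᵒᵖ V} (hF : IsFlat P K F)
    (G : EnrichedFunctor V K (FlatCat P A)) :
    ∃ (b : FlatCat P A) (c : ∀ k, F.obj (op k) ⟶ (G.obj k ⟶[V] b)),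
      IsColimitCocone F (G.comp V (FunctorSub.incl _)) b.obj c := by
  obtain ⟨E, e, he, hE⟩ := exists_flat_colimit hF
    (G := G.comp V (FunctorSub.incl (IsFlat P A))) fun k => (G.obj k).property
  exact ⟨⟨E, hE⟩, e, he⟩

/-- The inclusion of the flat presheaves into all presheaves preserves flat colimits. -/
theorem isColimitCocone_map_incl {F : EnrichedFunctor V Kᵒᵖ V} (hF : IsFlat P K F)
    {G : EnrichedFunctor V K (FlatCat P A)} {b : FlatCat P A}
    {c : ∀ k, F.obj (op k) ⟶ (G.obj k ⟶[V] b)} (h : IsColimitCocone F G b c) :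
    IsColimitCocone F (G.comp V (FunctorSub.incl _)) ((FunctorSub.incl _).obj b)
      (fun k => c k ≫ (FunctorSub.incl (IsFlat P A)).map (G.obj k) b) := by
  obtain ⟨b', c', h'⟩ := exists_colimit_flatCat hF G
  obtain ⟨s, t, hst, hts, hs⟩ := h'.of_incl.exists_iso h
  exact h'.ofIso (b' := b.obj) (s := s) (t := t) hst hts
    fun k => (hs k).trans (Category.comp_id (c k)).symm

variable (P A) in
/-- The Yoneda embedding of `A` into its category of flat presheaves. -/
abbrev flatYoneda : EnrichedFunctor V A (FlatCat P A) :=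
  FunctorSub.lift (yoneda A) (isFlat_yoneda P)

/-- By the Yoneda lemma, the presheaf `Flat(A)(J -, c)` is isomorphic to `c`. -/
theorem exists_homTo_flatYoneda_iso (c : FlatCat P A) :
    ∃ e : ∀ a, (homTo (flatYoneda P A) c).obj (op a) ≅ c.obj.obj (op a),
      (∀ a, (e a).inv = (yonedaIso c.obj a).hom) ∧ ∀ a b, lact (homTo (flatYoneda P A) c) a b ≫
        (e a).hom = (a ⟶[V] b) ◁ (e b).hom ≫ lact c.obj a b := by
  refine ⟨fun a => (yonedaIso c.obj a).symm, fun a => rfl, fun a b => ?_⟩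
  have h := whiskerLeft_lact_homTo (flatYoneda P A) c a b (yonedaIso c.obj b).hom
  have h' := h.trans (gcomp_yoneda_map_yonedaIso_hom c.obj b a)
  obtain ⟨l, hl⟩ : ∃ l : (a ⟶[V] b) ⊗ ((yoneda A).obj b ⟶[V] c.obj) ⟶
    ((yoneda A).obj a ⟶[V] c.obj), l = lact (homTo (flatYoneda P A) c) a b := ⟨_, rfl⟩
  have hl' : (a ⟶[V] b) ◁ (yonedaIso c.obj b).hom ≫ l =
    lact c.obj a b ≫ (yonedaIso c.obj a).hom := (congrArg (fun t => _ ≫ t) hl).trans h'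
  have key : l ≫ (yonedaIso c.obj a).inv =
      (a ⟶[V] b) ◁ (yonedaIso c.obj b).inv ≫ lact c.obj a b := by
    rw [Iso.comp_inv_eq, Category.assoc, ← hl', ← MonoidalCategory.whiskerLeft_comp_assoc,
      Iso.inv_hom_id, MonoidalCategory.whiskerLeft_id, Category.id_comp]
  exact (congrArg (fun t => t ≫ (yonedaIso c.obj a).inv) hl.symm).trans key

theorem isFlat_homTo_flatYoneda (c : FlatCat P A) :
    IsFlat P A (homTo (flatYoneda P A) c) := by
  obtain ⟨e, -, he⟩ := exists_homTo_flatYoneda_iso c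
  exact c.property.of_legIso e he

/-- Density of `A` in its flat presheaves: `c` is the colimit of `J` indexed by
`Flat(A)(J -, c)`. -/
theorem isColimitCocone_flatYoneda (c : FlatCat P A) :
    IsColimitCocone (homTo (flatYoneda P A) c) (flatYoneda P A) c
      (fun a => 𝟙 ((flatYoneda P A).obj a ⟶[V] c)) := by
  have hy := isColimitCocone_yoneda c.obj
  have h : IsColimitCocone c.obj (flatYoneda P A) c (fun a => (yonedaIso c.obj a).hom) :=
    ⟨hy.natural, fun {Z x} φ hφ => hy.existsUnique (x := x.obj) φ hφ⟩
  obtain ⟨e, hinv, he⟩ := exists_homTo_flatYoneda_iso c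
  have h' := h.reindex e he
  have hc : (fun a => (e a).hom ≫ (yonedaIso c.obj a).hom) =
      fun a => 𝟙 ((flatYoneda P A).obj a ⟶[V] c) := by
    funext a
    rw [← hinv]
    exact (e a).hom_inv_id
  exact hc ▸ h'

/-- A cocontinuous functor on the flat presheaves is the left Kan extension of its restriction
to `A`. -/
theorem IsCocontinuous.isColimitCocone_flatYoneda {B : Type w} [EnrichedCategory V B]
    {S : EnrichedFunctor V (FlatCat P A) B} (hS : IsCocontinuous (flatIndexes P) S)
    (c : FlatCat P A) :
    IsColimitCocone (homTo (flatYoneda P A) c) ((flatYoneda P A).comp V S) (S.obj c)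
      (fun a => S.map ((flatYoneda P A).obj a) c) := by
  have h := isCocontinuous_iff.1 hS A _ (isFlat_homTo_flatYoneda c) _ _ _
    (EnrichedFlat.isColimitCocone_flatYoneda c)
  have hc : (fun a => 𝟙 ((flatYoneda P A).obj a ⟶[V] c) ≫ S.map ((flatYoneda P A).obj a) c) =
      fun a => S.map ((flatYoneda P A).obj a) c := funext fun a => Category.id_comp _
  exact hc ▸ h

end FlatPresheaves

/-! ### Freeness of the category of flat presheaves -/

section FreeCocompletion

variable {V : Type u} [Category.{v} V] [MonoidalCategory V] [SymmetricCategory V]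
  [MonoidalClosed V] [Limits.HasLimits V]
variable {P : LimitIndexes V} {A : Type v} [EnrichedCategory V A]
variable {B : Type w} [EnrichedCategory V B]

/-- A left Kan extension `L` of `G` along the embedding of `A` into its flat presheaves preserves
flat colimits: `B(L c, x) ≅ [Aᵒᵖ, V](c, B(G -, x))` naturally in `c`, and flat colimits of flat
presheaves are formed in `[Aᵒᵖ, V]`. -/
theorem IsLeftKanExtension.isCocontinuous {G : EnrichedFunctor V A B}
    {L : EnrichedFunctor V (FlatCat P A) B} {η : 𝟙_ V ⟶ (G ⟶[V] (flatYoneda P A).comp V L)}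
    (h : IsLeftKanExtension (flatYoneda P A) G L η) : IsCocontinuous (flatIndexes P) L := by
  rw [isLeftKanExtension_iff] at h
  -- By the Yoneda lemma, `L c` is the colimit of `G` weighted by the presheaf `c`.
  let k (c : FlatCat P A) (a : A) : c.obj.obj (op a) ⟶ (G.obj a ⟶[V] L.obj c) :=
    (yonedaIso c.obj a).hom ≫ kanLeg η c a
  have hk (c : FlatCat P A) : IsColimitCocone c.obj G (L.obj c) (k c) := by
    obtain ⟨e, hinv, he⟩ := exists_homTo_flatYoneda_iso c
    have h' := (h c).reindex (fun a => (e a).symm) (lact_comp_inv he)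
    have hc : (fun a => (e a).symm.hom ≫ kanLeg η c a) = k c :=
      funext fun a => congrArg (fun t => t ≫ kanLeg η c a) (hinv a)
    exact hc ▸ h'
  have hk' (c c' : FlatCat P A) (a : A) : gcomp (k c a) (L.map c c') =
      papp (F := c.obj) (G := c'.obj) (𝟙 (natHom c.obj c'.obj)) a ≫ k c' a := by
    have h1 := gcomp_kanLeg η (c := c) (c' := c') (a := a) (yonedaIso c.obj a).hom (𝟙 (c ⟶[V] c'))
    rw [Category.id_comp] at h1
    refine h1.trans ?_
    refine (congrArg (fun t => t ≫ kanLeg η c' a)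
      (gcomp_yonedaIso_hom (F := c.obj) (F' := c'.obj) (𝟙 (natHom c.obj c'.obj)) a)).trans ?_
    exact Category.assoc _ _ _
  have hcocone (c : FlatCat P A) {Z : V} {x : B} (g : Z ⟶ (L.obj c ⟶[V] x)) (a b : A) :
      lact c.obj a b ▷ Z ≫ gcomp (k c a) g = (α_ _ _ _).hom ≫ (a ⟶[V] b) ◁ gcomp (k c b) g ≫
        lact (homTo G x) a b := by
    rw [whiskerRight_gcomp, (hk c).natural, gcomp_assoc]
    exact congrArg (fun t => (α_ _ _ _).hom ≫ t) (whiskerLeft_lact_homTo G x a b _).symm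
  -- The comparison `B(L c, x) ⟶ [Aᵒᵖ, V](c, B(G -, x))`, inverted by the universal property.
  let θ (c : FlatCat P A) (x : B) : (L.obj c ⟶[V] x) ⟶ natHom c.obj (homTo G x) :=
    plift (F := c.obj) (G := homTo G x) (fun a => gcomp (k c a) (𝟙 (L.obj c ⟶[V] x)))
      (hcocone c (𝟙 (L.obj c ⟶[V] x)))
  have hθ (c : FlatCat P A) (x : B) {Z : V} (g : Z ⟶ (L.obj c ⟶[V] x)) (a : A) :
      papp (F := c.obj) (G := homTo G x) (g ≫ θ c x) a = gcomp (k c a) g := by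
    refine (papp_comp (F := c.obj) (G := homTo G x) g (θ c x) a).trans ?_
    refine (congrArg (fun t => c.obj.obj (op a) ◁ g ≫ t)
      (papp_plift (F := c.obj) (G := homTo G x) _ (hcocone c (𝟙 (L.obj c ⟶[V] x))) a)).trans ?_
    exact (whiskerLeft_gcomp _ _ _).trans (congrArg (gcomp (k c a)) (Category.comp_id g))
  have hiso (c : FlatCat P A) (x : B) : IsIso (θ c x) := by
    rw [isIso_iff_existsUnique]
    intro Z y
    obtain ⟨g, hg, hu⟩ := (hk c).existsUnique
      (fun a => papp (F := c.obj) (G := homTo G x) y a) (fun a b =>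
        (papp_natural (F := c.obj) (G := homTo G x) y a b).trans
          (congrArg (fun t => (α_ _ _ _).hom ≫ t) (whiskerLeft_lact_homTo G x a b _)))
    refine ⟨g, papp_ext fun a => (hθ c x g a).trans (hg a), fun g' hg' => hu g' fun a => ?_⟩
    subst hg'
    exact (hθ c x g' a).symm
  rw [isCocontinuous_iff]
  intro K _ F hF D E e he
  refine IsColimitCocone.map_of_relativeAdjoint L (FunctorSub.incl (IsFlat P A)) he.natural
    (isColimitCocone_map_incl hF he) (fun x => homTo G x)
    (fun c x => @asIso V _ _ _ (θ c x) (hiso c x)) fun c c' x => ?_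
  refine papp_ext fun a => ?_
  refine (hθ c x _ a).trans ?_
  have h1 : gcomp (k c a) (gcomp (L.map c c') (𝟙 (L.obj c' ⟶[V] x))) = (α_ _ _ _).inv ≫
      papp (F := c.obj) (G := c'.obj) (𝟙 (natHom c.obj c'.obj)) a ▷ (L.obj c' ⟶[V] x) ≫
        gcomp (k c' a) (𝟙 (L.obj c' ⟶[V] x)) := by
    rw [Iso.eq_inv_comp, ← gcomp_assoc, hk', whiskerRight_gcomp]
  have h2 := hθ c' x (𝟙 (L.obj c' ⟶[V] x)) a
  rw [Category.id_comp] at h2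
  refine h1.trans (Eq.trans ?_ (papp_gcomp (F := c.obj) (G := c'.obj) (H := homTo G x)
    (𝟙 (natHom c.obj c'.obj)) (θ c' x) a).symm)
  exact congrArg (fun t => (α_ _ _ _).inv ≫ papp (F := c.obj) (G := c'.obj)
    (𝟙 (natHom c.obj c'.obj)) a ▷ (L.obj c' ⟶[V] x) ≫ t) h2.symm

theorem isIso_flatYoneda_map (a b : A) : IsIso ((flatYoneda P A).map a b) :=
  isIso_yoneda_map a b

/-- The hom-objects `[Flat(A), B](S, T)` exist for cocontinuous `S`, although `Flat(A)` is large. -/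
theorem hasNatHoms_isCocontinuous :
    HasNatHoms (IsCocontinuous (flatIndexes P) (B := FlatCat P A) (C := B)) :=
  ⟨fun _ T hS _ => hasNatHom_of_extension hS.isColimitCocone_flatYoneda T⟩

theorem IsCocontinuous.hasLeftKanExtension {S : EnrichedFunctor V (FlatCat P A) B}
    (hS : IsCocontinuous (flatIndexes P) S) :
    HasLeftKanExtension (flatYoneda P A) ((flatYoneda P A).comp V S) :=
  hasLeftKanExtension_of_colimits _ _ fun c => ⟨_, _, hS.isColimitCocone_flatYoneda c⟩

theorem isCocomplete_flatCat : IsCocomplete (flatIndexes P) (FlatCat P A) :=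
  isCocomplete_iff.2 fun _ _ _ hF G =>
    let ⟨b, c, h⟩ := exists_colimit_flatCat hF G
    ⟨b, c, h.of_incl⟩

/-- The unit of a left Kan extension along the embedding of `A` into its flat presheaves has an
inverse in the functor category. -/
theorem IsLeftKanExtension.exists_flatYoneda_unit_inverse {G : EnrichedFunctor V A B}
    {L : EnrichedFunctor V (FlatCat P A) B} {η : 𝟙_ V ⟶ (G ⟶[V] (flatYoneda P A).comp V L)}
    (h : IsLeftKanExtension (flatYoneda P A) G L η) :
    ∃ η' : 𝟙_ V ⟶ ((flatYoneda P A).comp V L ⟶[V] G),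
      lmul η η' = eId V G ∧ lmul η' η = eId V ((flatYoneda P A).comp V L) := by
  choose σ h₁ h₂ using fun a => h.exists_unit_inverse isIso_flatYoneda_map a
  have hσ : natHom.IsNatural ((flatYoneda P A).comp V L) G σ :=
    isNatural_inverse ((natHom.π_natural _ _).precomp η) h₁ h₂
  have hπ (F F' F'' : EnrichedFunctor V A B) (f : 𝟙_ V ⟶ (F ⟶[V] F'))
      (g : 𝟙_ V ⟶ (F' ⟶[V] F'')) (a : A) : lmul f g ≫ natHom.π F F'' a =
        lmul (f ≫ natHom.π F F' a) (g ≫ natHom.π F' F'' a) := by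
    rw [lmul, lmul, Category.assoc, gcomp, Category.assoc, eComp_π,
      MonoidalCategory.tensorHom_comp_tensorHom_assoc, gcomp]
  have hl (a : A) : natHom.lift σ hσ ≫ natHom.π ((flatYoneda P A).comp V L) G a = σ a :=
    natHom.lift_π (F := (flatYoneda P A).comp V L) (G := G) σ hσ a
  refine ⟨natHom.lift σ hσ, natHom.hom_ext fun a => ?_, natHom.hom_ext fun a => ?_⟩
  · exact (hπ _ _ _ _ _ a).trans (((congrArg (lmul _) (hl a)).trans (h₁ a)).trans
      (eId_π G a).symm)
  · exact (hπ _ _ _ _ _ a).trans (((congrArg (fun t => lmul t _) (hl a)).trans (h₂ a)).trans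
      (eId_π ((flatYoneda P A).comp V L) a).symm)

/-- Restriction to `A` is fully faithful on cocontinuous functors, and left Kan extensions, which
are cocontinuous and have invertible units, provide a quasi-inverse. -/
theorem isFreeCocompletion_flatYoneda :
    IsFreeCocompletion.{v, u, max u v, w} (flatIndexes P) (flatYoneda P A) where
  fullyFaithful := isIso_flatYoneda_map
  cocomplete := isCocomplete_flatCat
  universal B _ := by
    have := hasNatHoms_isCocontinuous (P := P) (A := A) (B := B)
    have h (S : EnrichedFunctor V (FlatCat P A) B) (hS : IsCocontinuous (flatIndexes P) S) :=
      hS.hasLeftKanExtension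
    let R := restriction (flatYoneda P A) (IsCocontinuous (flatIndexes P))
      (HasLeftKanExtension (flatYoneda P A) (B := B)) h
    have hR (S T) : IsIso (R.map S T) := isIso_restrictionMap
      S.property.isColimitCocone_flatYoneda T.obj
    choose L η hη using fun G : FunctorSub (HasLeftKanExtension (flatYoneda P A) (B := B)) =>
      G.property
    choose η' h₁ h₂ using fun G => (hη G).exists_flatYoneda_unit_inverse
    let L' (G : FunctorSub (HasLeftKanExtension (flatYoneda P A) (B := B))) :
      FunctorSub (IsCocontinuous (flatIndexes P) (B := FlatCat P A) (C := B)) :=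
        ⟨L G, (hη G).isCocontinuous⟩
    exact ⟨this, h, inverseOfFullyFaithful R hR L' η η' h₁ h₂,
      inverseUnit R hR L' η η' h₁ h₂, nonempty_inverseCounit R hR L' η η' h₁ h₂, hη⟩
  hasLeftKanExtension B _ hB G := hasLeftKanExtension_of_colimits _ _ fun c =>
    isCocomplete_iff.1 hB A _ (isFlat_homTo_flatYoneda c) G

end FreeCocompletion

end

end EnrichedFlat

theorem mainTheorem1 {V : Type u} [Category.{v} V] [MonoidalCategory V] [SymmetricCategory V]
    [MonoidalClosed V] [Limits.HasLimits V] (P : EnrichedFlat.LimitIndexes V)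
    (A : Type v) [EnrichedCategory V A] :
    EnrichedFlat.IsClosure (EnrichedFlat.flatIndexes P) (EnrichedFlat.IsFlat P A) ∧
    ∃ h : ∀ a : A, EnrichedFlat.IsFlat P A ((EnrichedFlat.yoneda A).obj a),
      EnrichedFlat.IsFreeCocompletion.{v, u, max u v, w} (EnrichedFlat.flatIndexes P)
        (EnrichedFlat.FunctorSub.lift (EnrichedFlat.yoneda A) h :
          EnrichedFunctor V A (EnrichedFlat.FlatCat P A)) :=
  ⟨EnrichedFlat.isClosure_isFlat P A, EnrichedFlat.isFlat_yoneda P,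
    EnrichedFlat.isFreeCocompletion_flatYoneda⟩
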